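/- Let $m,n\ge 2$ be integers and let $(M,g)$, $(N,h)$ be Einstein manifolds of dimensions $m,n$ with $\mathrm{Ric}_g=-(m+n-1)g$, $\mathrm{Ric}_h=-(m+n-1)h$. Consider solutions $-dt^2+a(t)^2g+b(t)^2h$, $0<t<\infty$, $a,b>0$, of the vacuum Einstein equations: with $p=-\dot a/a$, $q=-\dot b/b$ and $H=mp+nq<0$ these are $$\dot p=pH-\tfrac{m+n-1}{a^2},\quad \dot q=qH-\tfrac{m+n-1}{b^2},\quad H^2-(mp^2+nq^2)=(m+n-1)\Big(\tfrac{m}{a^2}+\tfrac{n}{b^2}\Big).$$ Put $A=-\frac1{aH}$, $B=-\frac1{bH}$, $P=\frac pH$, $Q=\frac qH$, $d\tau=H\,dt$, $s=mP^2+nQ^2$. Then $(A,B,P,Q)(\tau)$ solves $$A'=A(P-s),\quad B'=B(Q-s),\quad P'=P(1-s)-(m+n-1)A^2,\quad Q'=Q(1-s)-(m+n-1)B^2$$ on $\mathcal S=\{A>0,\ B>0,\ mP+nQ=1,\ s+(m+n-1)(mA^2+nB^2)=1\}$; an orbit is a solution in $\mathcal S$ defined for all $\tau\in\mathbb R$;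 a solution $(a,b)$ corresponds to an orbit if it runs through the whole orbit, so that $\tau\to\infty$ is the singularity $t\to0$ and $\tau\to-\infty$ is $t\to\infty$. Let $F_1,F_2$ be the points with $A=B=0$, $mP+nQ=1=mP^2+nQ^2$ and $P>0$, respectively $P<0$, and let $F_A$ be the point with $A=P=0$, $Q=\frac1n$, $B^2=\frac{n-1}{n^2(m+n-1)}$. The open edges of $\overline{\mathcal S}$ are $E_A=\overline{\mathcal S}\cap\{A=0,B>0\}$ and $E_B=\overline{\mathcal S}\cap\{A>0,B=0\}$. The reduced model is $-d\bar t^2+\bar a^2g$ with $\bar a=a\,b^{n/(m-1)}$, $d\bar t=b^{n/(m-1)}dt$; it is accelerating (decelerating) at $t$ if there $d\bar a/d\bar t>0$ and $d^2\bar a/d\bar t^2>0$ ($<0$). Statements about an orbit are about all corresponding models. Then: 1. Every orbit corresponds to a vacuum solution. The points of $\mathcal S$ on orbits converging to $F_1$ or $F_2$ as $\tau\to\infty$ (the generic orbits) form a relatively open and dense subset of $\mathcal S$, and no generic orbit gives a model that is accelerating for all $t>0$. Assume in addition $m+n\ge9$ and $(m,n)\notin\{(2,7),(7,2)\}$. 2.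 For every orbit converging to $F_1$ the set of times of accelerated expansion is an interval $(t_i,t_o)$ with $0<t_i<t_o<\infty$ (finite phase) or an interval $(t_i,\infty)$ with $0<t_i<\infty$ (late phase). There is an open $U\supseteq E_A$ such that every orbit converging to $F_1$ that meets $U$ has a finite phase; the part of $\mathcal S$ filled by the finite-phase orbits ending at $F_1$ is nonempty and connected. If $(m,n)\notin\{(2,8),(3,6)\}$, there is an open $V\supseteq E_B$ such that every orbit converging to $F_1$ that meets $V$ has a late phase, and the part of $\mathcal S$ filled by the late-phase orbits ending at $F_1$ is nonempty and connected. 3. Every orbit converging to $F_2$ either is decelerating for all $t>0$, or has a late phase: it is accelerating exactly for $t\in(t_i,\infty)$, $0<t_i<\infty$. There is an open $V\supseteq E_B$ such that every orbit converging to $F_2$ that meets $V$ has a late phase; the part of $\mathcal S$ filled by the late-phase orbits ending at $F_2$ is nonempty and connected. If $(m,n)\notin\{(8,2),(6,3)\}$, there is an open $U\supseteq E_A$ such that every orbit converging to $F_2$ that meets $U$ is decelerating for all $t>0$, and the part of $\mathcal S$ filled by the purely decelerating orbits ending at $F_2$ is nonempty and connected. 4. Every orbit converging to $F_A$ is decelerating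 for all $t>0$. -/

import Mathlib

open Filter Topology Set

namespace DoublyWarped

noncomputable section

/-! ### The reduced dynamical system (negative Einstein curvature of both factors) -/

/-- A state `(A, B, P, Q)`. -/
abbrev State : Type := ℝ × ℝ × ℝ × ℝ

/-- `m P² + n Q²`. -/
def sumSq (m n : ℕ) (P Q : ℝ) : ℝ := m * P ^ 2 + n * Q ^ 2

/-- The right-hand side of the evolution equations for `(A, B, P, Q)`, with `k_g = k_h = -1`. -/
def field (m n : ℕ) : State → State := fun (A, B, P, Q) =>
  (A * (P - sumSq m n P Q),
   B * (Q - sumSq m n P Q),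
   P * (1 - sumSq m n P Q) - ((m : ℝ) + n - 1) * A ^ 2,
   Q * (1 - sumSq m n P Q) - ((m : ℝ) + n - 1) * B ^ 2)

/-- The trace constraint and the Hamiltonian constraint, with `k_g = k_h = -1`. -/
def Constraints (m n : ℕ) : State → Prop := fun (A, B, P, Q) =>
  m * P + n * Q - 1 = 0 ∧
  sumSq m n P Q + ((m : ℝ) + n - 1) * (m * A ^ 2 + n * B ^ 2) - 1 = 0

/-- The physical state space. -/
def stateSpace (m n : ℕ) : Set State :=
  {x | Constraints m n x ∧ 0 < x.1 ∧ 0 < x.2.1}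

/-- The open edge `A = 0`, `B > 0` of the closed state space (its end points are `F₁`, `F₂`). -/
def edgeA (m n : ℕ) : Set State :=
  {x | Constraints m n x ∧ x.1 = 0 ∧ 0 < x.2.1}

/-- The open edge `B = 0`, `A > 0` of the closed state space (its end points are `F₁`, `F₂`). -/
def edgeB (m n : ℕ) : Set State :=
  {x | Constraints m n x ∧ 0 < x.1 ∧ x.2.1 = 0}

/-- The Kasner fixed point with `P > 0`, `Q < 0`. -/
def F₁ (m n : ℕ) : State :=
  (0, 0, (1 + n * √(((m : ℝ) + n - 1) / (m * n))) / (m + n),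
    (1 - m * √(((m : ℝ) + n - 1) / (m * n))) / (m + n))

/-- The Kasner fixed point with `P < 0`, `Q > 0`. -/
def F₂ (m n : ℕ) : State :=
  (0, 0, (1 - n * √(((m : ℝ) + n - 1) / (m * n))) / (m + n),
    (1 + m * √(((m : ℝ) + n - 1) / (m * n))) / (m + n))

/-- The fixed point in the interior of the edge `A = 0`. -/
def F_A (m n : ℕ) : State :=
  (0, √(((n : ℝ) - 1) / (n ^ 2 * ((m : ℝ) + n - 1))), 0, 1 / n)

/-- A complete orbit `τ ↦ (A, B, P, Q)(τ)` of the dynamical system in the physical state space. -/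
def IsOrbit (m n : ℕ) (X : ℝ → State) : Prop :=
  ∀ τ, X τ ∈ stateSpace m n ∧ HasDerivAt X (field m n (X τ)) τ

/-- The orbit converges to `F` as `τ → ∞`. -/
def ConvergesTo (X : ℝ → State) (F : State) : Prop := Tendsto X atTop (𝓝 F)

/-! ### Vacuum doubly warped products `-dt² + a² g + b² h` -/

/-- `p = -ȧ/a` (and, for `b`, `q = -ḃ/b`). -/
def rate (a : ℝ → ℝ) (t : ℝ) : ℝ := -deriv a t / a t

/-- The mean curvature `H = m p + n q`. -/
def meanCurv (m n : ℕ) (a b : ℝ → ℝ) (t : ℝ) : ℝ := m * rate a t + n * rate b t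

/-- `a`, `b` are the scale factors on `0 < t < ∞` of an expanding solution (`H < 0`) of the vacuum
Einstein equations for `-dt² + a² g + b² h`, where `Ric_g = -(m+n-1) g`, `Ric_h = -(m+n-1) h`,
`dim g = m`, `dim h = n`. -/
structure IsVacuum (m n : ℕ) (a b : ℝ → ℝ) : Prop where
  a_pos : ∀ t, 0 < t → 0 < a t
  b_pos : ∀ t, 0 < t → 0 < b t
  a_diff : ∀ t, 0 < t → DifferentiableAt ℝ a t
  b_diff : ∀ t, 0 < t → DifferentiableAt ℝ b t
  evol_p : ∀ t, 0 < t → HasDerivAt (rate a)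
    (rate a t * meanCurv m n a b t - ((m : ℝ) + n - 1) / a t ^ 2) t
  evol_q : ∀ t, 0 < t → HasDerivAt (rate b)
    (rate b t * meanCurv m n a b t - ((m : ℝ) + n - 1) / b t ^ 2) t
  hamiltonian : ∀ t, 0 < t →
    -(m * ((m : ℝ) + n - 1)) / a t ^ 2 - (n * ((m : ℝ) + n - 1)) / b t ^ 2
      + meanCurv m n a b t ^ 2 - (m * rate a t ^ 2 + n * rate b t ^ 2) = 0
  expanding : ∀ t, 0 < t → meanCurv m n a b t < 0

/-- The scale invariant variables
`A = -1/(aH)`, `B = -1/(bH)`, `P = p/H`, `Q = q/H` at proper time `t`. -/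
def stateAt (m n : ℕ) (a b : ℝ → ℝ) (t : ℝ) : State :=
  (-1 / (a t * meanCurv m n a b t), -1 / (b t * meanCurv m n a b t),
    rate a t / meanCurv m n a b t, rate b t / meanCurv m n a b t)

/-- The vacuum solution `a, b` on `0 < t < ∞` corresponds to the orbit `X`: in the time `τ` with
`dτ/dt = H`, its scale invariant variables run through the whole orbit `X`.
Since `H < 0`, `τ → ∞` is the singularity `t → 0` and `τ → -∞` is `t → ∞`. -/
def Corresponds (m n : ℕ) (X : ℝ → State) (a b : ℝ → ℝ) : Prop :=
  IsVacuum m n a b ∧ ∃ τ : ℝ → ℝ,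
    (∀ t, 0 < t → HasDerivAt τ (meanCurv m n a b t) t) ∧
    τ '' Ioi 0 = univ ∧
    ∀ t, 0 < t → stateAt m n a b t = X (τ t)

/-! ### The dimensionally reduced model `-dt̄² + ā² g` -/

/-- `dt̄/dt = b^{n/(m-1)}`. -/
def lapse (m n : ℕ) (b : ℝ → ℝ) (t : ℝ) : ℝ := b t ^ ((n : ℝ) / ((m : ℝ) - 1))

/-- The reduced scale factor `ā = a b^{n/(m-1)}`, as a function of `t`. -/
def redScale (m n : ℕ) (a b : ℝ → ℝ) (t : ℝ) : ℝ := a t * lapse m n b t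

/-- The derivative `df/dt̄ = (df/dt) / (dt̄/dt)`, as a function of `t`. -/
def dbar (m n : ℕ) (b : ℝ → ℝ) (f : ℝ → ℝ) (t : ℝ) : ℝ := deriv f t / lapse m n b t

/-- Accelerated expansion at `t`: `dā/dt̄ > 0` and `d²ā/dt̄² > 0`. -/
def AccelAt (m n : ℕ) (a b : ℝ → ℝ) (t : ℝ) : Prop :=
  0 < dbar m n b (redScale m n a b) t ∧
  0 < dbar m n b (dbar m n b (redScale m n a b)) t

/-- Decelerating expansion at `t`: `dā/dt̄ > 0` and `d²ā/dt̄² < 0`. -/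
def DecelAt (m n : ℕ) (a b : ℝ → ℝ) (t : ℝ) : Prop :=
  0 < dbar m n b (redScale m n a b) t ∧
  dbar m n b (dbar m n b (redScale m n a b)) t < 0

/-- The set of all times `t > 0` of accelerated expansion. -/
def accelTimes (m n : ℕ) (a b : ℝ → ℝ) : Set ℝ := {t | 0 < t ∧ AccelAt m n a b t}

/-- The models of `X` accelerate exactly in a phase `(tᵢ, tₒ)` with `0 < tᵢ < tₒ < ∞`. -/
def FinitePhase (m n : ℕ) (X : ℝ → State) : Prop :=
  ∀ a b, Corresponds m n X a b →
    ∃ tᵢ tₒ, 0 < tᵢ ∧ tᵢ < tₒ ∧ accelTimes m n a b = Ioo tᵢ tₒ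

/-- The models of `X` accelerate exactly in a phase `(tᵢ, ∞)` with `0 < tᵢ < ∞`. -/
def LatePhase (m n : ℕ) (X : ℝ → State) : Prop :=
  ∀ a b, Corresponds m n X a b → ∃ tᵢ, 0 < tᵢ ∧ accelTimes m n a b = Ioi tᵢ

/-- The models of `X` are decelerating at all times. -/
def Decelerating (m n : ℕ) (X : ℝ → State) : Prop :=
  ∀ a b, Corresponds m n X a b → ∀ t, 0 < t → DecelAt m n a b t

/-- The part of the state space filled by the orbits that converge to `F` and satisfy `R`. -/
def orbitFamily (m n : ℕ) (F : State) (R : (ℝ → State) → Prop) : Set State :=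
  {x | ∃ X, IsOrbit m n X ∧ X 0 = x ∧ ConvergesTo X F ∧ R X}

/-- The part of the state space filled by the generic orbits, i.e. those ending at `F₁` or `F₂`. -/
def genericSet (m n : ℕ) : Set State :=
  orbitFamily m n (F₁ m n) (fun _ => True) ∪ orbitFamily m n (F₂ m n) (fun _ => True)

/-- All orbits that end at `F` and pass close to the edge `E` satisfy `R`. -/
def HoldsNear (m n : ℕ) (F : State) (E : Set State) (R : (ℝ → State) → Prop) : Prop :=
  ∃ U : Set State, IsOpen U ∧ E ⊆ U ∧
    ∀ X, IsOrbit m n X → ConvergesTo X F → (∃ τ, X τ ∈ U) → R X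

end

end DoublyWarped

open DoublyWarped

open DoublyWarped

namespace DoublyWarped

/-! ### Real analysis tools -/

/-! The constraints reduce the system to the plane. With `f = (A² - B²)/(m A² + n B²)`, `x = P - Q`
and `D = m + n - 1 - m n x²` it reads `(m+n) f' = 2 (1 + n f)(1 - m f) x`, `(m+n) x' = D (x - f)` on
the open rectangle `-1/n < f < 1/m`, `D > 0`. The sides `f = 1/m` and `f = -1/n` are the edges `B =
0` and `A = 0`; on `D = 0` lie the Kasner points `F₁` (right, `x > 0`) and `F₂`; each edge carries
one saddle, at `x = f`. Exchanging the two factors is the symmetry `(f, x, m, n) ↦ (-f, -x, n, m)`,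
so every statement about `F₁` has a mirror image about `F₂`.

The function `lyap`, a multiple of `log (A^m B^n)` up to a constant, decreases with derivative `-2 m
n x²` and is maximal at the origin. By Barbalat's lemma every orbit starts at the origin (`t → ∞`),
and along a nonconstant orbit `lyap → -∞`. Orbits reaching `x ≥ 1/m` have `x > f` from then on and
end at `F₁`. The others, apart from those ending at `F₂`, stay in the strip `-1/n ≤ x ≤ 1/m` and
drift to an edge. There the saddle expands vertical distances exponentially, so no open set of
orbits can be trapped; this gives density of the generic orbits.

For `m + n ≥ 9` the origin is a node rather than a focus. Curves `x = μ f/(1 + β f)`, crossed only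
upwards, then exclude any turning back: a nonconstant orbit has `x > 0` throughout, or `x < 0`
throughout, or changes sign exactly once (`PlanarOrbit.cases`). A barrier ending at the saddle (`β =
m (μ - 1)`) forces the orbits crossing upwards to `F₁`; a barrier ending above it (`β` smaller)
keeps them away from the edge `B = 0` and supplies orbits that go to `F₁` with `x > 0` throughout.
The excluded pairs `(m, n)` are those where these polynomial barriers fail.

The sign of the acceleration is that of `accel`, which along an orbit satisfies a linear equation
with forcing `-2 (m+n-1) x (1 - m x)²` (`deriv_accel`). Hence its positivity propagates backwards in
`τ` where `x ≥ 0` and forwards where `x ≤ 0`, while `accel < 0` near `F₁`, `F₂` and `F_A`. This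
yields one type of phase for each type of orbit. Connectedness holds because each family is a
continuous image, under the flow, of `ℝ` times an interval on a transversal line. -/

theorem hasDerivAt_comp_neg' {E : Type*} [NormedAddCommGroup E] [NormedSpace ℝ E] {Z : ℝ → E}
    {Z' : E} {s : ℝ} (hZ : HasDerivAt Z Z' (-s)) : HasDerivAt (fun s => Z (-s)) (-Z') s := by
  have := hZ.scomp s (hasDerivAt_neg s)
  rwa [neg_one_smul] at this

/-- **Barbalat's lemma**: if `g` converges and its derivative is Lipschitz, the latter tends to `0`. -/
theorem tendsto_deriv_zero_of_tendsto {g g' g'' : ℝ → ℝ} {K l : ℝ}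
    (hg : ∀ t, HasDerivAt g (g' t) t) (hg' : ∀ t, HasDerivAt g' (g'' t) t)
    (hK : ∀ t, |g'' t| ≤ K) (hl : Tendsto g atTop (𝓝 l)) : Tendsto g' atTop (𝓝 0) := by
  have hK0 : 0 ≤ K := (abs_nonneg _).trans (hK 0)
  rw [Metric.tendsto_atTop]
  intro ε hε
  -- Over a length `h` the derivative varies by at most `K h < ε/2`, so a mean slope below `ε/2`
  -- keeps `g'` below `ε`. The `1` in `K + 1` allows `K = 0`.
  set h : ℝ := ε / (2 * (K + 1)) with hh
  have hpos : 0 < h := by positivity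
  have hKh : K * h < ε / 2 := by
    have : (K + 1) * h = ε / 2 := by rw [hh]; field_simp
    nlinarith
  have hlim : Tendsto (fun t => g (t + h) - g t) atTop (𝓝 0) := by
    simpa using (hl.comp (tendsto_atTop_add_const_right atTop h tendsto_id)).sub hl
  obtain ⟨N, hN⟩ := (Metric.tendsto_atTop.1 hlim) (h * (ε / 2)) (by positivity)
  refine ⟨N, fun t ht => ?_⟩
  have h1 := hN t ht
  rw [Real.dist_eq, sub_zero] at h1 ⊢
  obtain ⟨ξ, hξ, hd⟩ := exists_hasDerivAt_eq_slope g g' (by linarith : t < t + h)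
    (fun s _ => (hg s).continuousAt.continuousWithinAt) (fun s _ => hg s)
  have h2 : |g' ξ| < ε / 2 := by
    rw [hd, add_sub_cancel_left, abs_div, abs_of_pos hpos, div_lt_iff₀ hpos]
    linarith
  have h3 : ‖g' ξ - g' t‖ ≤ K * ‖ξ - t‖ :=
    (convex_univ (𝕜 := ℝ)).norm_image_sub_le_of_norm_hasDerivWithin_le (f' := g'')
      (fun s _ => (hg' s).hasDerivWithinAt) (fun s _ => hK s) (mem_univ _) (mem_univ _)
  rw [Real.norm_eq_abs, Real.norm_eq_abs, abs_of_pos (by linarith [hξ.1] : 0 < ξ - t)] at h3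
  have h4 : K * (ξ - t) ≤ K * h := mul_le_mul_of_nonneg_left (by linarith [hξ.2]) hK0
  have h5 : |g' t| ≤ |g' ξ| + |g' ξ - g' t| := by
    rw [abs_sub_comm]; linarith [abs_sub_abs_le_abs_sub (g' t) (g' ξ)]
  linarith

theorem tendsto_deriv_zero_of_tendsto_atBot {g g' g'' : ℝ → ℝ} {K l : ℝ}
    (hg : ∀ t, HasDerivAt g (g' t) t) (hg' : ∀ t, HasDerivAt g' (g'' t) t)
    (hK : ∀ t, |g'' t| ≤ K) (hl : Tendsto g atBot (𝓝 l)) : Tendsto g' atBot (𝓝 0) := by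
  have h := tendsto_deriv_zero_of_tendsto (g := fun t => g (-t)) (g' := fun t => -g' (-t))
    (g'' := fun t => g'' (-t)) (K := K) (l := l)
    (fun t => hasDerivAt_comp_neg' (hg (-t)))
    (fun t => by simpa using (hasDerivAt_comp_neg' (hg' (-t))).fun_neg)
    (fun t => hK _) (hl.comp tendsto_neg_atTop_atBot)
  simpa [Function.comp_def] using (h.neg).comp tendsto_neg_atBot_atTop

theorem tendsto_deriv_zero {g g' g'' : ℝ → ℝ} {K c : ℝ} {l : Filter ℝ} (hl : l = atTop ∨ l = atBot)
    (hg : ∀ t, HasDerivAt g (g' t) t) (hg' : ∀ t, HasDerivAt g' (g'' t) t)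
    (hK : ∀ t, |g'' t| ≤ K) (hc : Tendsto g l (𝓝 c)) : Tendsto g' l (𝓝 0) := by
  rcases hl with rfl | rfl
  · exact tendsto_deriv_zero_of_tendsto hg hg' hK hc
  · exact tendsto_deriv_zero_of_tendsto_atBot hg hg' hK hc

/-- A function with `a u ≤ u'` grows at least exponentially. -/
theorem exists_mul_le_of_mul_le_deriv {u u' a : ℝ → ℝ} {s t : ℝ} (hst : s ≤ t)
    (hu : ∀ τ ∈ Icc s t, HasDerivAt u (u' τ) τ) (ha : ContinuousOn a (Icc s t))
    (h : ∀ τ ∈ Icc s t, a τ * u τ ≤ u' τ) : ∃ E > 0, u s * E ≤ u t := by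
  -- The coefficient is extended constantly beyond the interval, so that its primitive is
  -- differentiable at the end points too.
  set b : ℝ → ℝ := IccExtend hst (domRestrict (Icc s t) a) with hb
  have hbc : Continuous b := ContinuousOn.domRestrict ha |>.Icc_extend'
  have hba : ∀ τ ∈ Icc s t, b τ = a τ := fun τ hτ => by
    rw [hb, IccExtend_of_mem _ _ hτ]; rfl
  set F : ℝ → ℝ := fun τ => ∫ σ in s..τ, b σ with hF
  have hFd : ∀ τ, HasDerivAt F (b τ) τ := fun τ =>
    intervalIntegral.integral_hasDerivAt_right (hbc.intervalIntegrable _ _)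
      (hbc.stronglyMeasurableAtFilter _ _) hbc.continuousAt
  have hv : ∀ τ ∈ Icc s t, HasDerivAt (fun τ => u τ * Real.exp (-F τ))
      ((u' τ - a τ * u τ) * Real.exp (-F τ)) τ := fun τ hτ => by
    have := (hu τ hτ).mul ((hFd τ).fun_neg.exp)
    rw [hba τ hτ] at this
    convert! this using 1
    ring
  have hmono : MonotoneOn (fun τ => u τ * Real.exp (-F τ)) (Icc s t) := by
    refine monotoneOn_of_deriv_nonneg (convex_Icc s t) (HasDerivAt.continuousOn hv)
      (fun τ hτ => (hv τ (interior_subset hτ)).differentiableAt.differentiableWithinAt) ?_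
    intro τ hτ
    have hτ' := interior_subset hτ
    rw [(hv τ hτ').deriv]
    exact mul_nonneg (by linarith [h τ hτ']) (Real.exp_pos _).le
  have h1 := hmono (left_mem_Icc.2 hst) (right_mem_Icc.2 hst) hst
  have h0 : F s = 0 := by simp [hF]
  simp only [h0, neg_zero, Real.exp_zero, mul_one] at h1
  refine ⟨Real.exp (F t), Real.exp_pos _, ?_⟩
  calc u s * Real.exp (F t) ≤ u t * Real.exp (-F t) * Real.exp (F t) := by gcongr
    _ = u t := by rw [mul_assoc, ← Real.exp_add]; simp

/-- A continuous function which is positive at `s` and nonpositive at `t ≥ s` has a first zero. -/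
theorem exists_first_zero {u : ℝ → ℝ} (hu : Continuous u) {s t : ℝ} (hst : s ≤ t) (hs : 0 < u s)
    (ht : u t ≤ 0) : ∃ r, s < r ∧ r ≤ t ∧ u r = 0 ∧ ∀ τ ∈ Ico s r, 0 < u τ := by
  set S := {τ | u τ ≤ 0} ∩ Icc s t with hS
  have hSc : IsCompact S := isCompact_Icc.inter_left (isClosed_le hu continuous_const)
  obtain ⟨r, hr, hmin⟩ := hSc.exists_isLeast ⟨t, ht, hst, le_rfl⟩
  have hbefore : ∀ τ ∈ Ico s r, 0 < u τ := fun τ hτ => by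
    by_contra hc
    exact absurd (hmin ⟨not_lt.1 hc, hτ.1, hτ.2.le.trans hr.2.2⟩) (not_le.2 hτ.2)
  have hsr : s < r := lt_of_le_of_ne hr.2.1 (by rintro rfl; exact absurd hr.1 (not_le.2 hs))
  refine ⟨r, hsr, hr.2.2, le_antisymm hr.1 ?_, hbefore⟩
  have : Tendsto u (𝓝[<] r) (𝓝 (u r)) := hu.continuousAt.mono_left nhdsWithin_le_nhds
  refine ge_of_tendsto this ?_
  filter_upwards [Ico_mem_nhdsLT hsr] with τ hτ using (hbefore τ hτ).le

/-- An open interval of times, described by order properties. -/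
theorem eq_Iio_of_isOpen {S : Set ℝ} (ho : IsOpen S) (hne : S.Nonempty)
    (hlow : ∀ s ∈ S, ∀ t ≤ s, t ∈ S) {T : ℝ} (hT : T ∉ S) : ∃ r, S = Iio r := by
  have hb : BddAbove S := ⟨T, fun s hs => not_lt.1 fun h => hT (hlow s hs T h.le)⟩
  refine ⟨sSup S, Subset.antisymm (fun s hs => ?_) fun s hs => ?_⟩
  · refine lt_of_le_of_ne (le_csSup hb hs) ?_
    rintro rfl
    obtain ⟨ε, hε, hball⟩ := Metric.isOpen_iff.1 ho _ hs
    have : sSup S + ε / 2 ∈ S := hball (by simp [abs_of_pos hε]; linarith)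
    linarith [le_csSup hb this]
  · obtain ⟨a, ha, hsa⟩ := exists_lt_of_lt_csSup hne hs
    exact hlow a ha s hsa.le

/-- `S` is the intersection of `S ∪ Iic r` and `S ∪ Ici r`. The half-line lemma applies to the first
set and to the reflection of the second. -/
theorem eq_Ioo_of_isOpen {S : Set ℝ} (ho : IsOpen S) {r : ℝ} (hr : r ∈ S)
    (hlow : ∀ s ∈ S, ∀ t, r ≤ t → t ≤ s → t ∈ S) (hup : ∀ s ∈ S, ∀ t, s ≤ t → t ≤ r → t ∈ S)
    {T₀ T₁ : ℝ} (hT₀ : T₀ ≤ r) (hT₁ : r ≤ T₁) (h₀ : T₀ ∉ S) (h₁ : T₁ ∉ S) :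
    ∃ a b, a < b ∧ S = Ioo a b := by
  obtain ⟨b, hb⟩ := eq_Iio_of_isOpen (S := {s | s ≤ r ∨ s ∈ S})
    (by
      have : {s | s ≤ r ∨ s ∈ S} = Iio r ∪ S := by
        ext s
        simp only [mem_ofPred_eq, mem_union, mem_Iio]
        constructor
        · rintro (h | h)
          · rcases h.lt_or_eq with h | h
            · exact Or.inl h
            · exact Or.inr (h ▸ hr)
          · exact Or.inr h
        · rintro (h | h)
          · exact Or.inl h.le
          · exact Or.inr h
      rw [this]; exact isOpen_Iio.union ho) ⟨r, Or.inl le_rfl⟩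
    (by
      rintro s (hs | hs) t ht
      · exact Or.inl (ht.trans hs)
      · rcases le_total t r with h | h
        · exact Or.inl h
        · exact Or.inr (hlow s hs t h ht))
    (T := T₁)
    (by
      rintro (h | h)
      · exact h₁ (by rw [le_antisymm h hT₁]; exact hr)
      · exact h₁ h)
  obtain ⟨a, ha⟩ := eq_Iio_of_isOpen (S := {s | r ≤ -s ∨ -s ∈ S})
    (by
      have : {s : ℝ | r ≤ -s ∨ -s ∈ S} = (fun s : ℝ => -s) ⁻¹' (Ioi r ∪ S) := by
        ext s
        simp only [mem_ofPred_eq, mem_union, mem_Ioi, mem_preimage]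
        constructor
        · rintro (h | h)
          · rcases h.lt_or_eq with h | h
            · exact Or.inl h
            · exact Or.inr (h ▸ hr)
          · exact Or.inr h
        · rintro (h | h)
          · exact Or.inl h.le
          · exact Or.inr h
      rw [this]; exact (isOpen_Ioi.union ho).preimage continuous_neg)
    ⟨-r, Or.inl (by simp)⟩
    (by
      rintro s (hs | hs) t ht
      · exact Or.inl (by linarith)
      · rcases le_total r (-t) with h | h
        · exact Or.inl h
        · exact Or.inr (hup _ hs _ (by linarith) h))
    (T := -T₀)
    (by
      rintro (h | h)
      · rw [neg_neg] at h; exact h₀ (by rw [le_antisymm hT₀ h]; exact hr)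
      · rw [neg_neg] at h; exact h₀ h)
  have hb' : ∀ s, (s ≤ r ∨ s ∈ S) ↔ s < b := fun s => by rw [← mem_Iio, ← hb]; rfl
  have ha' : ∀ s, (r ≤ s ∨ s ∈ S) ↔ -a < s := fun s => by
    rw [neg_lt, ← mem_Iio, ← ha]; simp
  refine ⟨-a, b, ((ha' r).1 (Or.inl le_rfl)).trans ((hb' r).1 (Or.inl le_rfl)), ?_⟩
  ext s
  rw [mem_Ioo, ← ha', ← hb']
  constructor
  · exact fun h => ⟨Or.inr h, Or.inr h⟩
  · rintro ⟨h1 | h1, h2 | h2⟩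
    · rw [le_antisymm h2 h1]; exact hr
    all_goals assumption

/-! ### The global flow of a bounded Lipschitz vector field -/

section Flow

variable {E : Type*} [NormedAddCommGroup E] [NormedSpace ℝ E]
  {V : E → E} {K L : NNReal}

/-- Since `‖V‖ ≤ L` everywhere, Picard–Lindelöf with ball radius `L (N + 1)` works on the whole
interval `[-(N+1), N+1]`, with no smallness of time. Uniqueness glues these solutions. -/
theorem exists_global_solution [CompleteSpace E] (hK : LipschitzWith K V) (hL : ∀ z, ‖V z‖ ≤ L) (z : E) :
    ∃ X : ℝ → E, X 0 = z ∧ ∀ t, HasDerivAt X (V (X t)) t := by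
  have key : ∀ N : ℕ, ∃ α : ℝ → E, α 0 = z ∧
      ∀ t ∈ Ioo (-((N : ℝ) + 1)) (N + 1), HasDerivAt α (V (α t)) t := by
    intro N
    have h0 : (0 : ℝ) ∈ Icc (-((N : ℝ) + 1)) (N + 1) := ⟨by linarith [N.cast_nonneg (α := ℝ)],
      by positivity⟩
    have hPL : IsPicardLindelof (fun _ => V) (⟨0, h0⟩ : Icc (-((N : ℝ) + 1)) (N + 1)) z
        (L * (N + 1)) 0 L K :=
      IsPicardLindelof.of_time_independent (fun x _ => hL x) hK.lipschitzOnWith (by simp)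
    obtain ⟨α, h1, h2⟩ := hPL.exists_eq_forall_mem_Icc_hasDerivWithinAt₀
    exact ⟨α, h1, fun t ht => (h2 t (Ioo_subset_Icc_self ht)).hasDerivAt (Icc_mem_nhds ht.1 ht.2)⟩
  choose α h0 hα using key
  have huniq : ∀ N k : ℕ, N ≤ k → ∀ t ∈ Ioo (-((N : ℝ) + 1)) (N + 1), α N t = α k t := by
    intro N k hNk
    have hNk' : (N : ℝ) ≤ k := by exact_mod_cast hNk
    refine ODE_solution_unique_of_mem_Ioo (v := fun _ => V) (s := fun _ => univ) (K := K) (t₀ := 0)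
      (fun _ _ => hK.lipschitzOnWith) ⟨by linarith [N.cast_nonneg (α := ℝ)], by positivity⟩
      (fun t ht => ⟨hα N t ht, mem_univ _⟩) (fun t ht => ⟨hα k t ⟨?_, ?_⟩, mem_univ _⟩)
      (by rw [h0, h0])
    · linarith [ht.1]
    · linarith [ht.2]
  -- The index jumps with `t`, but near any `t` the glued function agrees with the single solution
  -- of index `⌈|t|⌉₊ + 1`.
  refine ⟨fun t => α ⌈|t|⌉₊ t, by simp [h0], fun t => ?_⟩
  set N := ⌈|t|⌉₊ + 1 with hN
  have htN : |t| < N := by rw [hN]; push_cast; linarith [Nat.le_ceil |t|]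
  have hev : (fun t => α ⌈|t|⌉₊ t) =ᶠ[𝓝 t] α N := by
    filter_upwards [(continuous_abs.tendsto t).eventually (gt_mem_nhds htN)] with s hs
    refine huniq _ _ (Nat.ceil_le.2 hs.le) s ?_
    have := Nat.le_ceil |s|
    exact abs_lt.1 (by linarith)
  have hd := hα N t (abs_lt.1 (by linarith))
  have he : α ⌈|t|⌉₊ t = α N t := hev.eq_of_nhds
  simp only [he]
  exact hd.congr_of_eventuallyEq hev

theorem dist_solution_le (hK : LipschitzWith K V) {X Y : ℝ → E}
    (hX : ∀ t, HasDerivAt X (V (X t)) t) (hY : ∀ t, HasDerivAt Y (V (Y t)) t) (t : ℝ) :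
    dist (X t) (Y t) ≤ dist (X 0) (Y 0) * Real.exp (K * |t|) := by
  rcases le_total 0 t with ht | ht
  · have := dist_le_of_trajectories_ODE (v := fun _ => V) (f := X) (g := Y) (a := 0) (b := t)
      (fun _ => hK) (HasDerivAt.continuousOn fun s _ => hX s)
      (fun s _ => (hX s).hasDerivWithinAt) (HasDerivAt.continuousOn fun s _ => hY s)
      (fun s _ => (hY s).hasDerivWithinAt) le_rfl t ⟨ht, le_rfl⟩
    rwa [sub_zero, show (K : ℝ) * t = K * |t| by rw [abs_of_nonneg ht]] at this
  · have hneg : ∀ {Z : ℝ → E}, (∀ t, HasDerivAt Z (V (Z t)) t) →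
        ∀ s, HasDerivAt (fun s => Z (-s)) (-V (Z (-s))) s := fun hZ s =>
      hasDerivAt_comp_neg' (hZ (-s))
    have := dist_le_of_trajectories_ODE (v := fun _ z => -V z) (f := fun s => X (-s))
      (g := fun s => Y (-s)) (a := 0) (b := -t)
      (fun _ => hK.neg) (HasDerivAt.continuousOn fun s _ => hneg hX s)
      (fun s _ => (hneg hX s).hasDerivWithinAt) (HasDerivAt.continuousOn fun s _ => hneg hY s)
      (fun s _ => (hneg hY s).hasDerivWithinAt) le_rfl (-t) ⟨by linarith, le_rfl⟩
    simpa [abs_of_nonpos ht] using this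

theorem solution_unique (hK : LipschitzWith K V) {X Y : ℝ → E}
    (hX : ∀ t, HasDerivAt X (V (X t)) t) (hY : ∀ t, HasDerivAt Y (V (Y t)) t) (h0 : X 0 = Y 0) :
    X = Y :=
  ODE_solution_unique_univ (v := fun _ => V) (s := fun _ => univ) (t₀ := 0)
    (fun _ => hK.lipschitzOnWith) (fun t => ⟨hX t, mem_univ _⟩) (fun t => ⟨hY t, mem_univ _⟩) h0

/-- Joint continuity splits by the triangle inequality into Grönwall's estimate in the initial
point, locally uniform in time, and continuity in time at a fixed initial point. -/
theorem exists_continuous_flow [CompleteSpace E] (hK : LipschitzWith K V) (hL : ∀ z, ‖V z‖ ≤ L) :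
    ∃ φ : ℝ → E → E, (∀ z, φ 0 z = z) ∧ (∀ z t, HasDerivAt (φ · z) (V (φ t z)) t) ∧
      Continuous fun p : ℝ × E => φ p.1 p.2 := by
  choose φ h0 hφ using fun z => exists_global_solution hK hL z
  refine ⟨fun t z => φ z t, h0, hφ, ?_⟩
  rw [continuous_iff_continuousAt]
  rintro ⟨t₀, z₀⟩
  rw [ContinuousAt, tendsto_iff_dist_tendsto_zero]
  have hbound : ∀ p : ℝ × E, dist (φ p.2 p.1) (φ z₀ t₀) ≤
      dist p.2 z₀ * Real.exp (K * |p.1|) + dist (φ z₀ p.1) (φ z₀ t₀) := fun p => by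
    refine (dist_triangle _ (φ z₀ p.1) _).trans (add_le_add ?_ le_rfl)
    have := dist_solution_le hK (hφ p.2) (hφ z₀) p.1
    rwa [h0, h0] at this
  refine squeeze_zero (fun _ => dist_nonneg) hbound ?_
  have hc : Continuous (φ z₀) := continuous_iff_continuousAt.2 fun t => (hφ z₀ t).continuousAt
  have : Continuous fun p : ℝ × E =>
      dist p.2 z₀ * Real.exp (K * |p.1|) + dist (φ z₀ p.1) (φ z₀ t₀) := by fun_prop
  have h := this.tendsto (t₀, z₀)
  simpa using h

end Flow

/-! ### The planar system -/

/-- A complete solution of the planar system for `f = (A² - B²) / (m A² + n B²)` and `x = P - Q`. -/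
structure PlanarOrbit (m n : ℝ) (f x : ℝ → ℝ) : Prop where
  low : ∀ t, 0 < 1 + n * f t
  high : ∀ t, 0 < 1 - m * f t
  disc : ∀ t, 0 < m + n - 1 - m * n * x t ^ 2
  deriv_f : ∀ t, HasDerivAt f (2 / (m + n) * ((1 + n * f t) * (1 - m * f t) * x t)) t
  deriv_x : ∀ t, HasDerivAt x (1 / (m + n) * ((m + n - 1 - m * n * x t ^ 2) * (x t - f t))) t

/-- The logarithm of a power of the monotone quantity `A ^ m * B ^ n`. -/
noncomputable def lyap (m n f x : ℝ) : ℝ :=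
  (m + n) * Real.log (m + n - 1 - m * n * x ^ 2) + m * Real.log (1 + n * f)
    + n * Real.log (1 - m * f)

/-- Apply `log u ≤ u - 1` to the last two terms: the linear bounds `m · n f` and `-n · m f` cancel.
The right-hand side is the value at the origin. -/
theorem lyap_le {m n f x : ℝ} (hm : 2 ≤ m) (hn : 2 ≤ n) (h1 : 0 < 1 + n * f) (h2 : 0 < 1 - m * f)
    (h3 : 0 < m + n - 1 - m * n * x ^ 2) : lyap m n f x ≤ (m + n) * Real.log (m + n - 1) := by
  have e1 := Real.log_le_sub_one_of_pos h1
  have e2 := Real.log_le_sub_one_of_pos h2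
  have e3 : Real.log (m + n - 1 - m * n * x ^ 2) ≤ Real.log (m + n - 1) :=
    Real.log_le_log h3 (by nlinarith [sq_nonneg x, mul_nonneg (by linarith : 0 ≤ m) (by linarith : 0 ≤ n)])
  have e4 : m * Real.log (1 + n * f) ≤ m * (n * f) := by
    apply mul_le_mul_of_nonneg_left <;> linarith
  have e5 : n * Real.log (1 - m * f) ≤ n * (-(m * f)) := by
    apply mul_le_mul_of_nonneg_left <;> linarith
  have e6 := mul_le_mul_of_nonneg_left e3 (by linarith : 0 ≤ m + n)
  rw [lyap]; linarith

/-- The origin is the only maximum, because `log u < u - 1` is strict unless `u = 1`. -/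
theorem eq_zero_of_le_lyap {m n f x : ℝ} (hm : 2 ≤ m) (hn : 2 ≤ n) (h1 : 0 < 1 + n * f)
    (h2 : 0 < 1 - m * f) (h3 : 0 < m + n - 1 - m * n * x ^ 2)
    (h : (m + n) * Real.log (m + n - 1) ≤ lyap m n f x) : f = 0 ∧ x = 0 := by
  have hmn : 0 < m * n := by positivity
  have e1 := Real.log_le_sub_one_of_pos h1
  have e2 := Real.log_le_sub_one_of_pos h2
  have e3 : Real.log (m + n - 1 - m * n * x ^ 2) ≤ Real.log (m + n - 1) :=
    Real.log_le_log h3 (by nlinarith [sq_nonneg x])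
  have e4 : m * Real.log (1 + n * f) ≤ m * (n * f) := by
    apply mul_le_mul_of_nonneg_left <;> linarith
  have e5 : n * Real.log (1 - m * f) ≤ n * (-(m * f)) := by
    apply mul_le_mul_of_nonneg_left <;> linarith
  have e6 := mul_le_mul_of_nonneg_left e3 (by linarith : 0 ≤ m + n)
  constructor
  · by_contra hf
    have hnf : 1 + n * f ≠ 1 := by
      intro hc
      rcases mul_eq_zero.1 (by linarith : n * f = 0) with h | h
      · linarith
      · exact hf h
    have e7 := Real.log_lt_sub_one_of_pos h1 hnf
    have e8 : m * Real.log (1 + n * f) < m * (n * f) := by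
      apply mul_lt_mul_of_pos_left <;> linarith
    rw [lyap] at h; linarith
  · by_contra hx
    have hx2 : 0 < x ^ 2 := by positivity
    have e7 : Real.log (m + n - 1 - m * n * x ^ 2) < Real.log (m + n - 1) :=
      Real.log_lt_log h3 (by nlinarith [mul_pos hmn hx2])
    have e8 := mul_lt_mul_of_pos_left e7 (by linarith : 0 < m + n)
    rw [lyap] at h; linarith

namespace PlanarOrbit

variable {m n : ℝ} {f x : ℝ → ℝ}

/-- The symmetry exchanging the two Einstein factors. It transfers all results on `F₁` and the edge
`B = 0` to `F₂` and the edge `A = 0`. -/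
theorem swap (h : PlanarOrbit m n f x) : PlanarOrbit n m (fun t => -f t) (fun t => -x t) where
  low t := by simpa [sub_eq_add_neg] using h.high t
  high t := by simpa using h.low t
  disc t := by have := h.disc t; simp only [neg_sq]; nlinarith
  deriv_f t := by
    convert! (h.deriv_f t).fun_neg using 1
    rw [add_comm n m]; ring
  deriv_x t := by
    convert! (h.deriv_x t).fun_neg using 1
    rw [add_comm n m]; ring

theorem continuous_f (h : PlanarOrbit m n f x) : Continuous f :=
  continuous_iff_continuousAt.2 fun t => (h.deriv_f t).continuousAt

theorem continuous_x (h : PlanarOrbit m n f x) : Continuous x :=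
  continuous_iff_continuousAt.2 fun t => (h.deriv_x t).continuousAt

theorem abs_f_le (h : PlanarOrbit m n f x) (hm : 2 ≤ m) (hn : 2 ≤ n) (t : ℝ) : |f t| ≤ 1 := by
  have h1 := h.low t
  have h2 := h.high t
  rw [abs_le]; constructor <;> by_contra hc <;> push Not at hc <;> nlinarith

theorem abs_x_le (h : PlanarOrbit m n f x) (hm : 2 ≤ m) (hn : 2 ≤ n) (t : ℝ) : |x t| ≤ 1 := by
  have h1 := h.disc t
  rw [← sq_le_one_iff_abs_le_one]
  by_contra hc
  push Not at hc
  nlinarith [mul_nonneg (by linarith : 0 ≤ m - 1) (by linarith : 0 ≤ n - 1),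
    mul_lt_mul_of_pos_left hc (by positivity : 0 < m * n)]

theorem exists_bound (h : PlanarOrbit m n f x) (hm : 2 ≤ m) (hn : 2 ≤ n) {G : ℝ × ℝ → ℝ}
    (hG : Continuous G) : ∃ K, 0 ≤ K ∧ ∀ t, |G (f t, x t)| ≤ K := by
  obtain ⟨K, hK⟩ := ((isCompact_Icc (a := (-1 : ℝ)) (b := 1)).prod
    (isCompact_Icc (a := (-1 : ℝ)) (b := 1))).exists_bound_of_continuousOn hG.continuousOn
  have hK' : ∀ t, |G (f t, x t)| ≤ K := fun t =>
    hK _ ⟨abs_le.1 (h.abs_f_le hm hn t), abs_le.1 (h.abs_x_le hm hn t)⟩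
  exact ⟨K, (abs_nonneg _).trans (hK' 0), hK'⟩

/-- The mixed terms `±2 m n f x`, one from the first logarithm and one from the other two, cancel.
-/
theorem deriv_lyap (h : PlanarOrbit m n f x) (hm : 2 ≤ m) (hn : 2 ≤ n) (t : ℝ) :
    HasDerivAt (fun t => lyap m n (f t) (x t)) (-(2 * m * n * x t ^ 2)) t := by
  have h1 := h.low t
  have h2 := h.high t
  have h3 := h.disc t
  have hd : (m + n) ≠ 0 := by linarith
  have d1 := ((((h.deriv_x t).pow 2).const_mul (m * n)).const_sub (m + n - 1)).log h3.ne'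
  have d2 := (((h.deriv_f t).const_mul n).const_add 1).log h1.ne'
  have d3 := (((h.deriv_f t).const_mul m).const_sub 1).log h2.ne'
  have := ((d1.const_mul (m + n)).add (d2.const_mul m)).add (d3.const_mul n)
  convert! this using 1
  have h1' := h1.ne'
  have h2' := h2.ne'
  have h3' := h3.ne'
  simp only [Pi.pow_apply]
  field_simp
  ring

theorem antitone_lyap (h : PlanarOrbit m n f x) (hm : 2 ≤ m) (hn : 2 ≤ n) :
    Antitone fun t => lyap m n (f t) (x t) :=
  antitone_of_deriv_nonpos (fun t => (h.deriv_lyap hm hn t).differentiableAt) fun t => by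
    rw [(h.deriv_lyap hm hn t).deriv]
    have : 0 ≤ 2 * m * n * x t ^ 2 := by positivity
    linarith

/-- If `x` converges, then `x - f` tends to `0` or `x` tends to the boundary. -/
theorem tendsto_deriv_x (h : PlanarOrbit m n f x) (hm : 2 ≤ m) (hn : 2 ≤ n) {l : Filter ℝ}
    (hl : l = atTop ∨ l = atBot) {c : ℝ} (hc : Tendsto x l (𝓝 c)) :
    Tendsto (fun t => (m + n - 1 - m * n * x t ^ 2) * (x t - f t)) l (𝓝 0) := by
  have hd : (m + n) ≠ 0 := by linarith
  set G : ℝ × ℝ → ℝ := fun p => 1 / (m + n) * (-(m * n * (2 * p.2 *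
    (1 / (m + n) * ((m + n - 1 - m * n * p.2 ^ 2) * (p.2 - p.1))))) * (p.2 - p.1)
    + (m + n - 1 - m * n * p.2 ^ 2) * (1 / (m + n) * ((m + n - 1 - m * n * p.2 ^ 2) * (p.2 - p.1))
      - 2 / (m + n) * ((1 + n * p.1) * (1 - m * p.1) * p.2))) with hGdef
  obtain ⟨K, -, hK⟩ := h.exists_bound hm hn (G := G) (by rw [hGdef]; fun_prop)
  have := tendsto_deriv_zero hl h.deriv_x (g'' := fun t => G (f t, x t)) (fun t => by
    have d1 := (((h.deriv_x t).pow 2).const_mul (m * n)).const_sub (m + n - 1)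
    have := (d1.mul ((h.deriv_x t).sub (h.deriv_f t))).const_mul (1 / (m + n))
    convert! this using 1
    simp only [hGdef, Pi.sub_apply, Pi.pow_apply]
    ring) hK hc
  have h2 := this.const_mul (m + n)
  rw [mul_zero] at h2
  refine h2.congr fun t => ?_
  field_simp

/-- Barbalat's lemma is used twice: for `lyap` it gives `x² → 0`, and then for `x` it gives `D (x -
f) → 0` with `D → m + n - 1 > 0`, hence `f → 0`. -/
theorem tendsto_zero_of_tendsto_lyap (h : PlanarOrbit m n f x) (hm : 2 ≤ m) (hn : 2 ≤ n)
    {l : Filter ℝ} (hl : l = atTop ∨ l = atBot) {c : ℝ}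
    (hc : Tendsto (fun t => lyap m n (f t) (x t)) l (𝓝 c)) :
    Tendsto f l (𝓝 0) ∧ Tendsto x l (𝓝 0) := by
  set G : ℝ × ℝ → ℝ := fun p => -(2 * m * n * (2 * p.2 *
    (1 / (m + n) * ((m + n - 1 - m * n * p.2 ^ 2) * (p.2 - p.1))))) with hGdef
  obtain ⟨K, -, hK⟩ := h.exists_bound hm hn (G := G) (by rw [hGdef]; fun_prop)
  have h1 := tendsto_deriv_zero hl (h.deriv_lyap hm hn) (g'' := fun t => G (f t, x t)) (fun t => by
    have := (((h.deriv_x t).pow 2).const_mul (2 * m * n)).fun_neg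
    convert! this using 1
    simp only [hGdef]
    ring) hK hc
  have hx2 : Tendsto (fun t => x t ^ 2) l (𝓝 0) := by
    have := h1.const_mul (-(1 / (2 * m * n)))
    rw [mul_zero] at this
    refine this.congr fun t => ?_
    have : m ≠ 0 := by linarith
    have : n ≠ 0 := by linarith
    field_simp
  have hx : Tendsto x l (𝓝 0) := by
    rw [tendsto_zero_iff_abs_tendsto_zero]
    have := (Real.continuous_sqrt.tendsto 0).comp hx2
    rw [Real.sqrt_zero] at this
    exact this.congr fun t => Real.sqrt_sq_eq_abs _
  refine ⟨?_, hx⟩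
  have h2 := h.tendsto_deriv_x hm hn hl hx
  have h3 : Tendsto (fun t => m + n - 1 - m * n * x t ^ 2) l (𝓝 (m + n - 1)) := by
    simpa using (hx2.const_mul (m * n)).const_sub (m + n - 1)
  have h4 := hx.sub (h2.div h3 (by linarith))
  rw [zero_div, sub_zero] at h4
  refine h4.congr fun t => ?_
  have := (h.disc t).ne'
  simp only [Pi.div_apply]
  rw [mul_div_cancel_left₀ _ this, sub_sub_cancel]

/-- Every orbit starts at the interior fixed point. -/
theorem tendsto_atBot (h : PlanarOrbit m n f x) (hm : 2 ≤ m) (hn : 2 ≤ n) :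
    Tendsto f atBot (𝓝 0) ∧ Tendsto x atBot (𝓝 0) := by
  refine h.tendsto_zero_of_tendsto_lyap hm hn (Or.inr rfl)
    (tendsto_atBot_ciSup (h.antitone_lyap hm hn) ⟨(m + n) * Real.log (m + n - 1), ?_⟩)
  rintro _ ⟨t, rfl⟩
  exact lyap_le hm hn (h.low t) (h.high t) (h.disc t)

/-- The vector field vanishes at the origin and is linearly bounded there, so this energy obeys a
two-sided Grönwall estimate. It replaces a uniqueness theorem at the equilibrium. -/
theorem exists_energy_bound (h : PlanarOrbit m n f x) (hm : 2 ≤ m) (hn : 2 ≤ n) :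
    ∃ K, ∀ t, ∃ e, HasDerivAt (fun t => f t ^ 2 + x t ^ 2) e t ∧
      |e| ≤ K * (f t ^ 2 + x t ^ 2) := by
  obtain ⟨K₁, hK₁, h₁⟩ := h.exists_bound hm hn (G := fun p => 2 / (m + n) * ((1 + n * p.1) *
    (1 - m * p.1))) (by fun_prop)
  obtain ⟨K₂, hK₂, h₂⟩ := h.exists_bound hm hn (G := fun p => 1 / (m + n) *
    (m + n - 1 - m * n * p.2 ^ 2)) (by fun_prop)
  refine ⟨K₁ + 3 * K₂, fun t => ⟨_, ((h.deriv_f t).pow 2).add ((h.deriv_x t).pow 2), ?_⟩⟩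
  have e : (2 : ℕ) * f t ^ (2 - 1) * (2 / (m + n) * ((1 + n * f t) * (1 - m * f t) * x t))
      + (2 : ℕ) * x t ^ (2 - 1) * (1 / (m + n) * ((m + n - 1 - m * n * x t ^ 2) * (x t - f t)))
      = (2 / (m + n) * ((1 + n * f t) * (1 - m * f t))) * (2 * f t * x t)
        + (1 / (m + n) * (m + n - 1 - m * n * x t ^ 2)) * (2 * x t * (x t - f t)) := by
    push_cast; ring
  rw [e]
  have a1 : |2 * f t * x t| ≤ f t ^ 2 + x t ^ 2 := by
    rw [abs_le]; constructor <;> nlinarith [sq_nonneg (f t + x t), sq_nonneg (f t - x t)]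
  have a2 : |2 * x t * (x t - f t)| ≤ 3 * (f t ^ 2 + x t ^ 2) := by
    rw [abs_le]; constructor <;> nlinarith [sq_nonneg (f t + x t), sq_nonneg (f t - x t)]
  calc _ ≤ K₁ * (f t ^ 2 + x t ^ 2) + K₂ * (3 * (f t ^ 2 + x t ^ 2)) := by
        refine (abs_add_le _ _).trans (add_le_add ?_ ?_)
        · rw [abs_mul]; exact mul_le_mul (h₁ t) a1 (abs_nonneg _) hK₁
        · rw [abs_mul]; exact mul_le_mul (h₂ t) a2 (abs_nonneg _) hK₂
    _ = _ := by ring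

/-- An orbit through the interior fixed point is constant. -/
theorem eq_zero_of_eq_zero (h : PlanarOrbit m n f x) (hm : 2 ≤ m) (hn : 2 ≤ n) {s : ℝ}
    (hf : f s = 0) (hx : x s = 0) (t : ℝ) : f t = 0 ∧ x t = 0 := by
  obtain ⟨K, hK⟩ := h.exists_energy_bound hm hn
  choose e he hK using hK
  suffices f t ^ 2 + x t ^ 2 ≤ 0 by
    constructor <;> nlinarith [sq_nonneg (f t), sq_nonneg (x t)]
  rcases le_total s t with hst | hst
  · obtain ⟨E, hE, h1⟩ := exists_mul_le_of_mul_le_deriv (a := fun _ => K) hst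
      (fun τ _ => (he τ).fun_neg) continuousOn_const
      (fun τ _ => by have := (abs_le.1 (hK τ)).2; linarith)
    simp only [hf, hx] at h1
    linarith
  · obtain ⟨E, hE, h1⟩ := exists_mul_le_of_mul_le_deriv (a := fun _ => -K) hst
      (fun τ _ => he τ) continuousOn_const
      (fun τ _ => by have := (abs_le.1 (hK τ)).1; linarith)
    simp only [hf, hx] at h1
    by_contra hc
    push Not at hc
    have := mul_pos hc hE
    linarith

/-- Along a nonconstant orbit the monotone quantity tends to zero. -/
theorem tendsto_lyap_atTop (h : PlanarOrbit m n f x) (hm : 2 ≤ m) (hn : 2 ≤ n)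
    (hne : ∀ t, f t ≠ 0 ∨ x t ≠ 0) : Tendsto (fun t => lyap m n (f t) (x t)) atTop atBot := by
  rcases tendsto_atTop_of_antitone (h.antitone_lyap hm hn) with h1 | ⟨c, hc⟩
  · exact h1
  exfalso
  obtain ⟨hf, hx⟩ := h.tendsto_zero_of_tendsto_lyap hm hn (Or.inl rfl) hc
  have hcont : ContinuousAt (fun p : ℝ × ℝ => lyap m n p.1 p.2) (0, 0) := by
    unfold lyap
    refine ContinuousAt.add (ContinuousAt.add (ContinuousAt.mul continuousAt_const
      (ContinuousAt.log (by fun_prop) ?_)) (ContinuousAt.mul continuousAt_const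
      (ContinuousAt.log (by fun_prop) ?_))) (ContinuousAt.mul continuousAt_const
      (ContinuousAt.log (by fun_prop) ?_))
    · simp; linarith
    · simp
    · simp
  have h2 := hcont.tendsto.comp (hf.prodMk_nhds hx)
  -- A finite limit would be the value at the origin, the maximum. As `lyap` is antitone, it would
  -- have that value already at time `0`, and the orbit would be the equilibrium.
  have h3 : c = (m + n) * Real.log (m + n - 1) := by
    rw [tendsto_nhds_unique hc h2]; simp [lyap]
  have h4 : c ≤ lyap m n (f 0) (x 0) := (h.antitone_lyap hm hn).le_of_tendsto hc 0
  have h5 := eq_zero_of_le_lyap hm hn (h.low 0) (h.high 0) (h.disc 0) (h3 ▸ h4)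
  rcases hne 0 with h6 | h6
  · exact h6 h5.1
  · exact h6 h5.2

end PlanarOrbit

theorem exists_sign_near_zero {x : ℝ → ℝ} {d s : ℝ} (hx : HasDerivAt x d s) (hd : 0 < d)
    (h0 : x s = 0) :
    ∃ ε > 0, (∀ t ∈ Ioo s (s + ε), 0 < x t) ∧ ∀ t ∈ Ioo (s - ε) s, x t < 0 := by
  have h := eventually_nhdsWithin_sign_eq_of_deriv_pos (f := x) (x₀ := s) (by rwa [hx.deriv]) h0
  obtain ⟨ε, hε, hb⟩ := Metric.eventually_nhds_iff.1 h
  refine ⟨ε, hε, fun t ht => ?_, fun t ht => ?_⟩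
  · have := hb (y := t) (by rw [Real.dist_eq, abs_lt]; constructor <;> linarith [ht.1, ht.2])
    rwa [sign_pos (by linarith [ht.1] : 0 < t - s), sign_eq_one_iff] at this
  · have := hb (y := t) (by rw [Real.dist_eq, abs_lt]; constructor <;> linarith [ht.1, ht.2])
    rwa [sign_neg (by linarith [ht.2] : t - s < 0), sign_eq_neg_one_iff] at this

/-! ### Barriers -/

/-- The polynomial condition under which `x = μ f / (1 + β f)` is crossed upwards for `f ≥ 0`. -/
structure IsBarrier (m n μ β : ℝ) : Prop where
  one_lt : 1 < μ
  nonneg : 0 ≤ β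
  pos : ∀ f, 0 ≤ f → 0 ≤ 1 - m * f →
    0 ≤ ((m + n - 1) * (1 + β * f) ^ 2 - m * n * μ ^ 2 * f ^ 2) * (μ - 1 - β * f)
      - 2 * μ ^ 2 * (1 + n * f) * (1 - m * f)

/-- The barrier curve. -/
noncomputable def curve (μ β f : ℝ) : ℝ := μ * f / (1 + β * f)

theorem curve_pos {μ β f : ℝ} (hμ : 1 < μ) (hβ : 0 ≤ β) (hf : 0 < f) : 0 < curve μ β f := by
  unfold curve; positivity

theorem curve_mono {μ β f g : ℝ} (hμ : 1 < μ) (hβ : 0 ≤ β) (hf : 0 ≤ f) (hfg : f ≤ g) :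
    curve μ β f ≤ curve μ β g := by
  have hg : 0 ≤ g := hf.trans hfg
  unfold curve
  rw [div_le_div_iff₀ (by positivity) (by positivity)]
  nlinarith

theorem continuousAt_curve {μ β f : ℝ} (hβ : 0 ≤ β) (hf : 0 ≤ f) :
    ContinuousAt (curve μ β) f := by
  unfold curve
  have : 1 + β * f ≠ 0 := by positivity
  fun_prop (disch := assumption)

/-- The point `(1/m, 1/m)` is the saddle on the edge `B = 0`; this `β` makes the barrier end there.
-/
theorem curve_inv {m μ β : ℝ} (hm : 2 ≤ m) (hμ : 1 < μ) (hβ : β = m * (μ - 1)) :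
    curve μ β (1 / m) = 1 / m := by
  have : m ≠ 0 := by linarith
  have : μ ≠ 0 := by linarith
  unfold curve
  have e : 1 + β * (1 / m) = μ := by rw [hβ]; field_simp; ring
  rw [e]
  field_simp

theorem lt_curve_inv {m μ β : ℝ} (hm : 2 ≤ m) (hβ : 0 ≤ β) (h : β < m * (μ - 1)) :
    1 / m < curve μ β (1 / m) := by
  have : 0 < m := by linarith
  unfold curve
  rw [lt_div_iff₀ (by positivity)]
  have : β * (1 / m) < μ - 1 := by rw [mul_one_div, div_lt_iff₀ this]; linarith
  have h3 : 0 < 1 / m := by positivity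
  nlinarith

namespace PlanarOrbit

variable {m n μ β : ℝ} {f x : ℝ → ℝ}

theorem deriv_x_pos (h : PlanarOrbit m n f x) (hm : 2 ≤ m) (hn : 2 ≤ n) {t : ℝ} (ht : f t < x t) :
    0 < 1 / (m + n) * ((m + n - 1 - m * n * x t ^ 2) * (x t - f t)) :=
  mul_pos (by positivity) (mul_pos (h.disc t) (by linarith))

theorem strictMonoOn_f (h : PlanarOrbit m n f x) (hm : 2 ≤ m) (hn : 2 ≤ n) {s : Set ℝ}
    (hs : Convex ℝ s) (hx : ∀ t ∈ interior s, 0 < x t) : StrictMonoOn f s :=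
  strictMonoOn_of_deriv_pos hs h.continuous_f.continuousOn fun t ht => by
    rw [(h.deriv_f t).deriv]
    exact mul_pos (by positivity) (mul_pos (mul_pos (h.low t) (h.high t)) (hx t ht))

/-- The derivative is arranged as a multiple of the difference plus a remainder. The remainder is
the rate at which the field crosses the curve; its sign for `f ≥ 0` is that of the polynomial in
`IsBarrier`. -/
theorem deriv_sub_curve (h : PlanarOrbit m n f x) (hm : 2 ≤ m) (hn : 2 ≤ n) (hβ : 0 ≤ β) {t : ℝ}
    (hf : 0 ≤ f t) :
    HasDerivAt (fun t => x t - curve μ β (f t))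
      (1 / (m + n) * ((m + n - 1 - m * n * x t ^ 2)
        - m * n * (x t + curve μ β (f t)) * (curve μ β (f t) - f t)
        - 2 * μ * (1 + n * f t) * (1 - m * f t) / (1 + β * f t) ^ 2) * (x t - curve μ β (f t))
      + f t * (((m + n - 1) * (1 + β * f t) ^ 2 - m * n * μ ^ 2 * f t ^ 2) * (μ - 1 - β * f t)
        - 2 * μ ^ 2 * (1 + n * f t) * (1 - m * f t)) / ((m + n) * (1 + β * f t) ^ 3)) t := by
  have h1 : 1 + β * f t ≠ 0 := by positivity
  have := (h.deriv_x t).sub (((h.deriv_f t).const_mul μ).div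
    (((h.deriv_f t).const_mul β).const_add 1) h1)
  convert! this using 1
  have h2 : m + n ≠ 0 := by linarith
  unfold curve
  field_simp
  ring

/-- The orbit does not cross the barrier downwards. -/
theorem exists_mul_le_sub_curve (h : PlanarOrbit m n f x) (hm : 2 ≤ m) (hn : 2 ≤ n)
    (hB : IsBarrier m n μ β) {s t : ℝ} (hst : s ≤ t) (hf : ∀ τ ∈ Icc s t, 0 ≤ f τ) :
    ∃ E > 0, (x s - curve μ β (f s)) * E ≤ x t - curve μ β (f t) := by
  have hf0 := h.continuous_f
  have hx0 := h.continuous_x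
  have hne : ∀ τ ∈ Icc s t, (1 + β * f τ) ≠ 0 := fun τ hτ => by
    have := mul_nonneg hB.nonneg (hf τ hτ); positivity
  have hcurve : ContinuousOn (fun τ => curve μ β (f τ)) (Icc s t) := fun τ hτ =>
    ((continuousAt_curve hB.nonneg (hf τ hτ)).comp (f := f) hf0.continuousAt).continuousWithinAt
  refine exists_mul_le_of_mul_le_deriv (a := fun τ => 1 / (m + n) * ((m + n - 1 - m * n * x τ ^ 2)
        - m * n * (x τ + curve μ β (f τ)) * (curve μ β (f τ) - f τ)
        - 2 * μ * (1 + n * f τ) * (1 - m * f τ) / (1 + β * f τ) ^ 2)) hst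
    (fun τ hτ => h.deriv_sub_curve hm hn hB.nonneg (hf τ hτ)) ?_ fun τ hτ => ?_
  · refine ContinuousOn.mul continuousOn_const (ContinuousOn.sub (ContinuousOn.sub (by fun_prop)
      (by fun_prop)) (ContinuousOn.div (by fun_prop) (by fun_prop) fun τ hτ => pow_ne_zero 2 (hne τ hτ)))
  · have h1 := hf τ hτ
    have h2 := hB.pos (f τ) h1 (h.high τ).le
    have h3 := hB.nonneg
    refine le_add_of_nonneg_right ?_
    positivity

/-- While `x > 0`, `f` increases. At a first zero of `x` the curve would thus have positive height,
yet the orbit cannot have dropped below it. -/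
theorem pos_of_barrier (h : PlanarOrbit m n f x) (hm : 2 ≤ m) (hn : 2 ≤ n) (hB : IsBarrier m n μ β)
    {s : ℝ} (hf : 0 ≤ f s) (hx : 0 < x s) (hu : 0 ≤ x s - curve μ β (f s)) {t : ℝ} (hst : s ≤ t) :
    0 < x t := by
  by_contra hc
  obtain ⟨r, hsr, -, hr0, hr⟩ := exists_first_zero h.continuous_x hst hx (not_lt.1 hc)
  have hmono := h.strictMonoOn_f hm hn (convex_Icc s r) fun τ hτ => by
    rw [interior_Icc] at hτ; exact hr τ (Ioo_subset_Ico_self hτ)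
  have hfr : 0 < f r := hf.trans_lt
    (hmono (left_mem_Icc.2 hsr.le) (right_mem_Icc.2 hsr.le) hsr)
  obtain ⟨E, hE, h1⟩ := h.exists_mul_le_sub_curve hm hn hB hsr.le fun τ hτ =>
    hf.trans (hmono.monotoneOn (left_mem_Icc.2 hsr.le) hτ hτ.1)
  have h2 := curve_pos hB.one_lt hB.nonneg hfr
  rw [hr0] at h1
  have := mul_nonneg hu hE.le
  linarith

/-- After leaving the negative `f`-axis upwards, a first return `x = 0` is impossible with `f < 0`,
since there `x' > 0`, and with `f = 0`, the equilibrium. With `f > 0` the orbit has passed `f = 0`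
at some `x > 0`, which is above the barrier, and `pos_of_barrier` applies. -/
theorem pos_of_zero (h : PlanarOrbit m n f x) (hm : 2 ≤ m) (hn : 2 ≤ n) (hB : IsBarrier m n μ β)
    {s : ℝ} (hf : f s < 0) (hx : x s = 0) {t : ℝ} (hst : s < t) : 0 < x t := by
  by_contra hc
  push Not at hc
  obtain ⟨ε, hε, hpos, -⟩ := exists_sign_near_zero (h.deriv_x s)
    (h.deriv_x_pos hm hn (by rwa [hx])) hx
  obtain ⟨s', ⟨hs1, hs2⟩, hfs'⟩ : ∃ s', s' ∈ Ioo s (min (s + ε) t) ∧ f s' < 0 := by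
    have h1 : ∀ᶠ τ in 𝓝[>] s, f τ < 0 :=
      (h.continuous_f.continuousAt.eventually (gt_mem_nhds hf)).filter_mono nhdsWithin_le_nhds
    have h2 : ∀ᶠ τ in 𝓝[>] s, τ ∈ Ioo s (min (s + ε) t) :=
      Ioo_mem_nhdsGT (lt_min (by linarith) hst)
    obtain ⟨τ, h3, h4⟩ := (h1.and h2).exists
    exact ⟨τ, h4, h3⟩
  have hxs' : 0 < x s' := hpos s' ⟨hs1, hs2.trans_le (min_le_left _ _)⟩
  obtain ⟨r, hsr, -, hr0, hr⟩ := exists_first_zero h.continuous_x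
    (hs2.le.trans (min_le_right _ _)) hxs' hc
  have hfr : 0 < f r := by
    rcases lt_trichotomy (f r) 0 with h1 | h1 | h1
    · obtain ⟨ε', hε', -, hneg⟩ := exists_sign_near_zero (h.deriv_x r)
        (h.deriv_x_pos hm hn (by rwa [hr0])) hr0
      have h2 := hr (max s' (r - ε' / 2)) ⟨le_max_left _ _, max_lt hsr (by linarith)⟩
      have h3 := hneg (max s' (r - ε' / 2)) ⟨lt_max_of_lt_right (by linarith),
        max_lt hsr (by linarith)⟩
      linarith
    · exact absurd (h.eq_zero_of_eq_zero hm hn h1 hr0 s).1 hf.ne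
    · exact h1
  obtain ⟨p, hp, hfp⟩ := intermediate_value_Icc hsr.le h.continuous_f.continuousOn
    ⟨hfs'.le, hfr.le⟩
  have hpr : p < r := lt_of_le_of_ne hp.2 (by rintro rfl; linarith)
  have hxp := hr p ⟨hp.1, hpr⟩
  have := h.pos_of_barrier hm hn hB hfp.ge hxp (by rw [hfp]; simp [curve, hxp.le]) hpr.le
  linarith

/-- The orbit passes from the third to the second quadrant. -/
def Crossing (f x : ℝ → ℝ) : Prop :=
  ∃ s, x s = 0 ∧ f s < 0 ∧ (∀ t < s, x t < 0) ∧ ∀ t > s, 0 < x t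

theorem crossing_of_zero (h : PlanarOrbit m n f x) (hm : 2 ≤ m) (hn : 2 ≤ n)
    (hB : IsBarrier m n μ β) {μ' β' : ℝ} (hB' : IsBarrier n m μ' β') {s : ℝ} (hf : f s < 0)
    (hx : x s = 0) : Crossing f x := by
  refine ⟨s, hx, hf, fun t ht => ?_, fun t ht => h.pos_of_zero hm hn hB hf hx ht⟩
  by_contra hc
  push Not at hc
  obtain ⟨ε, hε, -, hneg⟩ := exists_sign_near_zero (h.deriv_x s)
    (h.deriv_x_pos hm hn (by rwa [hx])) hx
  have hneg' := hneg (max t (s - ε / 2)) ⟨lt_max_of_lt_right (by linarith),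
    max_lt ht (by linarith)⟩
  -- An earlier zero `p` is excluded by the sign of `f p`: if negative, `x > 0` for all later times;
  -- if positive, `x < 0` for all later times by the symmetry. Both contradict `x s = 0`.
  obtain ⟨p, hp, hxp⟩ := intermediate_value_Icc' (le_max_left t (s - ε / 2))
    h.continuous_x.continuousOn ⟨hneg'.le, hc⟩
  have hps : p < s := hp.2.trans_lt (max_lt ht (by linarith))
  rcases lt_trichotomy (f p) 0 with h1 | h1 | h1
  · have := h.pos_of_zero hm hn hB h1 hxp hps
    linarith
  · exact absurd (h.eq_zero_of_eq_zero hm hn h1 hxp s).1 hf.ne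
  · have := h.swap.pos_of_zero hn hm hB' (by simpa using h1) (by simpa using hxp) hps
    linarith

/-- The four types of nonconstant orbits. -/
theorem cases (h : PlanarOrbit m n f x) (hm : 2 ≤ m) (hn : 2 ≤ n) (hB : IsBarrier m n μ β)
    {μ' β' : ℝ} (hB' : IsBarrier n m μ' β') (hne : ∀ t, f t ≠ 0 ∨ x t ≠ 0) :
    (∀ t, 0 < x t) ∨ (∀ t, x t < 0) ∨ Crossing f x ∨ Crossing (fun t => -f t) (fun t => -x t) := by
  by_cases h0 : ∃ s, x s = 0
  · obtain ⟨s, hs⟩ := h0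
    rcases lt_trichotomy (f s) 0 with h1 | h1 | h1
    · exact Or.inr (Or.inr (Or.inl (h.crossing_of_zero hm hn hB hB' h1 hs)))
    · rcases hne s with h2 | h2
      · exact absurd h1 h2
      · exact absurd hs h2
    · exact Or.inr (Or.inr (Or.inr (h.swap.crossing_of_zero hn hm hB' hB (by simpa using h1)
        (by simpa using hs))))
  · push Not at h0
    rcases (h0 0).lt_or_gt with h1 | h1
    · refine Or.inr (Or.inl fun t => ?_)
      by_contra hc
      push Not at hc
      obtain ⟨p, hp⟩ := mem_range_of_exists_le_of_exists_ge h.continuous_x ⟨0, h1.le⟩ ⟨t, hc⟩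
      exact h0 p hp
    · refine Or.inl fun t => ?_
      by_contra hc
      push Not at hc
      obtain ⟨p, hp⟩ := mem_range_of_exists_le_of_exists_ge h.continuous_x ⟨t, hc⟩ ⟨0, h1.le⟩
      exact h0 p hp

/-- As long as `x > 0` for all earlier times, `f > 0`. -/
theorem f_pos_of_forall_lt (h : PlanarOrbit m n f x) (hm : 2 ≤ m) (hn : 2 ≤ n) {s : ℝ}
    (hx : ∀ t < s, 0 < x t) : 0 < f s := by
  have hmono := h.strictMonoOn_f hm hn (convex_Iic s) fun τ hτ => by
    rw [interior_Iic] at hτ; exact hx τ hτ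
  have h1 : f (s - 1) < f s := hmono (mem_Iic.2 (by linarith)) (mem_Iic.2 le_rfl) (by linarith)
  refine lt_of_le_of_lt (le_of_tendsto (h.tendsto_atBot hm hn).1 ?_) h1
  filter_upwards [eventually_le_atBot (s - 1)] with t ht
  exact hmono.monotoneOn (mem_Iic.2 (by linarith)) (mem_Iic.2 (by linarith)) ht

theorem f_neg_of_forall_lt (h : PlanarOrbit m n f x) (hm : 2 ≤ m) (hn : 2 ≤ n) {s : ℝ}
    (hx : ∀ t < s, x t < 0) : f s < 0 := by
  have := h.swap.f_pos_of_forall_lt hn hm (s := s) fun t ht => by simpa using hx t ht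
  linarith

/-- A crossing orbit enters the first quadrant strictly above the barrier. -/
theorem Crossing.sub_curve_pos (hc : Crossing f x) (h : PlanarOrbit m n f x) (hm : 2 ≤ m)
    (hn : 2 ≤ n) (hB : IsBarrier m n μ β) {t : ℝ} (hf : 0 ≤ f t) :
    0 < x t ∧ 0 < x t - curve μ β (f t) := by
  obtain ⟨s, hxs, hfs, hneg, hpos⟩ := hc
  have hst : s < t := by
    by_contra hts
    push Not at hts
    have := h.f_neg_of_forall_lt hm hn (s := t) fun τ hτ => hneg τ (by linarith)
    linarith
  -- At `f = 0` the barrier has height `0` while `x > 0`. This strict gap is then carried forward.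
  obtain ⟨p, hp, hfp⟩ := intermediate_value_Icc hst.le h.continuous_f.continuousOn ⟨hfs.le, hf⟩
  have hsp : s < p := lt_of_le_of_ne hp.1 (by rintro rfl; linarith)
  have hmono := h.strictMonoOn_f hm hn (convex_Icc p t) fun τ hτ => by
    rw [interior_Icc] at hτ; exact hpos τ (hsp.trans hτ.1)
  obtain ⟨E, hE, h1⟩ := h.exists_mul_le_sub_curve hm hn hB hp.2 fun τ hτ => by
    rw [← hfp]; exact hmono.monotoneOn (left_mem_Icc.2 hp.2) hτ hτ.1
  refine ⟨hpos t hst, lt_of_lt_of_le ?_ h1⟩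
  rw [hfp]
  simpa [curve, hE] using hpos p hsp

/-! ### Forward limits -/

/-- Since `f < 1/m` on every orbit, `x' ≥ 0` as soon as `x ≥ 1/m`. -/
theorem inv_le_of_inv_le (h : PlanarOrbit m n f x) (hm : 2 ≤ m) (hn : 2 ≤ n) {s t : ℝ}
    (hs : 1 / m ≤ x s) (hst : s ≤ t) : 1 / m ≤ x t := by
  have hx0 := h.continuous_x
  obtain ⟨E, hE, h1⟩ := exists_mul_le_of_mul_le_deriv (u := fun t => x t - 1 / m)
    (a := fun t => 1 / (m + n) * (m + n - 1 - m * n * x t ^ 2)) hst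
    (fun τ _ => (h.deriv_x τ).sub_const (1 / m)) (by fun_prop) (fun τ _ => by
      have h2 : f τ ≤ 1 / m := by rw [le_div_iff₀ (by linarith)]; linarith [h.high τ]
      have h3 := mul_nonneg (by positivity : 0 ≤ 1 / (m + n)) (h.disc τ).le
      nlinarith)
  have := mul_nonneg (sub_nonneg.2 hs) hE.le
  linarith

theorem strictMonoOn_x (h : PlanarOrbit m n f x) (hm : 2 ≤ m) (hn : 2 ≤ n) {s : ℝ}
    (hs : 1 / m ≤ x s) : StrictMonoOn x (Ici s) :=
  strictMonoOn_of_deriv_pos (convex_Ici s) h.continuous_x.continuousOn fun t ht => by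
    rw [interior_Ici] at ht
    rw [(h.deriv_x t).deriv]
    refine h.deriv_x_pos hm hn (lt_of_lt_of_le ?_ (h.inv_le_of_inv_le hm hn hs (le_of_lt ht)))
    rw [lt_div_iff₀ (by linarith)]; linarith [h.high t]

/-- The increasing `x` converges, so `D (x - f) → 0` by Barbalat's lemma. As `x - f` stays bounded
away from `0`, `D → 0`, which determines the limit. -/
theorem tendsto_of_inv_le (h : PlanarOrbit m n f x) (hm : 2 ≤ m) (hn : 2 ≤ n) {s : ℝ}
    (hs : 1 / m ≤ x s) : Tendsto x atTop (𝓝 √((m + n - 1) / (m * n))) := by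
  have hmono := h.strictMonoOn_x hm hn hs
  have hm0 : 0 < m := by linarith
  obtain ⟨c, hc⟩ : ∃ c, Tendsto x atTop (𝓝 c) := by
    have h1 : Monotone fun t => x (max s t) := fun a b hab =>
      hmono.monotoneOn (mem_Ici.2 (le_max_left _ _)) (mem_Ici.2 (le_max_left _ _))
        (max_le_max le_rfl hab)
    have h2 := tendsto_atTop_ciSup h1 ⟨1, by
      rintro _ ⟨t, rfl⟩; exact (abs_le.1 (h.abs_x_le hm hn _)).2⟩
    refine ⟨_, h2.congr' ?_⟩
    filter_upwards [eventually_ge_atTop s] with t ht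
    rw [max_eq_right ht]
  have h1 := h.tendsto_deriv_x hm hn (Or.inl rfl) hc
  set δ := x (s + 1) - 1 / m with hδ
  have hδ0 : 0 < δ := by
    have := hmono (mem_Ici.2 le_rfl) (mem_Ici.2 (by linarith)) (by linarith : s < s + 1)
    linarith
  have hD : Tendsto (fun t => m + n - 1 - m * n * x t ^ 2) atTop (𝓝 0) := by
    have h2 := h1.div_const δ
    rw [zero_div] at h2
    refine tendsto_of_tendsto_of_tendsto_of_le_of_le' tendsto_const_nhds h2
      (Eventually.of_forall fun t => (h.disc t).le) ?_
    filter_upwards [eventually_ge_atTop (s + 1)] with t ht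
    rw [le_div_iff₀ hδ0]
    refine mul_le_mul_of_nonneg_left ?_ (h.disc t).le
    have h3 : f t < 1 / m := by rw [lt_div_iff₀ hm0]; linarith [h.high t]
    have h4 := hmono.monotoneOn (mem_Ici.2 (by linarith)) (mem_Ici.2 (by linarith)) ht
    linarith
  have hc2 := ((hc.pow 2).const_mul (m * n)).const_sub (m + n - 1)
  have h5 := tendsto_nhds_unique hc2 hD
  have hc0 : 0 ≤ c := by
    refine le_trans (by positivity : 0 ≤ 1 / m) (ge_of_tendsto hc ?_)
    filter_upwards [eventually_ge_atTop s] with t ht using h.inv_le_of_inv_le hm hn hs ht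
  have : c = √((m + n - 1) / (m * n)) := by
    rw [eq_comm, Real.sqrt_eq_iff_eq_sq (div_nonneg (by linarith) (by positivity)) hc0,
      div_eq_iff (by positivity)]
    linarith
  rwa [← this]

theorem radius_gt_inv (hm : 2 ≤ m) (hn : 2 ≤ n) : 1 / m < √((m + n - 1) / (m * n)) := by
  refine Real.lt_sqrt_of_sq_lt ?_
  rw [div_pow, one_pow, div_lt_div_iff₀ (by positivity) (by positivity)]
  nlinarith [mul_pos (by linarith : 0 < m - 1) (by positivity : 0 < m * (m + n))]

/-- An orbit that stays in the strip `0 < x < 1 / m` approaches the edge `B = 0`. -/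
theorem tendsto_f_of_strip (h : PlanarOrbit m n f x) (hm : 2 ≤ m) (hn : 2 ≤ n)
    (hne : ∀ t, f t ≠ 0 ∨ x t ≠ 0) {s : ℝ} (hx : ∀ t ≥ s, 0 < x t) (hx' : ∀ t ≥ s, x t < 1 / m) :
    Tendsto f atTop (𝓝 (1 / m)) := by
  have hm0 : 0 < m := by linarith
  have hmono := h.strictMonoOn_f hm hn (convex_Ici s) fun τ hτ => by
    rw [interior_Ici] at hτ; exact hx τ (le_of_lt hτ)
  have hδ : 0 < m + n - 1 - n / m := by
    rw [sub_pos, div_lt_iff₀ hm0]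
    nlinarith [mul_pos (by linarith : 0 < m - 1) (by linarith : 0 < m + n)]
  -- In the strip the first two terms of `lyap` are bounded below, so the divergence of `lyap` must
  -- come from `log (1 - m f)`.
  have h1 : Tendsto (fun t => n * Real.log (1 - m * f t)) atTop atBot := by
    have h2 := tendsto_atBot_add_const_right atTop (-((m + n) * Real.log (m + n - 1 - n / m)
      + m * Real.log (1 + n * f s))) (h.tendsto_lyap_atTop hm hn hne)
    refine tendsto_atBot_mono' atTop ?_ h2
    filter_upwards [eventually_ge_atTop s] with t ht
    have e1 : Real.log (1 + n * f s) ≤ Real.log (1 + n * f t) := by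
      refine Real.log_le_log (h.low s) ?_
      have := hmono.monotoneOn (mem_Ici.2 le_rfl) (mem_Ici.2 ht) ht
      nlinarith
    have e2 : Real.log (m + n - 1 - n / m) ≤ Real.log (m + n - 1 - m * n * x t ^ 2) := by
      refine Real.log_le_log hδ ?_
      have h3 : x t ^ 2 ≤ (1 / m) ^ 2 := pow_le_pow_left₀ (hx t ht).le (hx' t ht).le 2
      have h4 := mul_le_mul_of_nonneg_left h3 (by positivity : 0 ≤ m * n)
      have h5 : m * n * (1 / m) ^ 2 = n / m := by field_simp
      linarith
    have e3 := mul_le_mul_of_nonneg_left e1 hm0.le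
    have e4 := mul_le_mul_of_nonneg_left e2 (by linarith : 0 ≤ m + n)
    rw [lyap]
    linarith
  have h2 : Tendsto (fun t => Real.log (1 - m * f t)) atTop atBot :=
    (tendsto_const_mul_atBot_of_pos (by linarith : 0 < n)).1 h1
  have h3 : Tendsto (fun t => 1 - m * f t) atTop (𝓝 0) :=
    (Real.tendsto_exp_atBot.comp h2).congr fun t => Real.exp_log (h.high t)
  have h4 := (h3.const_sub 1).div_const m
  rw [sub_zero] at h4
  refine h4.congr fun t => ?_
  field_simp
  ring

/-- Strictly above a barrier ending at the saddle, the orbit ends at the first Kasner point. -/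
theorem exists_inv_le_of_barrier (h : PlanarOrbit m n f x) (hm : 2 ≤ m) (hn : 2 ≤ n)
    (hB : IsBarrier m n μ (m * (μ - 1))) {s : ℝ} (hf : 0 ≤ f s) (hx : 0 < x s)
    (hu : 0 < x s - curve μ (m * (μ - 1)) (f s)) : ∃ t, 1 / m ≤ x t := by
  by_contra hc
  push Not at hc
  have hm0 : 0 < m := by linarith
  set β := m * (μ - 1) with hβ
  have hxpos : ∀ t ≥ s, 0 < x t := fun t ht => h.pos_of_barrier hm hn hB hf hx hu.le ht
  have hmono := h.strictMonoOn_f hm hn (convex_Ici s) fun τ hτ => by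
    rw [interior_Ici] at hτ; exact hxpos τ (le_of_lt hτ)
  have hfpos : ∀ t ≥ s, 0 ≤ f t := fun t ht =>
    hf.trans (hmono.monotoneOn (mem_Ici.2 le_rfl) (mem_Ici.2 ht) ht)
  have hne : ∀ t, f t ≠ 0 ∨ x t ≠ 0 := fun t => by
    by_contra h0
    push Not at h0
    exact hx.ne' (h.eq_zero_of_eq_zero hm hn h0.1 h0.2 s).2
  have hflim := h.tendsto_f_of_strip hm hn hne hxpos fun t _ => hc t
  have hupos : ∀ t ≥ s, 0 < x t - curve μ β (f t) := fun t ht => by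
    obtain ⟨E, hE, h1⟩ := h.exists_mul_le_sub_curve hm hn hB ht fun τ hτ => hfpos τ hτ.1
    exact (mul_pos hu hE).trans_le h1
  have hclim : Tendsto (fun t => curve μ β (f t)) atTop (𝓝 (1 / m)) := by
    have := (continuousAt_curve (μ := μ) hB.nonneg (by positivity : 0 ≤ 1 / m)).tendsto.comp hflim
    rwa [curve_inv hm hB.one_lt rfl] at this
  -- Trapped between the barrier and the height `1/m`, the orbit would have to run into the saddle.
  have hxlim : Tendsto x atTop (𝓝 (1 / m)) := by
    refine tendsto_of_tendsto_of_tendsto_of_le_of_le' hclim tendsto_const_nhds ?_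
      (Eventually.of_forall fun t => (hc t).le)
    filter_upwards [eventually_ge_atTop s] with t ht
    linarith [hupos t ht]
  have hαlim : Tendsto (fun t => 1 / (m + n) * ((m + n - 1 - m * n * x t ^ 2)
        - m * n * (x t + curve μ β (f t)) * (curve μ β (f t) - f t)
        - 2 * μ * (1 + n * f t) * (1 - m * f t) / (1 + β * f t) ^ 2)) atTop
      (𝓝 (1 / (m + n) * ((m + n - 1 - m * n * (1 / m) ^ 2)
        - m * n * (1 / m + 1 / m) * (1 / m - 1 / m)
        - 2 * μ * (1 + n * (1 / m)) * (1 - m * (1 / m)) / (1 + β * (1 / m)) ^ 2))) := by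
    have hden : (1 + β * (1 / m)) ^ 2 ≠ 0 := by
      have := hB.nonneg
      positivity
    exact ((((hxlim.pow 2).const_mul (m * n)).const_sub _).sub
      (((hxlim.add hclim).const_mul (m * n)).mul (hclim.sub hflim)) |>.sub
      (((((hflim.const_mul n).const_add 1).const_mul (2 * μ)).mul
        ((hflim.const_mul m).const_sub 1)).div (((hflim.const_mul β).const_add 1).pow 2)
        hden)).const_mul _
  have hαpos : 0 < 1 / (m + n) * ((m + n - 1 - m * n * (1 / m) ^ 2)
        - m * n * (1 / m + 1 / m) * (1 / m - 1 / m)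
        - 2 * μ * (1 + n * (1 / m)) * (1 - m * (1 / m)) / (1 + β * (1 / m)) ^ 2) := by
    have e1 : 1 - m * (1 / m) = 0 := by field_simp; ring
    have e2 : m * n * (1 / m) ^ 2 = n / m := by field_simp
    rw [e1, e2, sub_self, mul_zero, mul_zero, zero_div, sub_zero, sub_zero]
    refine mul_pos (by positivity) ?_
    rw [sub_pos, div_lt_iff₀ hm0]
    nlinarith [mul_pos (by linarith : 0 < m - 1) (by linarith : 0 < m + n)]
  obtain ⟨T, hT⟩ := (((hαlim.eventually (lt_mem_nhds hαpos)).and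
    (eventually_ge_atTop s))).exists_forall_of_atTop
  -- At the saddle the coefficient of the gap tends to a positive number, so the positive gap
  -- eventually does not decrease. It cannot tend to `0`.
  have humono : MonotoneOn (fun t => x t - curve μ β (f t)) (Ici T) := by
    refine monotoneOn_of_deriv_nonneg (convex_Ici T) (HasDerivAt.continuousOn fun t ht =>
      h.deriv_sub_curve hm hn hB.nonneg (hfpos t (hT t ht).2)) (fun t ht => ?_) fun t ht => ?_
    · rw [interior_Ici] at ht
      exact (h.deriv_sub_curve hm hn hB.nonneg
        (hfpos t (hT t (le_of_lt ht)).2)).differentiableAt.differentiableWithinAt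
    · rw [interior_Ici] at ht
      have hTt := hT t (le_of_lt ht)
      have h1 := hfpos t hTt.2
      rw [(h.deriv_sub_curve hm hn hB.nonneg h1).deriv]
      have h2 := hB.pos (f t) h1 (h.high t).le
      have h3 := hB.nonneg
      exact add_nonneg (mul_nonneg hTt.1.le (hupos t hTt.2).le) (by positivity)
  have hulim := hxlim.sub hclim
  rw [sub_self] at hulim
  have h1 : x T - curve μ β (f T) ≤ 0 := by
    refine ge_of_tendsto hulim ?_
    filter_upwards [eventually_ge_atTop T] with t ht
    exact humono (mem_Ici.2 le_rfl) (mem_Ici.2 ht) ht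
  linarith [hupos T (hT T le_rfl).2]

/-- Crossing orbits end at the first Kasner point. -/
theorem Crossing.exists_inv_le (hc : Crossing f x) (h : PlanarOrbit m n f x) (hm : 2 ≤ m)
    (hn : 2 ≤ n) (hB : IsBarrier m n μ (m * (μ - 1))) : ∃ t, 1 / m ≤ x t := by
  by_contra hlt
  push Not at hlt
  have hc' := hc
  obtain ⟨s, hxs, hfs, -, hpos⟩ := hc'
  have hne : ∀ t, f t ≠ 0 ∨ x t ≠ 0 := fun t => by
    by_contra h0
    push Not at h0
    exact hfs.ne (h.eq_zero_of_eq_zero hm hn h0.1 h0.2 s).1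
  have hflim := h.tendsto_f_of_strip hm hn hne (s := s + 1) (fun t ht => hpos t (by
    change t ≥ s + 1 at ht; change s < t; linarith)) fun t _ => hlt t
  obtain ⟨t, ht⟩ := (hflim.eventually (lt_mem_nhds (by positivity : 0 < 1 / m))).exists
  obtain ⟨h1, h2⟩ := hc.sub_curve_pos h hm hn hB ht.le
  obtain ⟨r, hr⟩ := h.exists_inv_le_of_barrier hm hn hB ht.le h1 h2
  linarith [hlt r]

/-- Orbits through a barrier that ends beyond the saddle come directly from the fixed point and
end at the first Kasner point. -/
theorem direct_of_barrier (h : PlanarOrbit m n f x) (hm : 2 ≤ m) (hn : 2 ≤ n)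
    (hB : IsBarrier m n μ β) (hlt : β < m * (μ - 1)) {μ' β' : ℝ} (hB' : IsBarrier n m μ' β')
    {s : ℝ} (hf : 0 < f s) (hx : x s = curve μ β (f s)) :
    (∀ t, 0 < x t) ∧ ∃ t, 1 / m ≤ x t := by
  have hxs : 0 < x s := hx ▸ curve_pos hB.one_lt hB.nonneg hf
  have hpos : ∀ t ≥ s, 0 < x t := fun t ht =>
    h.pos_of_barrier hm hn hB hf.le hxs (by rw [hx, sub_self]) ht
  have hne : ∀ t, f t ≠ 0 ∨ x t ≠ 0 := fun t => by
    by_contra h0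
    push Not at h0
    exact hf.ne' (h.eq_zero_of_eq_zero hm hn h0.1 h0.2 s).1
  refine ⟨?_, ?_⟩
  · rcases h.cases hm hn hB hB' hne with h1 | h1 | h1 | h1
    · exact h1
    · linarith [h1 s]
    · have := (h1.sub_curve_pos h hm hn hB hf.le).2
      linarith
    · obtain ⟨r, -, -, -, h2⟩ := h1
      have h3 := h2 (max s r + 1) (by
        have := le_max_right s r
        change r < max s r + 1; linarith)
      have h4 := hpos (max s r + 1) (by
        have := le_max_left s r
        change s ≤ max s r + 1; linarith)
      linarith
  · by_contra hc
    push Not at hc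
    -- If the orbit stayed below `1/m`, then `f → 1/m`; but it also stays above the curve, whose end
    -- point has height greater than `1/m`.
    have hflim := h.tendsto_f_of_strip hm hn hne hpos fun t _ => hc t
    have hmono := h.strictMonoOn_f hm hn (convex_Ici s) fun τ hτ => by
      rw [interior_Ici] at hτ; exact hpos τ (le_of_lt hτ)
    have hclim := (continuousAt_curve (μ := μ) hB.nonneg
      (by positivity : 0 ≤ 1 / m)).tendsto.comp hflim
    obtain ⟨t, ht, hts⟩ := ((hclim.eventually (lt_mem_nhds (lt_curve_inv hm hB.nonneg hlt))).and
      (eventually_ge_atTop s)).exists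
    obtain ⟨E, hE, h1⟩ := h.exists_mul_le_sub_curve hm hn hB hts fun τ hτ =>
      hf.le.trans (hmono.monotoneOn (mem_Ici.2 le_rfl) (mem_Ici.2 hτ.1) hτ.1)
    rw [hx, sub_self, zero_mul] at h1
    have := hc t
    simp only [Function.comp_apply] at ht
    linarith

/-- Crossing orbits avoid a neighbourhood of the edge `B = 0`. -/
theorem exists_le_of_crossing (hm : 2 ≤ m) (hn : 2 ≤ n) (hB : IsBarrier m n μ β)
    (hlt : β < m * (μ - 1)) : ∃ c > 0, ∃ N : ℕ, ∀ f x : ℝ → ℝ, PlanarOrbit m n f x →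
      Crossing f x → ∀ t, c * (m + n - 1 - m * n * x t ^ 2) ^ N ≤ 1 - m * f t := by
  have hm0 : 0 < m := by linarith
  obtain ⟨f₁, hf₁, hf₁0, hf₁m⟩ : ∃ f₁, 1 / m < curve μ β f₁ ∧ 0 < f₁ ∧ f₁ < 1 / m := by
    have h1 : ∀ᶠ f in 𝓝[<] (1 / m), 1 / m < curve μ β f :=
      ((continuousAt_curve (μ := μ) hB.nonneg (by positivity : 0 ≤ 1 / m)).eventually
        (lt_mem_nhds (lt_curve_inv hm hB.nonneg hlt))).filter_mono nhdsWithin_le_nhds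
    have h2 : ∀ᶠ f in 𝓝[<] (1 / m), f ∈ Ioo 0 (1 / m) := Ioo_mem_nhdsLT (by positivity)
    obtain ⟨f, h3, h4⟩ := (h1.and h2).exists
    exact ⟨f, h3, h4.1, h4.2⟩
  set δ := curve μ β f₁ - 1 / m with hδ
  have hδ0 : 0 < δ := by linarith
  -- Beyond `f₁` a crossing orbit has `x - f ≥ δ`. This `N` makes `N n (x - f)` dominate `1 + n f ≤
  -- (m + n)/m`, so `D ^ N` decays at least as fast as `1 - m f`.
  obtain ⟨N, hN⟩ := exists_nat_ge ((m + n) / (m * n * δ))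
  have hd : 0 < m + n - 1 := by linarith
  have hε : 0 < 1 - m * f₁ := by
    rw [lt_div_iff₀ hm0] at hf₁m; linarith
  -- Since `D ≤ m + n - 1`, this constant makes the claim hold wherever `f ≤ f₁`, in particular when
  -- the orbit passes `f₁`.
  set c := (1 - m * f₁) / (m + n - 1) ^ N with hcdef
  have hc0 : 0 < c := by positivity
  have hbase : ∀ y, 0 < m + n - 1 - m * n * y ^ 2 →
      c * (m + n - 1 - m * n * y ^ 2) ^ N ≤ 1 - m * f₁ := fun y hy => by
    calc c * (m + n - 1 - m * n * y ^ 2) ^ N ≤ c * (m + n - 1) ^ N := by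
          refine mul_le_mul_of_nonneg_left (pow_le_pow_left₀ hy.le ?_ N) hc0.le
          have : 0 ≤ m * n * y ^ 2 := by positivity
          linarith
      _ = 1 - m * f₁ := by rw [hcdef]; field_simp
  refine ⟨c, hc0, N, fun f x h hcr t => ?_⟩
  rcases le_total (f t) f₁ with hft | hft
  · exact (hbase _ (h.disc t)).trans (by nlinarith)
  have hcr' := hcr
  obtain ⟨s, hxs, hfs, hneg, hpos⟩ := hcr'
  have hst : s < t := by
    by_contra hts
    push Not at hts
    have := h.f_neg_of_forall_lt hm hn (s := t) fun τ hτ => hneg τ (by linarith)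
    linarith
  obtain ⟨p, hp, hfp⟩ := intermediate_value_Icc hst.le h.continuous_f.continuousOn
    ⟨hfs.le.trans hf₁0.le, hft⟩
  have hsp : s < p := lt_of_le_of_ne hp.1 (by rintro rfl; linarith)
  have hmono := h.strictMonoOn_f hm hn (convex_Icc p t) fun τ hτ => by
    rw [interior_Icc] at hτ; exact hpos τ (hsp.trans hτ.1)
  have hge : ∀ τ ∈ Icc p t, f₁ ≤ f τ := fun τ hτ => by
    rw [← hfp]; exact hmono.monotoneOn (left_mem_Icc.2 hp.2) hτ hτ.1
  have hf0 := h.continuous_f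
  have hx0 := h.continuous_x
  obtain ⟨E, hE, h1⟩ := exists_mul_le_of_mul_le_deriv
    (u := fun τ => 1 - m * f τ - c * (m + n - 1 - m * n * x τ ^ 2) ^ N)
    (a := fun τ => -(2 * m / (m + n) * (1 + n * f τ) * x τ)) hp.2
    (fun τ _ => (((h.deriv_f τ).const_mul m).const_sub 1).sub
      ((((((h.deriv_x τ).pow 2).const_mul (m * n)).const_sub (m + n - 1)).pow N).const_mul c))
    (by fun_prop) (fun τ hτ => by
      have hD := h.disc τ
      set D := m + n - 1 - m * n * x τ ^ 2 with hDdef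
      have hxf : δ ≤ x τ - f τ := by
        have e1 := (hcr.sub_curve_pos h hm hn hB (hf₁0.le.trans (hge τ hτ))).2
        have e2 := curve_mono hB.one_lt hB.nonneg hf₁0.le (hge τ hτ)
        have e3 : f τ ≤ 1 / m := by rw [le_div_iff₀ hm0]; linarith [h.high τ]
        linarith
      have hxp : 0 < x τ := hpos τ (hsp.trans_le hτ.1)
      have hN1 : 1 + n * f τ ≤ N * n * (x τ - f τ) := by
        have e3 : f τ ≤ 1 / m := by rw [le_div_iff₀ hm0]; linarith [h.high τ]
        have e4 : 1 + n * f τ ≤ (m + n) / m := by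
          have : n * f τ ≤ n * (1 / m) := mul_le_mul_of_nonneg_left e3 (by linarith)
          have e5 : (m + n) / m = 1 + n * (1 / m) := by field_simp
          linarith
        have e6 : (m + n) / m ≤ N * n * δ := by
          rw [div_le_iff₀ (by positivity)] at hN ⊢
          linarith
        have e7 : N * n * δ ≤ N * n * (x τ - f τ) :=
          mul_le_mul_of_nonneg_left hxf (by positivity)
        linarith
      have hpow : (N : ℝ) * D ^ (N - 1) * D = N * D ^ N := by
        rcases N with _ | N
        · simp
        · simp only [Nat.add_sub_cancel]; ring
      have hkey : 0 ≤ c * D ^ N * (2 * m * x τ / (m + n)) * (N * n * (x τ - f τ) - (1 + n * f τ)) :=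
        mul_nonneg (by positivity) (by linarith)
      have hd' : m + n ≠ 0 := by linarith
      have heq : -(m * (2 / (m + n) * ((1 + n * f τ) * (1 - m * f τ) * x τ))) -
          c * ((N : ℝ) * D ^ (N - 1) * -(m * n * ((2 : ℕ) * x τ ^ (2 - 1) *
            (1 / (m + n) * (D * (x τ - f τ))))))
          - (-(2 * m / (m + n) * (1 + n * f τ) * x τ)) * (1 - m * f τ - c * D ^ N)
          = c * D ^ N * (2 * m * x τ / (m + n)) * (N * n * (x τ - f τ) - (1 + n * f τ)) := by
        have : c * ((N : ℝ) * D ^ (N - 1) * -(m * n * ((2 : ℕ) * x τ ^ (2 - 1) *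
            (1 / (m + n) * (D * (x τ - f τ)))))) = -(c * (N * D ^ (N - 1) * D) *
            (m * n * (2 * x τ * (1 / (m + n) * (x τ - f τ))))) := by push_cast; ring
        rw [this, hpow]
        field_simp
        ring
      simp only [Pi.pow_apply] at *
      linarith)
  have h2 : 0 ≤ 1 - m * f p - c * (m + n - 1 - m * n * x p ^ 2) ^ N := by
    rw [hfp]; linarith [hbase _ (h.disc p)]
  have := mul_nonneg h2 hE.le
  linarith

end PlanarOrbit

/-! ### The sign of the acceleration along planar orbits -/

/-- A positive multiple of the second derivative of the reduced scale factor. -/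
def accel (m n f x : ℝ) : ℝ :=
  x * (2 * (m + n - 1) - (m * (m + n - 1) + n) * x) - (m + n - 1 - m * n * x ^ 2) * f

namespace PlanarOrbit

variable {m n : ℝ} {f x : ℝ → ℝ}

/-- A linear equation whose forcing has the sign of `-x`. This is what limits the number of phases:
zeros of `accel` are crossed in at most one direction on each side of `x = 0`. -/
theorem deriv_accel (h : PlanarOrbit m n f x) (hm : 2 ≤ m) (hn : 2 ≤ n) (t : ℝ) :
    HasDerivAt (fun t => accel m n (f t) (x t))
      (-(2 / (m + n) * (m * n * x t ^ 2 + m * (m + n) * x t - (m + n - 1)))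
        * accel m n (f t) (x t) - 2 * (m + n - 1) * x t * (1 - m * x t) ^ 2) t := by
  have hd : m + n ≠ 0 := by linarith
  have := ((h.deriv_x t).mul
    (((h.deriv_x t).const_mul (m * (m + n - 1) + n)).const_sub (2 * (m + n - 1)))).sub
    (((((h.deriv_x t).pow 2).const_mul (m * n)).const_sub (m + n - 1)).mul (h.deriv_f t))
  convert! this using 1
  simp only [accel, Pi.pow_apply]
  field_simp
  ring

theorem continuous_accel (h : PlanarOrbit m n f x) :
    Continuous fun t => accel m n (f t) (x t) := by
  have hf := h.continuous_f
  have hx := h.continuous_x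
  unfold accel
  fun_prop

theorem exists_accel_mul_le (h : PlanarOrbit m n f x) (hm : 2 ≤ m) (hn : 2 ≤ n) {s t : ℝ}
    (hst : s ≤ t) (hx : ∀ τ ∈ Icc s t, x τ ≤ 0) :
    ∃ E > 0, accel m n (f s) (x s) * E ≤ accel m n (f t) (x t) := by
  have hx0 := h.continuous_x
  refine exists_mul_le_of_mul_le_deriv
    (a := fun t => -(2 / (m + n) * (m * n * x t ^ 2 + m * (m + n) * x t - (m + n - 1)))) hst
    (fun τ _ => h.deriv_accel hm hn τ) (by fun_prop) fun τ hτ => ?_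
  have := mul_nonneg (mul_nonneg (by linarith : 0 ≤ 2 * (m + n - 1))
    (neg_nonneg.2 (hx τ hτ))) (sq_nonneg (1 - m * x τ))
  linarith

theorem exists_accel_le_mul (h : PlanarOrbit m n f x) (hm : 2 ≤ m) (hn : 2 ≤ n) {s t : ℝ}
    (hst : s ≤ t) (hx : ∀ τ ∈ Icc s t, 0 ≤ x τ) :
    ∃ E > 0, accel m n (f t) (x t) ≤ accel m n (f s) (x s) * E := by
  have hx0 := h.continuous_x
  obtain ⟨E, hE, h1⟩ := exists_mul_le_of_mul_le_deriv
    (a := fun t => -(2 / (m + n) * (m * n * x t ^ 2 + m * (m + n) * x t - (m + n - 1)))) hst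
    (fun τ _ => (h.deriv_accel hm hn τ).fun_neg) (by fun_prop) fun τ hτ => by
    have := mul_nonneg (mul_nonneg (by linarith : 0 ≤ 2 * (m + n - 1))
      (hx τ hτ)) (sq_nonneg (1 - m * x τ))
    linarith
  exact ⟨E, hE, by linarith⟩

theorem accel_pos_of_le (h : PlanarOrbit m n f x) (hm : 2 ≤ m) (hn : 2 ≤ n) {s t : ℝ}
    (hst : s ≤ t) (hx : ∀ τ ∈ Icc s t, 0 ≤ x τ) (ht : 0 < accel m n (f t) (x t)) :
    0 < accel m n (f s) (x s) := by
  obtain ⟨E, hE, h1⟩ := h.exists_accel_le_mul hm hn hst hx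
  exact (pos_iff_pos_of_mul_pos (ht.trans_le h1)).2 hE

theorem accel_pos_of_ge (h : PlanarOrbit m n f x) (hm : 2 ≤ m) (hn : 2 ≤ n) {s t : ℝ}
    (hst : s ≤ t) (hx : ∀ τ ∈ Icc s t, x τ ≤ 0) (hs : 0 < accel m n (f s) (x s)) :
    0 < accel m n (f t) (x t) := by
  obtain ⟨E, hE, h1⟩ := h.exists_accel_mul_le hm hn hst hx
  exact (mul_pos hs hE).trans_le h1

/-- An orbit starting into the first quadrant accelerates initially. -/
theorem exists_accel_pos (h : PlanarOrbit m n f x) (hm : 2 ≤ m) (hn : 2 ≤ n) {r : ℝ}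
    (hx : ∀ t < r, 0 < x t) : ∃ t < r, 0 < accel m n (f t) (x t) := by
  by_contra hc
  push Not at hc
  have hx0 := (h.tendsto_atBot hm hn).2
  have he : 0 < m * (m + n - 1) + n := by
    have := mul_pos (by linarith : 0 < m) (by linarith : 0 < m + n - 1); linarith
  have hd : 0 < m + n - 1 := by linarith
  obtain ⟨T, hT⟩ := ((hx0.eventually (gt_mem_nhds (div_pos hd he))).and
    (eventually_lt_atBot r)).exists_forall_of_atBot
  -- If `accel ≤ 0` with `x` small and positive, then `D f ≥ (m+n-1) x ≥ D x`. So `f ≥ x` and `x`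
  -- does not increase, although it must rise from its limit `0`.
  have hanti : AntitoneOn x (Iic T) := by
    refine antitoneOn_of_deriv_nonpos (convex_Iic T) h.continuous_x.continuousOn
      (fun t _ => (h.deriv_x t).differentiableAt.differentiableWithinAt) fun t ht => ?_
    rw [interior_Iic] at ht
    obtain ⟨h1, h2⟩ := hT t (le_of_lt ht)
    rw [(h.deriv_x t).deriv]
    have h3 := hx t h2
    have h4 := hc t h2
    have h5 := h.disc t
    rw [lt_div_iff₀ he] at h1
    have h6 : (m + n - 1 - m * n * x t ^ 2) * x t ≤ (m + n - 1 - m * n * x t ^ 2) * f t := by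
      rw [accel] at h4
      have h7 : 0 ≤ m * n * x t ^ 2 := by positivity
      nlinarith
    refine mul_nonpos_of_nonneg_of_nonpos (by positivity) ?_
    linarith
  have h1 : x T ≤ 0 := by
    refine ge_of_tendsto hx0 ?_
    filter_upwards [eventually_le_atBot T] with t ht
    exact hanti (mem_Iic.2 ht) (mem_Iic.2 le_rfl) ht
  linarith [hx T (hT T le_rfl).2]

/-- An orbit starting into the third quadrant does not accelerate initially. -/
theorem exists_accel_nonpos (h : PlanarOrbit m n f x) (hm : 2 ≤ m) (hn : 2 ≤ n) {r : ℝ}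
    (hx : ∀ t < r, x t < 0) : ∃ t < r, accel m n (f t) (x t) ≤ 0 := by
  by_contra hc
  push Not at hc
  have hx0 := (h.tendsto_atBot hm hn).2
  -- If `accel > 0` with `x < 0`, then `D f ≤ D x`. So `x` does not decrease, although it must fall
  -- from its limit `0`.
  have hmono : MonotoneOn x (Iio r) := by
    refine monotoneOn_of_deriv_nonneg (convex_Iio r) h.continuous_x.continuousOn
      (fun t _ => (h.deriv_x t).differentiableAt.differentiableWithinAt) fun t ht => ?_
    rw [interior_Iio] at ht
    rw [(h.deriv_x t).deriv]
    have h3 := hx t ht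
    have h4 := hc t ht
    have h5 := h.disc t
    have h6 : (m + n - 1 - m * n * x t ^ 2) * f t ≤ (m + n - 1 - m * n * x t ^ 2) * x t := by
      rw [accel] at h4
      have h7 : 0 ≤ m * n * x t ^ 2 * (-x t) :=
        mul_nonneg (by positivity) (by linarith)
      have h8 : 0 ≤ (m * (m + n - 1) + n) * x t ^ 2 := by
        have := mul_nonneg (by linarith : 0 ≤ m) (by linarith : 0 ≤ m + n - 1)
        positivity
      have h9 : 0 ≤ (m + n - 1) * (-x t) := mul_nonneg (by linarith) (by linarith)
      nlinarith
    refine mul_nonneg (by positivity) ?_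
    linarith
  have h1 : 0 ≤ x (r - 1) := by
    refine le_of_tendsto hx0 ?_
    filter_upwards [eventually_le_atBot (r - 1)] with t ht
    exact hmono (mem_Iio.2 (by linarith)) (mem_Iio.2 (by linarith)) ht
  linarith [hx (r - 1) (by linarith)]

/-- For `x > 0` acceleration propagates to all earlier `τ`; it occurs near the origin and not near
the end point. -/
theorem accel_eq_Iio_of_pos (h : PlanarOrbit m n f x) (hm : 2 ≤ m) (hn : 2 ≤ n)
    (hx : ∀ t, 0 < x t) (hT : ∀ᶠ t in atTop, accel m n (f t) (x t) < 0) :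
    ∃ r, {t | 0 < accel m n (f t) (x t)} = Iio r := by
  obtain ⟨T, hT⟩ := hT.exists
  obtain ⟨t, -, ht⟩ := h.exists_accel_pos hm hn (r := 0) fun t _ => hx t
  exact eq_Iio_of_isOpen (isOpen_lt continuous_const h.continuous_accel) ⟨t, ht⟩
    (fun s hs t hts => h.accel_pos_of_le hm hn hts (fun τ _ => (hx τ).le) hs) (T := T)
    (not_lt.2 hT.le)

/-- For `x < 0` a nonnegative `accel` would persist up to the end point, where it is negative. -/
theorem accel_neg_of_neg (h : PlanarOrbit m n f x) (hm : 2 ≤ m) (hn : 2 ≤ n)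
    (hx : ∀ t, x t < 0) (hT : ∀ᶠ t in atTop, accel m n (f t) (x t) < 0) (t : ℝ) :
    accel m n (f t) (x t) < 0 := by
  by_contra hc
  push Not at hc
  obtain ⟨T, hT, htT⟩ := (hT.and (eventually_ge_atTop t)).exists
  obtain ⟨E, hE, h1⟩ := h.exists_accel_mul_le hm hn htT fun τ _ => (hx τ).le
  have := mul_nonneg hc hE.le
  linarith

/-- At the crossing `accel = -(m+n-1) f > 0`. From either side acceleration propagates towards the
crossing time, and it is absent at some earlier and some later time. -/
theorem Crossing.accel_eq_Ioo (hc : Crossing f x) (h : PlanarOrbit m n f x) (hm : 2 ≤ m)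
    (hn : 2 ≤ n) (hT : ∀ᶠ t in atTop, accel m n (f t) (x t) < 0) :
    ∃ a b, a < b ∧ {t | 0 < accel m n (f t) (x t)} = Ioo a b := by
  obtain ⟨s, hxs, hfs, hneg, hpos⟩ := hc
  obtain ⟨T, hT, hsT⟩ := (hT.and (eventually_ge_atTop s)).exists
  obtain ⟨T₀, hT₀s, hT₀⟩ := h.exists_accel_nonpos hm hn hneg
  refine eq_Ioo_of_isOpen (isOpen_lt continuous_const h.continuous_accel) (r := s) ?_ ?_ ?_ hT₀s.le
    hsT (not_lt.2 hT₀) (not_lt.2 hT.le)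
  · have h1 := mul_neg_of_pos_of_neg (by linarith : 0 < m + n - 1) hfs
    simp only [mem_ofPred_eq, accel, hxs]
    linarith
  · intro τ hτ t hst htτ
    refine h.accel_pos_of_le hm hn htτ (fun σ hσ => ?_) hτ
    rcases (hst.trans hσ.1).eq_or_lt with h1 | h1
    · rw [← h1, hxs]
    · exact (hpos σ h1).le
  · intro τ hτ t hτt hts
    refine h.accel_pos_of_ge hm hn hτt (fun σ hσ => ?_) hτ
    rcases (hσ.2.trans hts).eq_or_lt with h1 | h1
    · rw [h1, hxs]
    · exact (hneg σ h1).le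

/-- At a downward crossing `f > 0` makes `accel < 0`. Acceleration after it would persist to the end
point; before it acceleration propagates backwards. -/
theorem Crossing.accel_eq_Iio (hc : Crossing (fun t => -f t) (fun t => -x t))
    (h : PlanarOrbit m n f x) (hm : 2 ≤ m) (hn : 2 ≤ n)
    (hT : ∀ᶠ t in atTop, accel m n (f t) (x t) < 0) :
    ∃ r, {t | 0 < accel m n (f t) (x t)} = Iio r := by
  obtain ⟨s, hxs, hfs, hpos, hneg⟩ := hc
  simp only [neg_eq_zero, neg_lt_zero, neg_pos] at hxs hfs hpos hneg
  have hs : accel m n (f s) (x s) < 0 := by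
    have h1 := mul_pos (by linarith : 0 < m + n - 1) hfs
    simp only [accel, hxs]
    linarith
  have hlt : ∀ t, 0 < accel m n (f t) (x t) → t < s := by
    intro t ht
    by_contra hst
    push Not at hst
    obtain ⟨T, hT, htT⟩ := (hT.and (eventually_ge_atTop t)).exists
    have := h.accel_pos_of_ge hm hn htT (fun σ hσ => by
      rcases (hst.trans hσ.1).eq_or_lt with h1 | h1
      · rw [← h1, hxs]
      · exact (hneg σ h1).le) ht
    linarith
  obtain ⟨t, -, ht⟩ := h.exists_accel_pos hm hn hpos
  exact eq_Iio_of_isOpen (isOpen_lt continuous_const h.continuous_accel) ⟨t, ht⟩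
    (fun τ hτ t htτ => h.accel_pos_of_le hm hn htτ
      (fun σ hσ => (hpos σ (hσ.2.trans_lt (hlt τ hτ))).le) hτ) (T := s) (not_lt.2 hs.le)

end PlanarOrbit

/-! ### Existence of barriers -/

/-- For this `β` the barrier polynomial is divisible by `1 - m f`, and `h₁`, `h₂` are the signs of
the coefficients left over. A real `μ` satisfying `h₁` exists exactly when `m + n ≥ 9`, that is,
when the eigenvalues at the origin are real. -/
theorem isBarrier_saddle {m n μ : ℝ} (hm : 2 ≤ m) (hμ : 1 < μ)
    (h₁ : 2 * μ ^ 2 ≤ (m + n - 1) * (μ - 1)) (h₂ : n * μ ^ 2 ≤ (m + n - 1) * m * (μ - 1) ^ 2) :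
    IsBarrier m n μ (m * (μ - 1)) where
  one_lt := hμ
  nonneg := mul_nonneg (by linarith) (by linarith)
  pos f hf hmf := by
    have e : ((m + n - 1) * (1 + m * (μ - 1) * f) ^ 2 - m * n * μ ^ 2 * f ^ 2)
        * (μ - 1 - m * (μ - 1) * f) - 2 * μ ^ 2 * (1 + n * f) * (1 - m * f)
        = (1 - m * f) * (((m + n - 1) * (μ - 1) - 2 * μ ^ 2)
          + ((m + n - 1) * m * (μ - 1) ^ 2 - n * μ ^ 2) * (2 * f + m * (μ - 1) * f ^ 2)) := by ring
    rw [e]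
    refine mul_nonneg hmf (add_nonneg (by linarith) (mul_nonneg (by linarith) ?_))
    have := mul_nonneg (by linarith : 0 ≤ m) (by linarith : 0 ≤ μ - 1)
    positivity

/-- The slack `k` in the strict inequality `h₂` pays for lowering `β` slightly below the value that
ends at the saddle. -/
theorem exists_isBarrier_lt {m n μ : ℝ} (hm : 2 ≤ m) (hn : 2 ≤ n) (hμ : 1 < μ)
    (h₁ : 2 * μ ^ 2 ≤ (m + n - 1) * (μ - 1)) (h₂ : n * μ ^ 2 < (m + n - 1) * m * (μ - 1) ^ 2) :
    ∃ β, IsBarrier m n μ β ∧ β < m * (μ - 1) := by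
  set b := m * (μ - 1) with hb
  set k := (m + n - 1) * m * (μ - 1) ^ 2 - n * μ ^ 2 with hk
  have hμ0 : 0 < μ - 1 := by linarith
  have hd : 0 < m + n - 1 := by linarith
  have hb0 : 0 < b := mul_pos (by linarith) hμ0
  have hk0 : 0 < k := by linarith
  set q := (μ - 1) * (m + n - 1) * (1 + b) with hq
  have hq0 : 0 < q := by positivity
  -- `η ≤ 1/2`, with `f ≤ 1/2` from `m ≥ 2`, gives `η f ≤ 1/4`; `η q ≤ k` absorbs the loss linear in
  -- `f`; `η ≤ b` keeps the new `β` nonnegative.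
  obtain ⟨η, hη0, hη1, hη2, hηb⟩ : ∃ η > 0, η ≤ 1 / 2 ∧ η * q ≤ k ∧ η ≤ b := by
    refine ⟨min (1 / 2) (min (k / q) b), by positivity, min_le_left _ _, ?_, ?_⟩
    · rw [← le_div_iff₀ hq0]
      exact (min_le_right _ _).trans (min_le_left _ _)
    · exact (min_le_right _ _).trans (min_le_right _ _)
  refine ⟨b - η, ⟨hμ, by linarith, fun f hf hmf => ?_⟩, by linarith⟩
  have hf1 : f ≤ 1 / 2 := by nlinarith
  have hbf : 0 ≤ b * f := by positivity
  set D := (m + n - 1) * (1 + (b - η) * f) ^ 2 - m * n * μ ^ 2 * f ^ 2 with hD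
  have eD : D = (m + n - 1) * (1 + 2 * (b * f)) + m * k * f ^ 2
      - (m + n - 1) * (η * f) * (2 + 2 * (b * f) - η * f) := by
    rw [hD, hk, hb]; ring
  have hηf : η * f ≤ 1 / 4 := by nlinarith
  have hηf0 : 0 ≤ η * f := by positivity
  have hηf2 : 0 ≤ (m + n - 1) * (η * f) ^ 2 := by positivity
  have hD0 : 0 ≤ D := by
    rw [eD]
    have e1 : 0 ≤ m * k * f ^ 2 := by positivity
    have e2 : (m + n - 1) * (η * f) * (1 + b * f) ≤ (m + n - 1) * (1 / 4) * (1 + b * f) := by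
      gcongr
    nlinarith [mul_nonneg hd.le hbf]
  have e : D * (μ - 1 - (b - η) * f) - 2 * μ ^ 2 * (1 + n * f) * (1 - m * f)
      = (1 - m * f) * ((μ - 1) * D - 2 * μ ^ 2 * (1 + n * f)) + η * f * D := by
    rw [hb]; ring
  rw [e]
  refine add_nonneg (mul_nonneg hmf ?_) (mul_nonneg hηf0 hD0)
  have e3 : (μ - 1) * D - 2 * μ ^ 2 * (1 + n * f) = ((m + n - 1) * (μ - 1) - 2 * μ ^ 2)
      + 2 * f * (k - η * q) + m * (μ - 1) * k * f ^ 2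
      + (μ - 1) * ((m + n - 1) * (η * f) ^ 2)
      + 2 * (μ - 1) * (m + n - 1) * (η * f) * b * (1 - f) := by
    rw [eD, hq, hk, hb]; ring
  rw [e3]
  have e4 : 0 ≤ 2 * f * (k - η * q) := mul_nonneg (by linarith) (by linarith)
  have e5 : 0 ≤ m * (μ - 1) * k * f ^ 2 := by positivity
  have e6 : 0 ≤ 2 * (μ - 1) * (m + n - 1) * (η * f) * b * (1 - f) :=
    mul_nonneg (by positivity) (by linarith)
  have e7 := mul_nonneg hμ0.le hηf2
  linarith

/-- For `m + n = 9` the condition `h₁` is `(μ - 2)² ≤ 0`, so `μ = 2` is forced and `h₂` becomes `n ≤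
2 m`, which fails only for `(2, 7)`. For `d = m + n ≥ 10` and `μ = (d-1)/3`, `h₁` is `d ≥ 10` and
`h₂` is `(d-3)(d-10) + (m-2)((d-4)² + d - 1) ≥ 0`. -/
theorem exists_isBarrier {m n : ℕ} (hm : 2 ≤ m) (hn : 2 ≤ n) (hd : 9 ≤ m + n)
    (h27 : (m, n) ≠ (2, 7)) : ∃ μ : ℝ, IsBarrier m n μ (m * (μ - 1)) := by
  have hm' : (2 : ℝ) ≤ m := by exact_mod_cast hm
  rcases hd.eq_or_lt with hd | hd
  · have h3 : 3 ≤ m := by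
      by_contra hc
      exact h27 (Prod.ext (by simp only; omega) (by simp only; omega))
    have h3' : (3 : ℝ) ≤ m := by exact_mod_cast h3
    have hd' : (9 : ℝ) = m + n := by exact_mod_cast hd
    exact ⟨2, isBarrier_saddle hm' (by norm_num) (by rw [← hd']; norm_num) (by
      rw [← hd']; linarith)⟩
  · have hd' : (10 : ℝ) ≤ m + n := by exact_mod_cast hd
    refine ⟨((m : ℝ) + n - 1) / 3, isBarrier_saddle hm' (by linarith) ?_ ?_⟩
    · nlinarith
    · have h2 : (n : ℝ) * (m + n - 1) ≤ m * (m + n - 4) ^ 2 := by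
        nlinarith [mul_nonneg (by linarith : (0 : ℝ) ≤ m + n - 3)
          (by linarith : (0 : ℝ) ≤ m + n - 10), mul_nonneg (by linarith : (0 : ℝ) ≤ m - 2)
          (by nlinarith : (0 : ℝ) ≤ (m + n - 4) ^ 2 + (m + n - 1))]
      have h3 := mul_le_mul_of_nonneg_left h2 (by linarith : (0 : ℝ) ≤ (m + n - 1) / 9)
      nlinarith

/-- With the `μ` of `exists_isBarrier`, equality in `h₂` occurs only for `n = 2 m` in the case `m +
n = 9`, i.e. `(3, 6)`, and for `(2, 8)`. -/
theorem exists_isBarrier_strict {m n : ℕ} (hm : 2 ≤ m) (hn : 2 ≤ n) (hd : 9 ≤ m + n)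
    (h27 : (m, n) ≠ (2, 7)) (h28 : (m, n) ≠ (2, 8)) (h36 : (m, n) ≠ (3, 6)) :
    ∃ μ β : ℝ, IsBarrier m n μ β ∧ β < m * (μ - 1) := by
  have hm' : (2 : ℝ) ≤ m := by exact_mod_cast hm
  have hn' : (2 : ℝ) ≤ n := by exact_mod_cast hn
  rcases hd.eq_or_lt with hd | hd
  · have h4 : 4 ≤ m := by
      by_contra hc
      rcases (by omega : m = 2 ∨ m = 3) with h | h
      · exact h27 (Prod.ext (by simp only; omega) (by simp only; omega))
      · exact h36 (Prod.ext (by simp only; omega) (by simp only; omega))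
    have h4' : (4 : ℝ) ≤ m := by exact_mod_cast h4
    have hd' : (9 : ℝ) = m + n := by exact_mod_cast hd
    exact ⟨2, exists_isBarrier_lt hm' hn' (by norm_num) (by rw [← hd']; norm_num) (by
      rw [← hd']; linarith)⟩
  · have hd' : (10 : ℝ) ≤ m + n := by exact_mod_cast hd
    refine ⟨((m : ℝ) + n - 1) / 3, exists_isBarrier_lt hm' hn' (by linarith) ?_ ?_⟩
    · nlinarith
    · have h1 : 0 < ((m : ℝ) + n - 3) * (m + n - 10)
          + (m - 2) * ((m + n - 4) ^ 2 + (m + n - 1)) := by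
        have e1 : (0 : ℝ) ≤ (m + n - 4) ^ 2 + (m + n - 1) := by nlinarith
        rcases (by omega : 11 ≤ m + n ∨ (m + n = 10 ∧ 3 ≤ m) ∨ (m = 2 ∧ n = 8)) with h | h | h
        · have h' : (11 : ℝ) ≤ m + n := by exact_mod_cast h
          have := mul_pos (by linarith : (0 : ℝ) < m + n - 3) (by linarith : (0 : ℝ) < m + n - 10)
          have := mul_nonneg (by linarith : (0 : ℝ) ≤ m - 2) e1
          linarith
        · have h' : (m : ℝ) + n = 10 := by exact_mod_cast h.1
          have h'' : (3 : ℝ) ≤ m := by exact_mod_cast h.2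
          rw [h']
          nlinarith
        · exact absurd (Prod.ext h.1 h.2) h28
      have h2 : (n : ℝ) * (m + n - 1) < m * (m + n - 4) ^ 2 := by linarith
      have h3 := mul_lt_mul_of_pos_left h2 (by linarith : (0 : ℝ) < (m + n - 1) / 9)
      nlinarith

/-! ### The phase plane -/

theorem hasDerivAt_tanh (w : ℝ) : HasDerivAt Real.tanh (1 - Real.tanh w ^ 2) w := by
  have h := (Real.hasDerivAt_sinh w).div (Real.hasDerivAt_cosh w) (Real.cosh_pos w).ne'
  have e : Real.tanh = Real.sinh / Real.cosh := by
    ext w; exact Real.tanh_eq_sinh_div_cosh w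
  rw [e]
  convert! h using 1
  have := (Real.cosh_pos w).ne'
  simp only [Pi.div_apply]
  field_simp

theorem one_sub_tanh_sq (w : ℝ) : 1 - Real.tanh w ^ 2 = 1 / Real.cosh w ^ 2 := by
  have := (Real.cosh_pos w).ne'
  rw [Real.tanh_eq_sinh_div_cosh]
  field_simp
  linarith [Real.cosh_sq w]

theorem one_sub_tanh_sq_pos (w : ℝ) : 0 < 1 - Real.tanh w ^ 2 := by
  rw [one_sub_tanh_sq]
  have := Real.cosh_pos w
  positivity

theorem continuous_tanh : Continuous Real.tanh :=
  continuous_iff_continuousAt.2 fun w => (hasDerivAt_tanh w).continuousAt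

theorem strictMono_tanh : StrictMono Real.tanh :=
  strictMono_of_deriv_pos fun w => by
    rw [(hasDerivAt_tanh w).deriv]; exact one_sub_tanh_sq_pos w

/-- The value of `|P - Q|` at the Kasner points. -/
noncomputable def radius (m n : ℝ) : ℝ := √((m + n - 1) / (m * n))

/-- `(A² - B²) / (m A² + n B²)` in terms of `y = log (A / B)`. -/
noncomputable def ratio (m n y : ℝ) : ℝ :=
  (Real.exp (2 * y) - 1) / (m * Real.exp (2 * y) + n)

/-- The vector field for `y = log (A / B)` and `w = artanh ((P - Q) / radius)`. -/
noncomputable def planeField (m n : ℝ) (z : ℝ × ℝ) : ℝ × ℝ :=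
  (radius m n * Real.tanh z.2,
    (m + n - 1) / (m + n) * (Real.tanh z.2 - ratio m n z.1 / radius m n))

section

variable {m n : ℝ}

theorem radius_pos (hm : 2 ≤ m) (hn : 2 ≤ n) : 0 < radius m n :=
  Real.sqrt_pos.2 (div_pos (by linarith) (by positivity))

theorem radius_sq (hm : 2 ≤ m) (hn : 2 ≤ n) : m * n * radius m n ^ 2 = m + n - 1 := by
  rw [radius, Real.sq_sqrt (div_nonneg (by linarith) (by positivity))]
  field_simp

theorem radius_swap (m n : ℝ) : radius n m = radius m n := by
  rw [radius, radius, add_comm n m, mul_comm n m]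

theorem one_add_ratio (hm : 2 ≤ m) (hn : 2 ≤ n) (y : ℝ) :
    1 + n * ratio m n y = (m + n) * Real.exp (2 * y) / (m * Real.exp (2 * y) + n) := by
  have : 0 < m * Real.exp (2 * y) + n := by positivity
  rw [ratio]; field_simp; ring

theorem one_sub_ratio (hm : 2 ≤ m) (hn : 2 ≤ n) (y : ℝ) :
    1 - m * ratio m n y = (m + n) / (m * Real.exp (2 * y) + n) := by
  have : 0 < m * Real.exp (2 * y) + n := by positivity
  rw [ratio]; field_simp; ring

theorem one_add_ratio_pos (hm : 2 ≤ m) (hn : 2 ≤ n) (y : ℝ) : 0 < 1 + n * ratio m n y := by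
  rw [one_add_ratio hm hn]; positivity

theorem one_sub_ratio_pos (hm : 2 ≤ m) (hn : 2 ≤ n) (y : ℝ) : 0 < 1 - m * ratio m n y := by
  rw [one_sub_ratio hm hn]; positivity

theorem hasDerivAt_ratio (hm : 2 ≤ m) (hn : 2 ≤ n) (y : ℝ) :
    HasDerivAt (ratio m n)
      (2 / (m + n) * ((1 + n * ratio m n y) * (1 - m * ratio m n y))) y := by
  have h0 : 0 < m * Real.exp (2 * y) + n := by positivity
  have h1 : HasDerivAt (fun y => Real.exp (2 * y)) (Real.exp (2 * y) * (2 * 1)) y :=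
    ((hasDerivAt_id y).const_mul 2).exp
  have := (h1.sub_const 1).div ((h1.const_mul m).add_const n) h0.ne'
  rw [one_add_ratio hm hn, one_sub_ratio hm hn]
  convert! this using 1
  field_simp
  ring

theorem ratio_neg (hm : 2 ≤ m) (hn : 2 ≤ n) (y : ℝ) : ratio m n (-y) = -ratio n m y := by
  have h0 : 0 < n * Real.exp (2 * y) + m := by positivity
  have h1 : 0 < m * (Real.exp (2 * y))⁻¹ + n := by positivity
  have h2 := Real.exp_pos (2 * y)
  rw [ratio, ratio, mul_neg, Real.exp_neg]
  field_simp
  ring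

theorem strictMono_ratio (hm : 2 ≤ m) (hn : 2 ≤ n) : StrictMono (ratio m n) :=
  strictMono_of_deriv_pos fun y => by
    rw [(hasDerivAt_ratio hm hn y).deriv]
    exact mul_pos (by positivity) (mul_pos (one_add_ratio_pos hm hn y) (one_sub_ratio_pos hm hn y))

theorem ratio_zero (m n : ℝ) : ratio m n 0 = 0 := by simp [ratio]

theorem abs_ratio_le (hm : 2 ≤ m) (hn : 2 ≤ n) (y : ℝ) : |ratio m n y| ≤ 1 := by
  have h1 := one_add_ratio_pos hm hn y
  have h2 := one_sub_ratio_pos hm hn y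
  rw [abs_le]; constructor <;> by_contra hc <;> push Not at hc <;> nlinarith

theorem lipschitz_tanh : LipschitzWith 1 Real.tanh :=
  lipschitzWith_of_nnnorm_deriv_le (fun w => (hasDerivAt_tanh w).differentiableAt) fun w => by
    rw [(hasDerivAt_tanh w).deriv, ← NNReal.coe_le_coe, coe_nnnorm, Real.norm_eq_abs,
      abs_of_pos (one_sub_tanh_sq_pos w)]
    have := sq_nonneg (Real.tanh w)
    push_cast
    linarith

theorem lipschitz_ratio (hm : 2 ≤ m) (hn : 2 ≤ n) : LipschitzWith 1 (ratio m n) :=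
  lipschitzWith_of_nnnorm_deriv_le (fun y => (hasDerivAt_ratio hm hn y).differentiableAt)
    fun y => by
    have h1 := one_add_ratio_pos hm hn y
    have h2 := one_sub_ratio_pos hm hn y
    rw [(hasDerivAt_ratio hm hn y).deriv, ← NNReal.coe_le_coe, coe_nnnorm, Real.norm_eq_abs,
      abs_of_pos (by positivity)]
    push_cast
    rw [div_mul_eq_mul_div, div_le_one (by linarith)]
    set r := ratio m n y
    nlinarith [mul_pos h1 h2, sq_nonneg (m * n * r - n), sq_nonneg (m * (1 + n * r) - n * (1 - m * r)),
      mul_pos (by linarith : 0 < m) h1, mul_pos (by linarith : 0 < n) h2,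
      mul_nonneg (by linarith : 0 ≤ m - 2) (by linarith : 0 ≤ n - 2)]

/-- The purpose of the coordinates `(y, w)`: they spread the open rectangle over the whole plane and
make the field bounded and globally Lipschitz, so the flow is complete. -/
theorem exists_lipschitz_planeField (hm : 2 ≤ m) (hn : 2 ≤ n) :
    ∃ K : NNReal, LipschitzWith K (planeField m n) := by
  have h1 : LipschitzWith _ fun z : ℝ × ℝ => Real.tanh z.2 :=
    lipschitz_tanh.comp LipschitzWith.prod_snd
  have h2 : LipschitzWith _ fun z : ℝ × ℝ => ratio m n z.1 :=
    (lipschitz_ratio hm hn).comp LipschitzWith.prod_fst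
  have h3 := (lipschitzWith_smul (radius m n)).comp h1
  have h4 := (lipschitzWith_smul ((m + n - 1) / (m + n))).comp
    (h1.sub ((lipschitzWith_smul (radius m n)⁻¹).comp h2))
  have e : planeField m n = fun z => (radius m n • Real.tanh z.2,
      ((m + n - 1) / (m + n)) • (Real.tanh z.2 - (radius m n)⁻¹ • ratio m n z.1)) := by
    ext z <;> simp only [planeField, smul_eq_mul]
    ring
  rw [e]
  exact ⟨_, h3.prodMk h4⟩

theorem exists_bound_planeField (hm : 2 ≤ m) (hn : 2 ≤ n) :
    ∃ L : NNReal, ∀ z, ‖planeField m n z‖ ≤ L := by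
  have hc := radius_pos hm hn
  have hκ : 0 ≤ (m + n - 1) / (m + n) := div_nonneg (by linarith) (by linarith)
  have ht : ∀ w, |Real.tanh w| ≤ 1 := fun w => by
    rw [← sq_le_one_iff_abs_le_one]; linarith [one_sub_tanh_sq_pos w]
  refine ⟨Real.toNNReal (radius m n + (m + n - 1) / (m + n) * (1 + 1 / radius m n)), fun z => ?_⟩
  rw [Prod.norm_def, Real.coe_toNNReal _ (by positivity)]
  refine max_le ?_ ?_
  · rw [planeField, Real.norm_eq_abs, abs_mul, abs_of_pos hc]
    have e1 : radius m n * |Real.tanh z.2| ≤ radius m n * 1 := by gcongr; exact ht _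
    have e2 : 0 ≤ (m + n - 1) / (m + n) * (1 + 1 / radius m n) := by positivity
    linarith
  · rw [planeField, Real.norm_eq_abs, abs_mul, abs_of_nonneg hκ]
    have e1 : |Real.tanh z.2 - ratio m n z.1 / radius m n| ≤ 1 + 1 / radius m n := by
      refine (abs_sub _ _).trans (add_le_add (ht _) ?_)
      rw [abs_div, abs_of_pos hc]
      gcongr
      exact abs_ratio_le hm hn _
    have e2 := mul_le_mul_of_nonneg_left e1 hκ
    linarith

/-- A complete solution in the phase plane. -/
def IsSol (m n : ℝ) (z : ℝ → ℝ × ℝ) : Prop := ∀ t, HasDerivAt z (planeField m n (z t)) t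

/-- `P - Q` in terms of the phase plane variable. -/
noncomputable def shear (m n w : ℝ) : ℝ := radius m n * Real.tanh w

theorem IsSol.planarOrbit {z : ℝ → ℝ × ℝ} (hz : IsSol m n z) (hm : 2 ≤ m) (hn : 2 ≤ n) :
    PlanarOrbit m n (fun t => ratio m n (z t).1) (fun t => shear m n (z t).2) where
  low t := one_add_ratio_pos hm hn _
  high t := one_sub_ratio_pos hm hn _
  disc t := by
    have h1 := radius_sq hm hn
    have h2 := one_sub_tanh_sq_pos (z t).2
    have : m + n - 1 - m * n * shear m n (z t).2 ^ 2
        = (m + n - 1) * (1 - Real.tanh (z t).2 ^ 2) := by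
      rw [shear, mul_pow, ← mul_assoc, h1]; ring
    rw [this]
    exact mul_pos (by linarith) h2
  deriv_f t := by
    have h1 : HasDerivAt (fun t => (z t).1) (planeField m n (z t)).1 t := (hz t).fst
    convert! (hasDerivAt_ratio hm hn (z t).1).comp t h1 using 1
    simp only [planeField, shear]
    ring
  deriv_x t := by
    have h1 : HasDerivAt (fun t => (z t).2) (planeField m n (z t)).2 t := (hz t).snd
    convert! ((hasDerivAt_tanh (z t).2).comp t h1).const_mul (radius m n) using 1
    have h2 : m + n - 1 - m * n * shear m n (z t).2 ^ 2
        = (m + n - 1) * (1 - Real.tanh (z t).2 ^ 2) := by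
      rw [shear, mul_pow, ← mul_assoc, radius_sq hm hn]; ring
    rw [h2]
    have := (radius_pos hm hn).ne'
    simp only [planeField, shear]
    field_simp

theorem IsSol.shift {z : ℝ → ℝ × ℝ} (hz : IsSol m n z) (s : ℝ) : IsSol m n fun t => z (t + s) :=
  fun t => (hz (t + s)).comp_add_const t s

theorem IsSol.neg {z : ℝ → ℝ × ℝ} (hz : IsSol m n z) (hm : 2 ≤ m) (hn : 2 ≤ n) :
    IsSol n m fun t => -z t := fun t => by
  convert! (hz t).fun_neg using 1
  simp only [planeField, Prod.fst_neg, Prod.snd_neg, Real.tanh_neg, ratio_neg hn hm,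
    radius_swap m n, Prod.neg_mk, add_comm n m]
  ext <;> simp only <;> ring

end

/-- The state with phase plane coordinates `(y, w)`. -/
noncomputable def ofPlane (m n : ℕ) (z : ℝ × ℝ) : State :=
  (Real.exp z.1 * (Real.cosh z.2 * √((m + n) * (m * Real.exp (2 * z.1) + n)))⁻¹,
    (Real.cosh z.2 * √((m + n) * (m * Real.exp (2 * z.1) + n)))⁻¹,
    (1 + n * shear m n z.2) / (m + n), (1 - m * shear m n z.2) / (m + n))

section

variable {m n : ℕ}

theorem ofPlane_B_sq (hm : 2 ≤ m) (hn : 2 ≤ n) (z : ℝ × ℝ) :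
    (ofPlane m n z).2.1 ^ 2 = (1 - Real.tanh z.2 ^ 2) / ((m + n) * (m * Real.exp (2 * z.1) + n)) := by
  have hm' : (2 : ℝ) ≤ m := by exact_mod_cast hm
  have hn' : (2 : ℝ) ≤ n := by exact_mod_cast hn
  have h0 : 0 < ((m : ℝ) + n) * (m * Real.exp (2 * z.1) + n) := by positivity
  rw [ofPlane, one_sub_tanh_sq, inv_pow, mul_pow, Real.sq_sqrt h0.le]
  have := Real.cosh_pos z.2
  field_simp

theorem ofPlane_A (z : ℝ × ℝ) : (ofPlane m n z).1 = Real.exp z.1 * (ofPlane m n z).2.1 := rfl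

theorem ofPlane_A_sq (hm : 2 ≤ m) (hn : 2 ≤ n) (z : ℝ × ℝ) :
    (ofPlane m n z).1 ^ 2 = Real.exp (2 * z.1) * (1 - Real.tanh z.2 ^ 2)
      / ((m + n) * (m * Real.exp (2 * z.1) + n)) := by
  rw [ofPlane_A, mul_pow, ofPlane_B_sq hm hn, ← Real.exp_nat_mul]
  push_cast
  ring

theorem ofPlane_B_pos (hm : 2 ≤ m) (hn : 2 ≤ n) (z : ℝ × ℝ) : 0 < (ofPlane m n z).2.1 := by
  have := Real.cosh_pos z.2
  have hm' : (2 : ℝ) ≤ m := by exact_mod_cast hm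
  have hn' : (2 : ℝ) ≤ n := by exact_mod_cast hn
  have h0 : 0 < ((m : ℝ) + n) * (m * Real.exp (2 * z.1) + n) := by positivity
  have := Real.sqrt_pos.2 h0
  unfold ofPlane
  positivity

theorem ofPlane_sub (hm : 2 ≤ m) (z : ℝ × ℝ) :
    (ofPlane m n z).2.2.1 - (ofPlane m n z).2.2.2 = shear m n z.2 := by
  have hm' : (2 : ℝ) ≤ m := by exact_mod_cast hm
  have : (m : ℝ) + n ≠ 0 := by positivity
  simp only [ofPlane]
  field_simp
  ring

theorem sumSq_ofPlane (hm : 2 ≤ m) (z : ℝ × ℝ) :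
    sumSq m n (ofPlane m n z).2.2.1 (ofPlane m n z).2.2.2
      = (1 + m * n * shear m n z.2 ^ 2) / (m + n) := by
  have hm' : (2 : ℝ) ≤ m := by exact_mod_cast hm
  have : (m : ℝ) + n ≠ 0 := by positivity
  simp only [ofPlane, sumSq]
  field_simp
  ring

theorem shear_sq (hm : 2 ≤ m) (hn : 2 ≤ n) (w : ℝ) :
    (m : ℝ) * n * shear m n w ^ 2 = (m + n - 1) * Real.tanh w ^ 2 := by
  have hm' : (2 : ℝ) ≤ m := by exact_mod_cast hm
  have hn' : (2 : ℝ) ≤ n := by exact_mod_cast hn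
  rw [shear, mul_pow, ← mul_assoc, radius_sq hm' hn']

theorem ofPlane_mem (hm : 2 ≤ m) (hn : 2 ≤ n) (z : ℝ × ℝ) : ofPlane m n z ∈ stateSpace m n := by
  have hm' : (2 : ℝ) ≤ m := by exact_mod_cast hm
  have hn' : (2 : ℝ) ≤ n := by exact_mod_cast hn
  have hd : (m : ℝ) + n ≠ 0 := by positivity
  have hB := ofPlane_B_pos hm hn z
  have hA : 0 < (ofPlane m n z).1 := by rw [ofPlane_A]; positivity
  refine ⟨⟨?_, ?_⟩, hA, hB⟩
  · field_simp
    ring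
  · change sumSq m n (ofPlane m n z).2.2.1 (ofPlane m n z).2.2.2 + ((m : ℝ) + n - 1) *
      (m * (ofPlane m n z).1 ^ 2 + n * (ofPlane m n z).2.1 ^ 2) - 1 = 0
    rw [sumSq_ofPlane hm, ofPlane_A_sq hm hn, ofPlane_B_sq hm hn, shear_sq hm hn]
    have : 0 < (m : ℝ) * Real.exp (2 * z.1) + n := by positivity
    field_simp
    ring

/-- Only the equation for `B` needs a real computation. That for `A = e^y B` follows from `y' = P -
Q`, and `P`, `Q` are affine in `x`. -/
theorem IsSol.isOrbit {z : ℝ → ℝ × ℝ} (hz : IsSol m n z) (hm : 2 ≤ m) (hn : 2 ≤ n) :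
    IsOrbit m n fun t => ofPlane m n (z t) := by
  have hm' : (2 : ℝ) ≤ m := by exact_mod_cast hm
  have hn' : (2 : ℝ) ≤ n := by exact_mod_cast hn
  intro t
  refine ⟨ofPlane_mem hm hn _, ?_⟩
  have hd : (m : ℝ) + n ≠ 0 := by positivity
  have hN : 0 < (m : ℝ) * Real.exp (2 * (z t).1) + n := by positivity
  have hdN : 0 < ((m : ℝ) + n) * (m * Real.exp (2 * (z t).1) + n) := by positivity
  have hr := radius_pos hm' hn'
  have hr2 := radius_sq hm' hn'
  have hy : HasDerivAt (fun t => (z t).1) (shear m n (z t).2) t := (hz t).fst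
  have hw : HasDerivAt (fun t => (z t).2) (((m : ℝ) + n - 1) / (m + n) *
    (Real.tanh (z t).2 - ratio m n (z t).1 / radius m n)) t := (hz t).snd
  have hx := (hz.planarOrbit hm' hn').deriv_x t
  have hsq : √(((m : ℝ) + n) * (m * Real.exp (2 * (z t).1) + n)) ^ 2
    = ((m : ℝ) + n) * (m * Real.exp (2 * (z t).1) + n) := Real.sq_sqrt hdN.le
  have hsqpos := Real.sqrt_pos.2 hdN
  have hB : HasDerivAt (fun t => (ofPlane m n (z t)).2.1) ((ofPlane m n (z t)).2.1 *
      ((ofPlane m n (z t)).2.2.2 - sumSq m n (ofPlane m n (z t)).2.2.1 (ofPlane m n (z t)).2.2.2))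
      t := by
    have h1 := (((hy.const_mul 2).exp.const_mul (m : ℝ)).add_const (n : ℝ)).const_mul ((m : ℝ) + n)
    have h2 := hw.cosh.mul (h1.sqrt hdN.ne')
    have hcs := Real.cosh_pos (z t).2
    have h3 := h2.inv (mul_pos hcs hsqpos).ne'
    convert! h3 using 1
    rw [sumSq_ofPlane hm, shear_sq hm hn]
    have hsinh : Real.sinh (z t).2 = Real.tanh (z t).2 * Real.cosh (z t).2 := by
      rw [Real.tanh_eq_sinh_div_cosh]; field_simp
    rw [hsinh]
    simp only [ofPlane, shear, ratio, Pi.mul_apply]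
    set S := √(((m : ℝ) + n) * (m * Real.exp (2 * (z t).1) + n)) with hS
    set E := Real.exp (2 * (z t).1) with hE
    set u := Real.tanh (z t).2 with hu
    set C := Real.cosh (z t).2 with hC
    set c := radius (m : ℝ) n with hc
    have hSne := hsqpos.ne'
    have hCne := hcs.ne'
    have hcne := hr.ne'
    have hNne := hN.ne'
    have e1 : ((m : ℝ) + n) * (m * (E * (2 * (c * u)))) / (2 * S)
        = S * (m * E * (c * u) / (m * E + n)) := by
      rw [div_eq_iff (by positivity)]
      field_simp
      rw [hsq]
      ring
    have e2 : (1 - m * (c * u)) / ((m : ℝ) + n) - (1 + (m + n - 1) * u ^ 2) / (m + n)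
        = -(u * (((m : ℝ) + n - 1) / (m + n) * (u - (E - 1) / (m * E + n) / c))
          + m * E * (c * u) / (m * E + n)) := by
      field_simp
      rw [← hr2]
      ring
    rw [e1, e2]
    field_simp
  have hA : HasDerivAt (fun t => (ofPlane m n (z t)).1) ((ofPlane m n (z t)).1 *
      ((ofPlane m n (z t)).2.2.1 - sumSq m n (ofPlane m n (z t)).2.2.1 (ofPlane m n (z t)).2.2.2))
      t := by
    have h1 := hy.exp.mul hB
    convert! h1 using 1
    rw [ofPlane_A, ← ofPlane_sub (n := n) hm (z t)]
    ring
  have hAsq := ofPlane_A_sq hm hn (z t)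
  have hBsq := ofPlane_B_sq hm hn (z t)
  have hss := sumSq_ofPlane (n := n) hm (z t)
  have hsh := shear_sq hm hn (z t).2
  have hP : HasDerivAt (fun t => (ofPlane m n (z t)).2.2.1) ((ofPlane m n (z t)).2.2.1 *
      (1 - sumSq m n (ofPlane m n (z t)).2.2.1 (ofPlane m n (z t)).2.2.2)
      - ((m : ℝ) + n - 1) * (ofPlane m n (z t)).1 ^ 2) t := by
    convert! ((hx.const_mul (n : ℝ)).const_add 1).div_const ((m : ℝ) + n) using 1
    rw [hss, hAsq, hsh]
    simp only [ofPlane, ratio]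
    field_simp
    ring
  have hQ : HasDerivAt (fun t => (ofPlane m n (z t)).2.2.2) ((ofPlane m n (z t)).2.2.2 *
      (1 - sumSq m n (ofPlane m n (z t)).2.2.1 (ofPlane m n (z t)).2.2.2)
      - ((m : ℝ) + n - 1) * (ofPlane m n (z t)).2.1 ^ 2) t := by
    convert! ((hx.const_mul (m : ℝ)).const_sub 1).div_const ((m : ℝ) + n) using 1
    rw [hss, hBsq, hsh]
    simp only [ofPlane, ratio]
    field_simp
    ring
  exact hA.prodMk (hB.prodMk (hP.prodMk hQ))

end

/-! ### Orbits as curves in the phase plane -/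

/-- A continuous global flow of the phase plane field. -/
structure IsFlow (m n : ℝ) (φ : ℝ → ℝ × ℝ → ℝ × ℝ) : Prop where
  zero : ∀ z, φ 0 z = z
  sol : ∀ z, IsSol m n (φ · z)
  cont : Continuous fun p : ℝ × ℝ × ℝ => φ p.1 p.2

theorem exists_isFlow {m n : ℝ} (hm : 2 ≤ m) (hn : 2 ≤ n) : ∃ φ, IsFlow m n φ := by
  obtain ⟨K, hK⟩ := exists_lipschitz_planeField hm hn
  obtain ⟨L, hL⟩ := exists_bound_planeField hm hn
  obtain ⟨φ, h1, h2, h3⟩ := exists_continuous_flow hK hL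
  exact ⟨φ, h1, h2, h3⟩

theorem IsFlow.eq {m n : ℝ} {φ : ℝ → ℝ × ℝ → ℝ × ℝ} (hφ : IsFlow m n φ) (hm : 2 ≤ m) (hn : 2 ≤ n)
    {z : ℝ → ℝ × ℝ} (hz : IsSol m n z) (s t : ℝ) : z (t + s) = φ t (z s) := by
  obtain ⟨K, hK⟩ := exists_lipschitz_planeField hm hn
  have := solution_unique hK (hz.shift s) (hφ.sol (z s)) (by simp [hφ.zero])
  exact congr_fun this t

theorem IsFlow.add {m n : ℝ} {φ : ℝ → ℝ × ℝ → ℝ × ℝ} (hφ : IsFlow m n φ) (hm : 2 ≤ m) (hn : 2 ≤ n)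
    (s t : ℝ) (z : ℝ × ℝ) : φ (t + s) z = φ t (φ s z) :=
  hφ.eq hm hn (hφ.sol z) s t

/-- The phase plane coordinates of a state. -/
noncomputable def toPlane (m n : ℕ) (X : State) : ℝ × ℝ :=
  (Real.log (X.1 / X.2.1), Real.artanh ((X.2.2.1 - X.2.2.2) / radius m n))

variable {m n : ℕ}

theorem toPlane_ofPlane (hm : 2 ≤ m) (hn : 2 ≤ n) (z : ℝ × ℝ) :
    toPlane m n (ofPlane m n z) = z := by
  have hm' : (2 : ℝ) ≤ m := by exact_mod_cast hm
  have hn' : (2 : ℝ) ≤ n := by exact_mod_cast hn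
  have hB := ofPlane_B_pos hm hn z
  have hr := (radius_pos hm' hn').ne'
  rw [toPlane, ofPlane_sub hm, ofPlane_A, mul_div_cancel_right₀ _ hB.ne', Real.log_exp, shear,
    mul_div_cancel_left₀ _ hr, Real.artanh_tanh]

theorem stateSpace_facts (hm : 2 ≤ m) {X : State} (hX : X ∈ stateSpace m n) :
    X.2.2.1 = (1 + n * (X.2.2.1 - X.2.2.2)) / (m + n) ∧
    X.2.2.2 = (1 - m * (X.2.2.1 - X.2.2.2)) / (m + n) ∧
    ((m : ℝ) + n) * (m + n - 1) * (m * X.1 ^ 2 + n * X.2.1 ^ 2)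
      = m + n - 1 - m * n * (X.2.2.1 - X.2.2.2) ^ 2 := by
  obtain ⟨A, B, P, Q⟩ := X
  obtain ⟨⟨h1, h2⟩, -, -⟩ := hX
  have hd : ((m : ℝ) + n) ≠ 0 := by
    have : 0 < m := by omega
    positivity
  simp only
  refine ⟨?_, ?_, ?_⟩
  · rw [eq_div_iff hd]; linarith
  · rw [eq_div_iff hd]; linarith
  · have hs : ((m : ℝ) + n) * sumSq m n P Q = 1 + m * n * (P - Q) ^ 2 := by
      have : (m * P + n * Q) ^ 2 = 1 := by
        rw [show (m * P + n * Q : ℝ) = 1 by linarith]; norm_num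
      rw [sumSq]; linarith
    linear_combination ((m : ℝ) + n) * h2 - hs

theorem disc_pos_of_mem (hm : 2 ≤ m) (hn : 2 ≤ n) {X : State} (hX : X ∈ stateSpace m n) :
    0 < (m : ℝ) + n - 1 - m * n * (X.2.2.1 - X.2.2.2) ^ 2 := by
  have hm' : (2 : ℝ) ≤ m := by exact_mod_cast hm
  have hn' : (2 : ℝ) ≤ n := by exact_mod_cast hn
  rw [← (stateSpace_facts hm hX).2.2]
  have := hX.2.1
  have := hX.2.2
  have : (0 : ℝ) < m + n - 1 := by linarith
  positivity

theorem div_radius_mem (hm : 2 ≤ m) (hn : 2 ≤ n) {u : ℝ}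
    (hu : 0 < (m : ℝ) + n - 1 - m * n * u ^ 2) : u / radius m n ∈ Ioo (-1 : ℝ) 1 := by
  have hm' : (2 : ℝ) ≤ m := by exact_mod_cast hm
  have hn' : (2 : ℝ) ≤ n := by exact_mod_cast hn
  have hr := radius_pos hm' hn'
  rw [mem_Ioo, ← abs_lt, ← sq_lt_one_iff_abs_lt_one, div_pow, div_lt_one (by positivity)]
  rw [← radius_sq hm' hn', ← mul_sub] at hu
  have h := (pos_iff_pos_of_mul_pos hu).1 (by positivity)
  linarith

theorem ofPlane_toPlane (hm : 2 ≤ m) (hn : 2 ≤ n) {X : State} (hX : X ∈ stateSpace m n) :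
    ofPlane m n (toPlane m n X) = X := by
  have hm' : (2 : ℝ) ≤ m := by exact_mod_cast hm
  have hn' : (2 : ℝ) ≤ n := by exact_mod_cast hn
  obtain ⟨h1, h2, h3⟩ := stateSpace_facts hm hX
  have hD := disc_pos_of_mem hm hn hX
  have hu := div_radius_mem hm hn hD
  have hr := radius_pos hm' hn'
  have hr2 := radius_sq hm' hn'
  have hA := hX.2.1
  have hB := hX.2.2
  have hsh : shear m n (toPlane m n X).2 = X.2.2.1 - X.2.2.2 := by
    rw [shear, toPlane, Real.tanh_artanh hu]; field_simp
  have hBsq : (ofPlane m n (toPlane m n X)).2.1 ^ 2 = X.2.1 ^ 2 := by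
    rw [ofPlane_B_sq hm hn]
    have e1 : Real.exp (2 * (toPlane m n X).1) = (X.1 / X.2.1) ^ 2 := by
      rw [toPlane, two_mul, Real.exp_add, Real.exp_log (by positivity)]; ring
    have e2 := shear_sq hm hn (toPlane m n X).2
    rw [hsh] at e2
    have hd1 : (0 : ℝ) < m + n - 1 := by linarith
    have e3 : 1 - Real.tanh (toPlane m n X).2 ^ 2 = ((m : ℝ) + n) * (m * X.1 ^ 2 + n * X.2.1 ^ 2) := by
      apply mul_left_cancel₀ hd1.ne'
      linarith
    rw [e1, e3, div_eq_iff (by positivity)]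
    field_simp
  have hBeq : (ofPlane m n (toPlane m n X)).2.1 = X.2.1 :=
    (pow_left_inj₀ (ofPlane_B_pos hm hn _).le hB.le two_ne_zero).1 hBsq
  have hAeq : (ofPlane m n (toPlane m n X)).1 = X.1 := by
    rw [ofPlane_A, hBeq, toPlane, Real.exp_log (by positivity)]; field_simp
  refine Prod.ext hAeq (Prod.ext hBeq (Prod.ext ?_ ?_))
  · rw [h1]; simp only [ofPlane]; rw [hsh]
  · rw [h2]; simp only [ofPlane]; rw [hsh]

theorem continuous_ofPlane (hm : 2 ≤ m) (hn : 2 ≤ n) : Continuous (ofPlane m n) := by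
  have h1 : ∀ z : ℝ × ℝ, Real.cosh z.2 * √((m + n) * (m * Real.exp (2 * z.1) + n)) ≠ 0 := fun z => by
    have := Real.cosh_pos z.2
    have hm' : (2 : ℝ) ≤ m := by exact_mod_cast hm
    have hn' : (2 : ℝ) ≤ n := by exact_mod_cast hn
    have h0 : 0 < ((m : ℝ) + n) * (m * Real.exp (2 * z.1) + n) := by positivity
    have := Real.sqrt_pos.2 h0
    positivity
  have h2 : Continuous fun z : ℝ × ℝ =>
      (Real.cosh z.2 * √((m + n) * (m * Real.exp (2 * z.1) + n)))⁻¹ :=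
    Continuous.inv₀ (Continuous.mul (Real.continuous_cosh.comp continuous_snd) (by fun_prop)) h1
  have h3 : Continuous fun z : ℝ × ℝ => shear m n z.2 :=
    continuous_const.mul (continuous_tanh.comp continuous_snd)
  unfold ofPlane
  fun_prop

theorem contDiff_field (m n : ℕ) : ContDiff ℝ 1 (field m n) := by
  have : field m n = fun z : State => (z.1 * (z.2.2.1 - (m * z.2.2.1 ^ 2 + n * z.2.2.2 ^ 2)),
    z.2.1 * (z.2.2.2 - (m * z.2.2.1 ^ 2 + n * z.2.2.2 ^ 2)),
    z.2.2.1 * (1 - (m * z.2.2.1 ^ 2 + n * z.2.2.2 ^ 2)) - ((m : ℝ) + n - 1) * z.1 ^ 2,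
    z.2.2.2 * (1 - (m * z.2.2.1 ^ 2 + n * z.2.2.2 ^ 2)) - ((m : ℝ) + n - 1) * z.2.1 ^ 2) := rfl
  rw [this]
  fun_prop

theorem stateSpace_subset (hm : 2 ≤ m) (hn : 2 ≤ n) : stateSpace m n ⊆ Metric.closedBall 0 1 := by
  have hm' : (2 : ℝ) ≤ m := by exact_mod_cast hm
  have hn' : (2 : ℝ) ≤ n := by exact_mod_cast hn
  rintro ⟨A, B, P, Q⟩ ⟨⟨-, h2⟩, -, -⟩
  simp only [sumSq] at h2
  have a1 : 0 ≤ A ^ 2 := sq_nonneg A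
  have a2 : 0 ≤ B ^ 2 := sq_nonneg B
  have a3 : 0 ≤ P ^ 2 := sq_nonneg P
  have a4 : 0 ≤ Q ^ 2 := sq_nonneg Q
  have b1 : A ^ 2 ≤ m * A ^ 2 := le_mul_of_one_le_left a1 (by linarith)
  have b2 : B ^ 2 ≤ n * B ^ 2 := le_mul_of_one_le_left a2 (by linarith)
  have b3 : P ^ 2 ≤ m * P ^ 2 := le_mul_of_one_le_left a3 (by linarith)
  have b4 : Q ^ 2 ≤ n * Q ^ 2 := le_mul_of_one_le_left a4 (by linarith)
  have b5 : (m * A ^ 2 + n * B ^ 2 : ℝ) ≤ ((m : ℝ) + n - 1) * (m * A ^ 2 + n * B ^ 2) :=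
    le_mul_of_one_le_left (by linarith) (by linarith)
  rw [mem_closedBall_zero_iff, Prod.norm_def, Prod.norm_def, Prod.norm_def]
  refine max_le ?_ (max_le ?_ (max_le ?_ ?_)) <;>
    rw [Real.norm_eq_abs, ← sq_le_one_iff_abs_le_one] <;> simp only <;> linarith

/-- Every orbit is the image of a solution in the phase plane. -/
theorem IsOrbit.exists_isSol {X : ℝ → State} (hX : IsOrbit m n X) (hm : 2 ≤ m) (hn : 2 ≤ n) :
    ∃ z, IsSol m n z ∧ X = fun t => ofPlane m n (z t) := by
  have hm' : (2 : ℝ) ≤ m := by exact_mod_cast hm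
  have hn' : (2 : ℝ) ≤ n := by exact_mod_cast hn
  obtain ⟨φ, hφ⟩ := exists_isFlow hm' hn'
  refine ⟨(φ · (toPlane m n (X 0))), hφ.sol _, ?_⟩
  have hY := (hφ.sol (toPlane m n (X 0))).isOrbit hm hn
  -- The polynomial field is Lipschitz only on bounded sets, but every orbit stays in the unit ball,
  -- which suffices for uniqueness.
  obtain ⟨K, hK⟩ := LocallyLipschitzOn.exists_lipschitzOnWith_of_compact
    (isCompact_closedBall (0 : State) 1) (contDiff_field m n).locallyLipschitz.locallyLipschitzOn
  refine ODE_solution_unique_univ (v := fun _ => field m n) (s := fun _ => Metric.closedBall 0 1)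
    (t₀ := 0) (fun _ => hK) (fun t => ⟨(hX t).2, stateSpace_subset hm hn (hX t).1⟩)
    (fun t => ⟨(hY t).2, stateSpace_subset hm hn (hY t).1⟩) ?_
  simp only [hφ.zero]
  exact (ofPlane_toPlane hm hn (hX 0).1).symm

/-! ### Limits -/

/-- By the Hamiltonian constraint `m A² + n B²` is a multiple of `D`, so convergence of the shear to
a zero of `D` alone forces `A, B → 0`. -/
theorem tendsto_ofPlane (hm : 2 ≤ m) (hn : 2 ≤ n) {z : ℝ → ℝ × ℝ} {l : Filter ℝ} {e : ℝ}
    (he : (m : ℝ) * n * e ^ 2 = m + n - 1) (h : Tendsto (fun t => shear m n (z t).2) l (𝓝 e)) :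
    Tendsto (fun t => ofPlane m n (z t)) l
      (𝓝 (0, 0, (1 + n * e) / (m + n), (1 - m * e) / (m + n))) := by
  have hm' : (2 : ℝ) ≤ m := by exact_mod_cast hm
  have hn' : (2 : ℝ) ≤ n := by exact_mod_cast hn
  have hd : (0 : ℝ) < (m + n) * (m + n - 1) := mul_pos (by linarith) (by linarith)
  have hlim := (((h.pow 2).const_mul ((m : ℝ) * n)).const_sub ((m : ℝ) + n - 1)).div_const
    (((m : ℝ) + n) * (m + n - 1))
  rw [he, sub_self, zero_div] at hlim
  have hf := fun t => (stateSpace_facts hm (ofPlane_mem hm hn (z t))).2.2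
  simp only [ofPlane_sub hm] at hf
  have key : ∀ {g : ℝ → ℝ}, (∀ t, g t ^ 2 ≤
      ((m : ℝ) + n - 1 - m * n * shear m n (z t).2 ^ 2) / ((m + n) * (m + n - 1))) →
      Tendsto g l (𝓝 0) := fun {g} hg => by
    have h1 : Tendsto (fun t => g t ^ 2) l (𝓝 0) :=
      squeeze_zero (fun t => sq_nonneg _) hg hlim
    rw [tendsto_zero_iff_abs_tendsto_zero]
    have := (Real.continuous_sqrt.tendsto 0).comp h1
    rw [Real.sqrt_zero] at this
    exact this.congr fun t => Real.sqrt_sq_eq_abs _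
  refine Tendsto.prodMk_nhds (key fun t => ?_) (Tendsto.prodMk_nhds (key fun t => ?_)
    (Tendsto.prodMk_nhds (((h.const_mul (n : ℝ)).const_add 1).div_const _)
      (((h.const_mul (m : ℝ)).const_sub 1).div_const _)))
  · rw [le_div_iff₀ hd, ← hf t, mul_comm]
    refine mul_le_mul_of_nonneg_left ?_ hd.le
    change (ofPlane m n (z t)).1 ^ 2 ≤ _
    nlinarith [sq_nonneg (ofPlane m n (z t)).1, sq_nonneg (ofPlane m n (z t)).2.1]
  · rw [le_div_iff₀ hd, ← hf t, mul_comm]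
    refine mul_le_mul_of_nonneg_left ?_ hd.le
    change (ofPlane m n (z t)).2.1 ^ 2 ≤ _
    nlinarith [sq_nonneg (ofPlane m n (z t)).1, sq_nonneg (ofPlane m n (z t)).2.1]

theorem tendsto_shear (hm : 2 ≤ m) {z : ℝ → ℝ × ℝ} {l : Filter ℝ} {F : State}
    (h : Tendsto (fun t => ofPlane m n (z t)) l (𝓝 F)) :
    Tendsto (fun t => shear m n (z t).2) l (𝓝 (F.2.2.1 - F.2.2.2)) := by
  have h1 : Continuous fun X : State => X.2.2.1 - X.2.2.2 := by fun_prop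
  exact ((h1.tendsto F).comp h).congr fun t => ofPlane_sub hm (z t)

theorem F₁_sub (hm : 2 ≤ m) : (F₁ m n).2.2.1 - (F₁ m n).2.2.2 = radius m n := by
  have : ((m : ℝ) + n) ≠ 0 := by
    have : 0 < m := by omega
    positivity
  simp only [F₁, radius]; field_simp; ring

theorem F₂_sub (hm : 2 ≤ m) : (F₂ m n).2.2.1 - (F₂ m n).2.2.2 = -radius m n := by
  have : ((m : ℝ) + n) ≠ 0 := by
    have : 0 < m := by omega
    positivity
  simp only [F₂, radius]; field_simp; ring

theorem convergesTo_F₁_iff (hm : 2 ≤ m) (hn : 2 ≤ n) {z : ℝ → ℝ × ℝ} :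
    ConvergesTo (fun t => ofPlane m n (z t)) (F₁ m n) ↔
      Tendsto (fun t => shear m n (z t).2) atTop (𝓝 (radius m n)) := by
  constructor
  · intro h
    have := tendsto_shear hm h
    rwa [F₁_sub hm] at this
  · intro h
    exact tendsto_ofPlane hm hn (radius_sq (by exact_mod_cast hm) (by exact_mod_cast hn)) h

theorem convergesTo_F₂_iff (hm : 2 ≤ m) (hn : 2 ≤ n) {z : ℝ → ℝ × ℝ} :
    ConvergesTo (fun t => ofPlane m n (z t)) (F₂ m n) ↔
      Tendsto (fun t => shear m n (z t).2) atTop (𝓝 (-radius m n)) := by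
  constructor
  · intro h
    have := tendsto_shear hm h
    rwa [F₂_sub hm] at this
  · intro h
    have := tendsto_ofPlane hm hn (e := -radius (m : ℝ) n) (by
      rw [neg_sq]; exact radius_sq (by exact_mod_cast hm) (by exact_mod_cast hn)) h
    rwa [mul_neg, ← sub_eq_add_neg, mul_neg, sub_neg_eq_add] at this

/-- The sign of the acceleration in terms of the state. -/
def accelState (m n : ℕ) (X : State) : ℝ :=
  1 - sumSq m n X.2.2.1 X.2.2.2 - (1 - X.2.2.1) ^ 2 - ((m : ℝ) + n - 1) * X.1 ^ 2

theorem accelState_ofPlane (hm : 2 ≤ m) (hn : 2 ≤ n) (z : ℝ × ℝ) :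
    accelState m n (ofPlane m n z)
      = n / ((m : ℝ) + n) ^ 2 * accel m n (ratio m n z.1) (shear m n z.2) := by
  have hm' : (2 : ℝ) ≤ m := by exact_mod_cast hm
  have hn' : (2 : ℝ) ≤ n := by exact_mod_cast hn
  have hd : ((m : ℝ) + n) ≠ 0 := by positivity
  have hd1 : ((m : ℝ) + n - 1) ≠ 0 := by linarith
  have hN : (m : ℝ) * Real.exp (2 * z.1) + n ≠ 0 := by positivity
  have h1 := shear_sq hm hn z.2
  have h2 : Real.tanh z.2 ^ 2 = (m : ℝ) * n * shear m n z.2 ^ 2 / (m + n - 1) := by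
    rw [eq_div_iff hd1]; linarith
  rw [accelState, sumSq_ofPlane hm, ofPlane_A_sq hm hn, h2]
  simp only [ofPlane, accel, ratio]
  set x := shear (m : ℝ) n z.2
  field_simp
  ring

theorem continuous_accelState (m n : ℕ) : Continuous (accelState m n) := by
  unfold accelState sumSq
  fun_prop

theorem accelState_neg (hm : 2 ≤ m) {F : State} (hs : sumSq m n F.2.2.1 F.2.2.2 = 1)
    (hP : F.2.2.1 ≠ 1) : accelState m n F < 0 := by
  have h1 : 0 < (1 - F.2.2.1) ^ 2 := by
    have : 1 - F.2.2.1 ≠ 0 := fun h => hP (by linarith)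
    positivity
  have hm' : (2 : ℝ) ≤ m := by exact_mod_cast hm
  have h2 : 0 ≤ ((m : ℝ) + n - 1) * F.1 ^ 2 :=
    mul_nonneg (by linarith [n.cast_nonneg (α := ℝ)]) (sq_nonneg _)
  rw [accelState, hs]
  linarith

theorem sumSq_of_radius (hm : 2 ≤ m) {e : ℝ} (he : (m : ℝ) * n * e ^ 2 = m + n - 1) :
    sumSq m n ((1 + n * e) / (m + n)) ((1 - m * e) / (m + n)) = 1 := by
  have hd : ((m : ℝ) + n) ≠ 0 := by
    have : 0 < m := by omega
    positivity
  rw [sumSq]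
  field_simp
  linear_combination ((m : ℝ) + n) * he

/-- `P = 1` would force `m (m + n - 1) = n`, whereas `m (m + n - 1) - n = (m - 1)(m + n) > 0`.
Together with `accelState_neg` this excludes acceleration near the Kasner points. -/
theorem ne_one_of_radius (hm : 2 ≤ m) (hn : 2 ≤ n) {e : ℝ} (he : (m : ℝ) * n * e ^ 2 = m + n - 1) :
    (1 + n * e) / ((m : ℝ) + n) ≠ 1 := by
  have hm' : (2 : ℝ) ≤ m := by exact_mod_cast hm
  have hn' : (2 : ℝ) ≤ n := by exact_mod_cast hn
  rw [Ne, div_eq_one_iff_eq (by positivity)]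
  intro h
  have h1 : (n : ℝ) * e = m + n - 1 := by linarith
  have h2 : (m : ℝ) * (n * e) ^ 2 = n * (m + n - 1) := by linear_combination (n : ℝ) * he
  rw [h1] at h2
  nlinarith [mul_pos (by linarith : (0 : ℝ) < m - 1) (by linarith : (0 : ℝ) < m + n),
    mul_pos (by linarith : (0 : ℝ) < m + n - 1)
      (mul_pos (by linarith : (0 : ℝ) < m - 1) (by linarith : (0 : ℝ) < m + n))]

theorem accelState_F₁ (hm : 2 ≤ m) (hn : 2 ≤ n) : accelState m n (F₁ m n) < 0 := by
  have he := radius_sq (m := m) (n := n) (by exact_mod_cast hm) (by exact_mod_cast hn)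
  exact accelState_neg hm (sumSq_of_radius hm he) (ne_one_of_radius hm hn he)

theorem accelState_F₂ (hm : 2 ≤ m) (hn : 2 ≤ n) : accelState m n (F₂ m n) < 0 := by
  have he : (m : ℝ) * n * (-radius m n) ^ 2 = m + n - 1 := by
    rw [neg_sq]; exact radius_sq (m := m) (n := n) (by exact_mod_cast hm) (by exact_mod_cast hn)
  have h1 := sumSq_of_radius hm he
  have h2 := ne_one_of_radius hm hn he
  rw [mul_neg, ← sub_eq_add_neg] at h1 h2
  rw [mul_neg, sub_neg_eq_add] at h1
  exact accelState_neg hm h1 h2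

theorem accelState_F_A (hn : 2 ≤ n) : accelState m n (F_A m n) < 0 := by
  have hn' : (2 : ℝ) ≤ n := by exact_mod_cast hn
  simp only [accelState, F_A, sumSq]
  have : (n : ℝ) * (1 / n) ^ 2 = 1 / n := by field_simp
  have h2 : (0 : ℝ) < 1 / n := by positivity
  nlinarith

/-- Orbits do not accelerate near their end points. -/
theorem eventually_accel_neg (hm : 2 ≤ m) (hn : 2 ≤ n) {z : ℝ → ℝ × ℝ} {F : State}
    (hF : accelState m n F < 0) (h : ConvergesTo (fun t => ofPlane m n (z t)) F) :
    ∀ᶠ t in atTop, accel m n (ratio m n (z t).1) (shear m n (z t).2) < 0 := by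
  have h1 := ((continuous_accelState m n).tendsto F).comp h
  filter_upwards [h1.eventually (gt_mem_nhds hF)] with t ht
  simp only [Function.comp_apply] at ht
  rw [accelState_ofPlane hm hn] at ht
  have hn' : (2 : ℝ) ≤ n := by exact_mod_cast hn
  have h2 : 0 < n / ((m : ℝ) + n) ^ 2 := by positivity
  by_contra hc
  push Not at hc
  have := mul_nonneg h2.le hc
  linarith

/-! ### Vacuum solutions and their reduced models -/

variable {m n : ℕ} {a b : ℝ → ℝ} {X : ℝ → State}

theorem hasDerivAt_of_rate (ha : ∀ t, 0 < t → 0 < a t)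
    (hd : ∀ t, 0 < t → DifferentiableAt ℝ a t) {t : ℝ} (ht : 0 < t) :
    HasDerivAt a (-(rate a t * a t)) t := by
  have h := (hd t ht).hasDerivAt
  have : deriv a t = -(rate a t * a t) := by
    have := (ha t ht).ne'
    rw [rate]; field_simp;
  rwa [this] at h

namespace IsVacuum

theorem dbar_redScale (h : IsVacuum m n a b) {t : ℝ} (ht : 0 < t) :
    dbar m n b (redScale m n a b) t = -((rate a t + n / ((m : ℝ) - 1) * rate b t) * a t) := by
  have hb := h.b_pos t ht
  have h1 := hasDerivAt_of_rate h.a_pos h.a_diff ht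
  have h2 := (hasDerivAt_of_rate h.b_pos h.b_diff ht).rpow_const (p := (n : ℝ) / ((m : ℝ) - 1))
    (Or.inl hb.ne')
  have h3 : HasDerivAt (redScale m n a b) _ t := h1.mul h2
  have hpos := Real.rpow_pos_of_pos hb ((n : ℝ) / ((m : ℝ) - 1))
  rw [dbar, h3.deriv, Real.rpow_sub_one hb.ne', lapse]
  field_simp
  ring

theorem dbar_dbar_redScale (h : IsVacuum m n a b) {t : ℝ} (ht : 0 < t) :
    dbar m n b (dbar m n b (redScale m n a b)) t =
      a t * ((rate a t + n / ((m : ℝ) - 1) * rate b t) * rate a t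
        - (rate a t * meanCurv m n a b t - ((m : ℝ) + n - 1) / a t ^ 2)
        - n / ((m : ℝ) - 1) * (rate b t * meanCurv m n a b t - ((m : ℝ) + n - 1) / b t ^ 2))
        / lapse m n b t := by
  have h1 := hasDerivAt_of_rate h.a_pos h.a_diff ht
  have h2 := (((h.evol_p t ht).add ((h.evol_q t ht).const_mul ((n : ℝ) / ((m : ℝ) - 1)))).mul
    h1).fun_neg
  have hev : dbar m n b (redScale m n a b) =ᶠ[𝓝 t]
      fun t => -((rate a t + n / ((m : ℝ) - 1) * rate b t) * a t) := by
    filter_upwards [lt_mem_nhds ht] with s hs using h.dbar_redScale hs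
  have h3 := h2.congr_of_eventuallyEq hev
  rw [dbar, h3.deriv]
  congr 1
  simp only [Pi.add_apply]
  ring

theorem rate_eq (h : IsVacuum m n a b) {t : ℝ} (ht : 0 < t) :
    accelState m n (stateAt m n a b t) * meanCurv m n a b t ^ 2 =
      meanCurv m n a b t ^ 2 - (m * rate a t ^ 2 + n * rate b t ^ 2)
        - (meanCurv m n a b t - rate a t) ^ 2 - ((m : ℝ) + n - 1) / a t ^ 2 := by
  have hH := (h.expanding t ht).ne
  have ha := (h.a_pos t ht).ne'
  simp only [accelState, stateAt, sumSq]
  field_simp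

/-- The Hamiltonian constraint eliminates the curvature of the second factor. What remains is a
positive factor times a function of the scale invariant state. -/
theorem dbar_dbar_eq (h : IsVacuum m n a b) (hm : 2 ≤ m) {t : ℝ} (ht : 0 < t) :
    dbar m n b (dbar m n b (redScale m n a b)) t =
      accelState m n (stateAt m n a b t) *
        (meanCurv m n a b t ^ 2 * a t / (((m : ℝ) - 1) * lapse m n b t)) := by
  have hm' : (2 : ℝ) ≤ m := by exact_mod_cast hm
  have hm1 : (m : ℝ) - 1 ≠ 0 := by linarith
  have hl : lapse m n b t ≠ 0 := (Real.rpow_pos_of_pos (h.b_pos t ht) _).ne'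
  have h1 := h.rate_eq ht
  have h2 := h.hamiltonian t ht
  have hH : meanCurv m n a b t = m * rate a t + n * rate b t := rfl
  rw [h.dbar_dbar_redScale ht, mul_div_assoc', ← mul_assoc, h1]
  have ha := (h.a_pos t ht).ne'
  have hb := (h.b_pos t ht).ne'
  rw [div_eq_div_iff hl (mul_ne_zero hm1 hl)]
  set H := meanCurv m n a b t
  set p := rate a t
  set q := rate b t
  set ia := ((m : ℝ) + n - 1) / a t ^ 2 with hia
  set ib := ((m : ℝ) + n - 1) / b t ^ 2 with hib
  have h3 : -(m * ia) - n * ib + H ^ 2 - (m * p ^ 2 + n * q ^ 2) = 0 := by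
    rw [← h2, hia, hib]; ring
  have h4 : ((p + n / ((m : ℝ) - 1) * q) * p - (p * H - ia) - n / ((m : ℝ) - 1) * (q * H - ib))
      * (m - 1) = H ^ 2 - (m * p ^ 2 + n * q ^ 2) - (H - p) ^ 2 - ia := by
    have e : ((p + n / ((m : ℝ) - 1) * q) * p - (p * H - ia) - n / ((m : ℝ) - 1) * (q * H - ib))
      * (m - 1) = ((m - 1) * p + n * q) * p - (m - 1) * (p * H - ia) - n * (q * H - ib) := by
      field_simp
    rw [e]
    linear_combination (-1) * h3 + (H - p) * hH
  calc _ = (((p + n / ((m : ℝ) - 1) * q) * p - (p * H - ia) - n / ((m : ℝ) - 1) * (q * H - ib))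
      * (m - 1)) * (a t * lapse m n b t) := by ring
    _ = _ := by rw [h4]; ring

/-- The derivative is `(p - H) a/(m - 1)`. The Hamiltonian constraint gives `m p² ≤ H²`, so `|p| <
|H|` because `m ≥ 2`, and `H < 0`. -/
theorem dbar_redScale_pos (h : IsVacuum m n a b) (hm : 2 ≤ m) (hn : 2 ≤ n) {t : ℝ} (ht : 0 < t) :
    0 < dbar m n b (redScale m n a b) t := by
  have hm' : (2 : ℝ) ≤ m := by exact_mod_cast hm
  have hn' : (2 : ℝ) ≤ n := by exact_mod_cast hn
  have hm1 : 0 < (m : ℝ) - 1 := by linarith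
  have ha := h.a_pos t ht
  have hb := h.b_pos t ht
  have hH := h.expanding t ht
  rw [h.dbar_redScale ht, neg_pos]
  refine mul_neg_of_neg_of_pos ?_ ha
  have h2 := h.hamiltonian t ht
  have e : rate a t + n / ((m : ℝ) - 1) * rate b t
      = (meanCurv m n a b t - rate a t) / (m - 1) := by
    rw [meanCurv]; field_simp; ring
  rw [e]
  refine div_neg_of_neg_of_pos ?_ hm1
  by_contra hc
  push Not at hc
  have h3 : 0 ≤ (m * ((m : ℝ) + n - 1)) / a t ^ 2 :=
    div_nonneg (mul_nonneg (by linarith) (by linarith)) (sq_nonneg _)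
  have h4 : 0 ≤ (n * ((m : ℝ) + n - 1)) / b t ^ 2 :=
    div_nonneg (mul_nonneg (by linarith) (by linarith)) (sq_nonneg _)
  rw [neg_div] at h2
  have h5 : 0 ≤ n * rate b t ^ 2 := by positivity
  have h6 : meanCurv m n a b t ^ 2 ≤ rate a t ^ 2 := by nlinarith
  have h7 : 2 * rate a t ^ 2 ≤ m * rate a t ^ 2 :=
    mul_le_mul_of_nonneg_right hm' (sq_nonneg _)
  nlinarith

end IsVacuum

/-- A vacuum solution corresponding to an orbit, with the acceleration read off the orbit. -/
theorem Corresponds.exists_time (h : Corresponds m n X a b) (hm : 2 ≤ m) (hn : 2 ≤ n) :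
    ∃ τ : ℝ → ℝ, StrictAntiOn τ (Ioi 0) ∧ (∀ σ, ∃ t, 0 < t ∧ τ t = σ) ∧
      (∀ t, 0 < t → (AccelAt m n a b t ↔ 0 < accelState m n (X (τ t)))) ∧
      ∀ t, 0 < t → (DecelAt m n a b t ↔ accelState m n (X (τ t)) < 0) := by
  obtain ⟨hv, τ, h1, h2, h3⟩ := h
  have hm' : (2 : ℝ) ≤ m := by exact_mod_cast hm
  have hpos : ∀ t, 0 < t →
      0 < meanCurv m n a b t ^ 2 * a t / (((m : ℝ) - 1) * lapse m n b t) := fun t ht => by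
    have e1 := hv.a_pos t ht
    have e2 : 0 < lapse m n b t := Real.rpow_pos_of_pos (hv.b_pos t ht) _
    have e3 : 0 < (m : ℝ) - 1 := by linarith
    have e4 := (hv.expanding t ht).ne
    positivity
  refine ⟨τ, ?_, fun σ => ?_, fun t ht => ?_, fun t ht => ?_⟩
  · refine strictAntiOn_of_deriv_neg (convex_Ioi 0)
      (fun t ht => (h1 t ht).continuousAt.continuousWithinAt) fun t ht => ?_
    rw [interior_Ioi] at ht
    rw [(h1 t ht).deriv]
    exact hv.expanding t ht
  · obtain ⟨t, ht, hσ⟩ := h2.ge (mem_univ σ)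
    exact ⟨t, ht, hσ⟩
  · rw [AccelAt, and_iff_right (hv.dbar_redScale_pos hm hn ht), hv.dbar_dbar_eq hm ht, h3 t ht,
      mul_pos_iff_of_pos_right (hpos t ht)]
  · rw [DecelAt, and_iff_right (hv.dbar_redScale_pos hm hn ht), hv.dbar_dbar_eq hm ht, h3 t ht]
    exact ⟨fun h => by
      by_contra hc
      exact absurd h (not_lt.2 (mul_nonneg (not_lt.1 hc) (hpos t ht).le)),
      fun h => mul_neg_of_neg_of_pos h (hpos t ht)⟩

/-- As `τ` decreases in `t`, the end points of the `τ`-interval are interchanged. -/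
theorem finitePhase_of_eq_Ioo (hm : 2 ≤ m) (hn : 2 ≤ n)
    (h : ∃ α β, α < β ∧ {σ | 0 < accelState m n (X σ)} = Ioo α β) : FinitePhase m n X := by
  obtain ⟨α, β, hαβ, hS⟩ := h
  intro a b hab
  obtain ⟨τ, hanti, hsurj, hacc, -⟩ := hab.exists_time hm hn
  obtain ⟨t₁, ht₁, h₁⟩ := hsurj α
  obtain ⟨t₀, ht₀, h₀⟩ := hsurj β
  refine ⟨t₀, t₁, ht₀, ?_, ?_⟩
  · rw [← hanti.lt_iff_gt ht₁ ht₀, h₁, h₀]; exact hαβ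
  · ext t
    have hmem : ∀ σ, 0 < accelState m n (X σ) ↔ σ ∈ Ioo α β := fun σ => by rw [← hS]; rfl
    constructor
    · rintro ⟨ht, h2⟩
      obtain ⟨h3, h4⟩ := (hmem _).1 ((hacc t ht).1 h2)
      rw [← h₁, hanti.lt_iff_gt ht₁ ht] at h3
      rw [← h₀, hanti.lt_iff_gt ht ht₀] at h4
      exact ⟨h4, h3⟩
    · rintro ⟨h3, h4⟩
      have ht : 0 < t := ht₀.trans h3
      refine ⟨ht, (hacc t ht).2 ((hmem _).2 ⟨?_, ?_⟩)⟩
      · rw [← h₁]; exact hanti ht ht₁ h4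
      · rw [← h₀]; exact hanti ht₀ ht h3

theorem Corresponds.accelTimes_eq_Ioi (hm : 2 ≤ m) (hn : 2 ≤ n)
    (h : ∃ r, {σ | 0 < accelState m n (X σ)} = Iio r) (hab : Corresponds m n X a b) :
    ∃ tᵢ, 0 < tᵢ ∧ accelTimes m n a b = Ioi tᵢ := by
  obtain ⟨r, hS⟩ := h
  obtain ⟨τ, hanti, hsurj, hacc, -⟩ := hab.exists_time hm hn
  obtain ⟨t₀, ht₀, h₀⟩ := hsurj r
  refine ⟨t₀, ht₀, ?_⟩
  ext t
  have hmem : ∀ σ, 0 < accelState m n (X σ) ↔ σ ∈ Iio r := fun σ => by rw [← hS]; rfl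
  constructor
  · rintro ⟨ht, h2⟩
    have h3 := (hmem _).1 ((hacc t ht).1 h2)
    rwa [mem_Iio, ← h₀, hanti.lt_iff_gt ht ht₀] at h3
  · intro h3
    have ht : 0 < t := ht₀.trans h3
    exact ⟨ht, (hacc t ht).2 ((hmem _).2 (by rw [mem_Iio, ← h₀]; exact hanti ht₀ ht h3))⟩

theorem latePhase_of_eq_Iio (hm : 2 ≤ m) (hn : 2 ≤ n)
    (h : ∃ r, {σ | 0 < accelState m n (X σ)} = Iio r) : LatePhase m n X :=
  fun _ _ hab => hab.accelTimes_eq_Ioi hm hn h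

theorem decelerating_of_neg (hm : 2 ≤ m) (hn : 2 ≤ n)
    (h : ∀ σ, accelState m n (X σ) < 0) : Decelerating m n X := by
  intro a b hab t ht
  obtain ⟨τ, -, -, -, hdec⟩ := hab.exists_time hm hn
  exact (hdec t ht).2 (h _)

theorem not_forall_accelAt (hm : 2 ≤ m) (hn : 2 ≤ n)
    (h : ∃ σ, accelState m n (X σ) < 0) (hab : Corresponds m n X a b) :
    ¬ ∀ t, 0 < t → AccelAt m n a b t := by
  intro hall
  obtain ⟨σ, hσ⟩ := h
  obtain ⟨τ, -, hsurj, hacc, -⟩ := hab.exists_time hm hn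
  obtain ⟨t, ht, rfl⟩ := hsurj σ
  exact absurd ((hacc t ht).1 (hall t ht)) (not_lt.2 hσ.le)

/-- Both properties quantify over all models of `X`, so they exclude each other only because a model
exists. -/
theorem not_finite_and_late (hX : ∃ a b, Corresponds m n X a b) (h₁ : FinitePhase m n X)
    (h₂ : LatePhase m n X) : False := by
  obtain ⟨a, b, hab⟩ := hX
  obtain ⟨t₀, t₁, -, -, h3⟩ := h₁ a b hab
  obtain ⟨t₂, -, h4⟩ := h₂ a b hab
  have h5 : max t₁ t₂ + 1 ∈ Ioi t₂ := by
    have := le_max_right t₁ t₂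
    rw [mem_Ioi]; linarith
  rw [← h4, h3] at h5
  have := le_max_left t₁ t₂
  linarith [h5.2]

theorem not_decelerating_and_late (hX : ∃ a b, Corresponds m n X a b)
    (h₁ : Decelerating m n X) (h₂ : LatePhase m n X) : False := by
  obtain ⟨a, b, hab⟩ := hX
  obtain ⟨t₂, h0, h4⟩ := h₂ a b hab
  have h5 : t₂ + 1 ∈ Ioi t₂ := by rw [mem_Ioi]; linarith
  rw [← h4] at h5
  have := (h₁ a b hab (t₂ + 1) h5.1).2
  linarith [h5.2.2]

/-! ### Existence of the vacuum solution of an orbit -/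

/-- A change of time with prescribed positive density that is integrable at the future end. -/
theorem exists_time_change {h : ℝ → ℝ} {s : ℝ → ℝ} (hs : ∀ τ, HasDerivAt h (s τ) τ) {k : ℝ}
    (hk : 0 < k) (hks : ∀ τ, k ≤ s τ) :
    ∃ τ : ℝ → ℝ, (∀ t, 0 < t → HasDerivAt τ (-Real.exp (h (τ t))) t) ∧ τ '' Ioi 0 = univ := by
  have hcont : Continuous h := continuous_iff_continuousAt.2 fun t => (hs t).continuousAt
  have hmono : Monotone fun τ => h τ - k * τ :=
    monotone_of_deriv_nonneg (fun τ => ((hs τ).sub ((hasDerivAt_id τ).const_mul k)).differentiableAt)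
      fun τ => by
        have := ((hs τ).fun_sub ((hasDerivAt_id' τ).const_mul k)).deriv
        rw [this]; linarith [hks τ]
  set g : ℝ → ℝ := fun τ => Real.exp (-h τ) with hg
  have hgc : Continuous g := by rw [hg]; fun_prop
  have hgpos : ∀ τ, 0 < g τ := fun τ => Real.exp_pos _
  set T₀ : ℝ → ℝ := fun τ => ∫ σ in (0 : ℝ)..τ, g σ with hT₀
  have hT₀d : ∀ τ, HasDerivAt T₀ (g τ) τ := fun τ =>
    intervalIntegral.integral_hasDerivAt_right (hgc.intervalIntegrable _ _)
      (hgc.stronglyMeasurableAtFilter _ _) hgc.continuousAt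
  have hT₀mono : StrictMono T₀ := strictMono_of_deriv_pos fun τ => by
    rw [(hT₀d τ).deriv]; exact hgpos τ
  set C := Real.exp (-h 0) with hC
  -- For `τ ≥ 0` the density is at most `C e^{-kτ}`: the singularity lies at finite proper time.
  have hbound : ∀ τ, T₀ τ ≤ C / k := by
    intro τ
    rcases le_total 0 τ with h0 | h0
    · have h1 : AntitoneOn (fun τ => T₀ τ + C / k * Real.exp (-(k * τ))) (Ici 0) := by
        have hd : ∀ σ, HasDerivAt (fun τ => T₀ τ + C / k * Real.exp (-(k * τ)))
            (g σ - C * Real.exp (-(k * σ))) σ := fun σ => by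
          have := (hT₀d σ).add ((((hasDerivAt_id σ).const_mul k).fun_neg.exp).const_mul (C / k))
          convert! this using 1
          simp only [id_eq]
          field_simp
          ring
        refine antitoneOn_of_deriv_nonpos (convex_Ici 0) (HasDerivAt.continuousOn fun σ _ => hd σ)
          (fun σ _ => (hd σ).differentiableAt.differentiableWithinAt) fun σ hσ => ?_
        rw [interior_Ici] at hσ
        rw [(hd σ).deriv, sub_nonpos, hC, ← Real.exp_add]
        refine Real.exp_le_exp.2 ?_
        have := hmono (le_of_lt hσ)
        simp only [mul_zero, sub_zero] at this
        linarith
      have h2 := h1 (mem_Ici.2 le_rfl) (mem_Ici.2 h0) h0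
      simp only [mul_zero, neg_zero, Real.exp_zero, mul_one] at h2
      have h3 : T₀ 0 = 0 := by simp [hT₀]
      have h4 : 0 ≤ C / k * Real.exp (-(k * τ)) := by positivity
      linarith
    · have h3 : T₀ 0 = 0 := by simp [hT₀]
      have h4 := hT₀mono.monotone h0
      have h5 : 0 ≤ C / k := by positivity
      linarith
  set S := ⨆ τ, T₀ τ with hS
  have hbdd : BddAbove (range T₀) := ⟨C / k, by rintro _ ⟨τ, rfl⟩; exact hbound τ⟩
  have hTtop : Tendsto T₀ atTop (𝓝 S) := tendsto_atTop_ciSup hT₀mono.monotone hbdd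
  have hlt : ∀ τ, T₀ τ < S := fun τ =>
    (hT₀mono (lt_add_one τ)).trans_le (le_ciSup hbdd _)
  -- For `τ ≤ 0` the density is at least `C`: the proper time towards `τ → -∞` is infinite.
  have hTbot : Tendsto T₀ atBot atBot := by
    have h1 : MonotoneOn (fun τ => T₀ τ - C * τ) (Iic 0) := by
      have hd : ∀ σ, HasDerivAt (fun τ => T₀ τ - C * τ) (g σ - C) σ := fun σ => by
        have := (hT₀d σ).fun_sub ((hasDerivAt_id' σ).const_mul C)
        rwa [mul_one] at this
      refine monotoneOn_of_deriv_nonneg (convex_Iic 0) (HasDerivAt.continuousOn fun σ _ => hd σ)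
        (fun σ _ => (hd σ).differentiableAt.differentiableWithinAt) fun σ hσ => ?_
      rw [interior_Iic] at hσ
      rw [(hd σ).deriv, sub_nonneg]
      refine Real.exp_le_exp.2 (neg_le_neg ?_)
      have h2 := hmono (le_of_lt (mem_Iio.1 hσ))
      have h3 := mul_nonpos_of_nonneg_of_nonpos hk.le (le_of_lt (mem_Iio.1 hσ))
      simp only [mul_zero] at h2
      linarith
    refine tendsto_atBot_mono' atBot ?_ (tendsto_id.const_mul_atBot (Real.exp_pos (-h 0)))
    filter_upwards [eventually_le_atBot 0] with τ hτ
    have h2 := h1 (mem_Iic.2 hτ) (mem_Iic.2 le_rfl) hτ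
    have h3 : T₀ 0 = 0 := by simp [hT₀]
    simp only [mul_zero, h3] at h2
    simp only [id_eq]
    linarith
  -- The proper time since the singularity, `t = S - T₀ τ`, maps `ℝ` decreasingly onto `(0, ∞)`.
  -- Composing with `-log` gives an order isomorphism of `ℝ`, whose inverse is continuous.
  set R : ℝ → ℝ := fun τ => -Real.log (S - T₀ τ) with hR
  have hRmono : StrictMono R := fun σ τ hστ => by
    have := hT₀mono hστ
    have h2 := Real.log_lt_log (sub_pos.2 (hlt τ)) (by linarith : S - T₀ τ < S - T₀ σ)
    simp only [hR]
    linarith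
  have hT₀c : Continuous T₀ := continuous_iff_continuousAt.2 fun τ => (hT₀d τ).continuousAt
  have hRc : Continuous R := by
    refine (Continuous.log (by fun_prop) fun τ => (sub_pos.2 (hlt τ)).ne').neg
  have hRtop : Tendsto R atTop atTop := by
    have h1 : Tendsto (fun τ => S - T₀ τ) atTop (𝓝[>] 0) := by
      refine tendsto_nhdsWithin_iff.2 ⟨?_, Eventually.of_forall fun τ => sub_pos.2 (hlt τ)⟩
      simpa using hTtop.const_sub S
    exact tendsto_neg_atBot_atTop.comp (Real.tendsto_log_nhdsGT_zero.comp h1)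
  have hRbot : Tendsto R atBot atBot := by
    have h1 : Tendsto (fun τ => S - T₀ τ) atBot atTop := by
      have := tendsto_atTop_add_const_left atBot S (tendsto_neg_atBot_atTop.comp hTbot)
      simpa [Function.comp_def, sub_eq_add_neg] using this
    exact tendsto_neg_atTop_atBot.comp (Real.tendsto_log_atTop.comp h1)
  have hRsurj : Function.Surjective R := hRc.surjective hRtop hRbot
  set e := hRmono.orderIsoOfSurjective R hRsurj with he
  have heR : ∀ y, R (e.symm y) = y := fun y => e.apply_symm_apply y
  set τ : ℝ → ℝ := fun t => e.symm (-Real.log t) with hτ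
  have hinv : ∀ t, 0 < t → S - T₀ (τ t) = t := fun t ht => by
    have h1 := heR (-Real.log t)
    simp only [hR, neg_inj] at h1
    exact Real.log_injOn_pos (sub_pos.2 (hlt _)) ht h1
  refine ⟨τ, fun t ht => ?_, ?_⟩
  · have hc : ContinuousAt τ t :=
      e.symm.continuous.continuousAt.comp (Real.continuousAt_log ht.ne').neg
    have := HasDerivAt.of_local_left_inverse hc ((hT₀d (τ t)).const_sub S)
      (neg_ne_zero.2 (hgpos _).ne') (by
        filter_upwards [lt_mem_nhds ht] with s hs using hinv s hs)
    convert! this using 1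
    rw [hg, ← neg_inv, ← Real.exp_neg, neg_neg]
  · refine eq_univ_of_forall fun σ => ⟨S - T₀ σ, sub_pos.2 (hlt σ), ?_⟩
    exact e.symm_apply_apply σ

/-- The evolution equations give `dH/dτ = s H`, so `H = -e^h` with `h' = s`. Then `a = e^{-h}/A` and
`b = e^{-h}/B` are forced, and `t` comes from `dτ/dt = H`. -/
theorem exists_corresponds (hX : IsOrbit m n X) (hm : 2 ≤ m) (hn : 2 ≤ n) :
    ∃ a b, Corresponds m n X a b := by
  have hm' : (2 : ℝ) ≤ m := by exact_mod_cast hm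
  have hn' : (2 : ℝ) ≤ n := by exact_mod_cast hn
  set s : ℝ → ℝ := fun τ => sumSq m n (X τ).2.2.1 (X τ).2.2.2 with hs
  have hXc : Continuous X := continuous_iff_continuousAt.2 fun τ => (hX τ).2.continuousAt
  have hsc : Continuous s := by rw [hs]; unfold sumSq; fun_prop
  set h : ℝ → ℝ := fun τ => ∫ σ in (0 : ℝ)..τ, s σ with hh
  have hhd : ∀ τ, HasDerivAt h (s τ) τ := fun τ =>
    intervalIntegral.integral_hasDerivAt_right (hsc.intervalIntegrable _ _)
      (hsc.stronglyMeasurableAtFilter _ _) hsc.continuousAt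
  -- By the trace constraint `(m + n) s = 1 + m n (P - Q)²`.
  have hsk : ∀ τ, 1 / ((m : ℝ) + n) ≤ s τ := fun τ => by
    obtain ⟨⟨h1, -⟩, -, -⟩ := (hX τ).1
    rw [div_le_iff₀ (by positivity), hs]
    simp only [sumSq]
    have h2 : (m : ℝ) * (X τ).2.2.1 + n * (X τ).2.2.2 = 1 := by linarith
    have h3 : ((m : ℝ) * (X τ).2.2.1 + n * (X τ).2.2.2) ^ 2 = 1 := by rw [h2]; norm_num
    have h4 : 0 ≤ (m : ℝ) * n * ((X τ).2.2.1 - (X τ).2.2.2) ^ 2 := by positivity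
    linarith
  obtain ⟨τ, hτ, himg⟩ := exists_time_change hhd (by positivity) hsk
  have hA : ∀ σ, HasDerivAt (fun σ => (X σ).1) ((X σ).1 * ((X σ).2.2.1 - s σ)) σ :=
    fun σ => (hX σ).2.fst
  have hB : ∀ σ, HasDerivAt (fun σ => (X σ).2.1) ((X σ).2.1 * ((X σ).2.2.2 - s σ)) σ :=
    fun σ => (hX σ).2.snd.fst
  have hP : ∀ σ, HasDerivAt (fun σ => (X σ).2.2.1) ((X σ).2.2.1 * (1 - s σ)
    - ((m : ℝ) + n - 1) * (X σ).1 ^ 2) σ := fun σ => (hX σ).2.snd.snd.fst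
  have hQ : ∀ σ, HasDerivAt (fun σ => (X σ).2.2.2) ((X σ).2.2.2 * (1 - s σ)
    - ((m : ℝ) + n - 1) * (X σ).2.1 ^ 2) σ := fun σ => (hX σ).2.snd.snd.snd
  have hApos : ∀ σ, 0 < (X σ).1 := fun σ => (hX σ).1.2.1
  have hBpos : ∀ σ, 0 < (X σ).2.1 := fun σ => (hX σ).1.2.2
  have scale : ∀ {Y y : ℝ → ℝ}, (∀ σ, 0 < Y σ) →
      (∀ σ, HasDerivAt Y (Y σ * (y σ - s σ)) σ) → ∀ t, 0 < t →
      HasDerivAt (fun t => Real.exp (-h (τ t)) / Y (τ t)) (y (τ t) / Y (τ t)) t := by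
    intro Y y hY hY' t ht
    have h1 := ((hhd (τ t)).fun_neg.exp.fun_div (hY' (τ t)) (hY _).ne').comp t (hτ t ht)
    convert! h1 using 1
    have h2 := (hY (τ t)).ne'
    rw [Real.exp_neg]
    have h3 := (Real.exp_pos (h (τ t))).ne'
    field_simp
    ring
  have scale_rate : ∀ {Y y : ℝ → ℝ}, (∀ σ, 0 < Y σ) →
      (∀ σ, HasDerivAt Y (Y σ * (y σ - s σ)) σ) → ∀ t, 0 < t →
      rate (fun t => Real.exp (-h (τ t)) / Y (τ t)) t = -(y (τ t) * Real.exp (h (τ t))) := by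
    intro Y y hY hY' t ht
    rw [rate, (scale hY hY' t ht).deriv, Real.exp_neg]
    have h2 := (hY (τ t)).ne'
    have h3 := (Real.exp_pos (h (τ t))).ne'
    field_simp
  have scale_evol : ∀ {Y y : ℝ → ℝ}, (∀ σ, 0 < Y σ) →
      (∀ σ, HasDerivAt Y (Y σ * (y σ - s σ)) σ) →
      (∀ σ, HasDerivAt y (y σ * (1 - s σ) - ((m : ℝ) + n - 1) * Y σ ^ 2) σ) → ∀ t, 0 < t →
      HasDerivAt (rate fun t => Real.exp (-h (τ t)) / Y (τ t))
        (-(y (τ t) * Real.exp (h (τ t))) * -Real.exp (h (τ t))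
          - ((m : ℝ) + n - 1) / (Real.exp (-h (τ t)) / Y (τ t)) ^ 2) t := by
    intro Y y hY hY' hy t ht
    have h1 := ((hy (τ t)).mul (hhd (τ t)).exp).fun_neg.comp t (hτ t ht)
    refine (h1.congr_of_eventuallyEq ?_).congr_deriv ?_
    · filter_upwards [lt_mem_nhds ht] with r hr using scale_rate hY hY' r hr
    · have h2 := (hY (τ t)).ne'
      rw [Real.exp_neg]
      have h3 := (Real.exp_pos (h (τ t))).ne'
      field_simp
      ring
  set a : ℝ → ℝ := fun t => Real.exp (-h (τ t)) / (X (τ t)).1 with ha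
  set b : ℝ → ℝ := fun t => Real.exp (-h (τ t)) / (X (τ t)).2.1 with hb
  have hra := scale_rate hApos hA
  have hrb := scale_rate hBpos hB
  have hH : ∀ t, 0 < t → meanCurv m n a b t = -Real.exp (h (τ t)) := fun t ht => by
    have h1 := (hX (τ t)).1.1.1
    rw [meanCurv, hra t ht, hrb t ht]
    linear_combination (-Real.exp (h (τ t))) * h1
  have hexp : ∀ t, Real.exp (-h (τ t)) = (Real.exp (h (τ t)))⁻¹ := fun t => Real.exp_neg _
  refine ⟨a, b, ⟨fun t _ => div_pos (Real.exp_pos _) (hApos _), fun t _ =>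
    div_pos (Real.exp_pos _) (hBpos _), fun t ht => (scale hApos hA t ht).differentiableAt,
    fun t ht => (scale hBpos hB t ht).differentiableAt, fun t ht => ?_, fun t ht => ?_,
    fun t ht => ?_, fun t ht => ?_⟩, τ, fun t ht => ?_, himg, fun t ht => ?_⟩
  · rw [hra t ht, hH t ht]; exact scale_evol hApos hA hP t ht
  · rw [hrb t ht, hH t ht]; exact scale_evol hBpos hB hQ t ht
  · have h1 : sumSq m n (X (τ t)).2.2.1 (X (τ t)).2.2.2 + ((m : ℝ) + n - 1) *
      (m * (X (τ t)).1 ^ 2 + n * (X (τ t)).2.1 ^ 2) - 1 = 0 := (hX (τ t)).1.1.2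
    rw [hra t ht, hrb t ht, hH t ht]
    simp only [ha, hb, hexp]
    have h3 := (Real.exp_pos (h (τ t))).ne'
    have h4 := (hApos (τ t)).ne'
    have h5 := (hBpos (τ t)).ne'
    rw [sumSq] at h1
    field_simp
    linear_combination (-Real.exp (h (τ t)) ^ 2) * h1
  · rw [hH t ht]; exact neg_neg_of_pos (Real.exp_pos _)
  · rw [hH t ht]; exact hτ t ht
  · have h3 := (Real.exp_pos (h (τ t))).ne'
    have h4 := (hApos (τ t)).ne'
    have h5 := (hBpos (τ t)).ne'
    rw [stateAt, hH t ht, hra t ht, hrb t ht]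
    simp only [ha, hb, hexp]
    refine Prod.ext ?_ (Prod.ext ?_ (Prod.ext ?_ ?_)) <;> simp only <;> field_simp

/-! ### Density of the generic orbits -/

theorem tanh_sub_mul_ge {q a b : ℝ} (ha : |Real.tanh a| ≤ q) (hb : |Real.tanh b| ≤ q) :
    (1 - q ^ 2) * (a - b) ^ 2 ≤ (Real.tanh a - Real.tanh b) * (a - b) := by
  wlog hab : b ≤ a generalizing a b
  · have := this hb ha (le_of_not_ge hab)
    linarith
  have h := (convex_Icc b a).mul_sub_le_image_sub_of_le_deriv continuous_tanh.continuousOn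
    (fun w _ => (hasDerivAt_tanh w).differentiableAt.differentiableWithinAt)
    (C := 1 - q ^ 2) (fun w hw => by
      rw [interior_Icc] at hw
      rw [(hasDerivAt_tanh w).deriv, sub_le_sub_iff_left, sq_le_sq, abs_of_nonneg
        ((abs_nonneg _).trans ha)]
      have h1 := strictMono_tanh hw.1
      have h2 := strictMono_tanh hw.2
      rw [abs_le] at *
      constructor <;> linarith) b (left_mem_Icc.2 hab) a (right_mem_Icc.2 hab) hab
  nlinarith

theorem abs_tanh_sub_le (a b : ℝ) : |Real.tanh a - Real.tanh b| ≤ |a - b| := by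
  simpa [Real.dist_eq] using lipschitz_tanh.dist_le_mul a b

/-! ### Trapped orbits near an edge are determined by their starting height -/

section

variable {m n : ℝ}

/-- `ratio` saturates at `1/m`: its derivative contains the factor `1 - m ratio = (m+n)/(m e^{2y} +
n)`, which is small for large `y`. -/
theorem exists_abs_ratio_sub_le (hm : 2 ≤ m) (hn : 2 ≤ n) {σ : ℝ} (hσ : 0 < σ) :
    ∃ Y > 0, ∀ a b, Y ≤ a → Y ≤ b → |ratio m n a - ratio m n b| ≤ σ * |a - b| := by
  refine ⟨(1 + n) / σ, by positivity, fun a b ha hb => ?_⟩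
  refine (convex_Ici ((1 + n) / σ)).norm_image_sub_le_of_norm_hasDerivWithin_le
    (fun y _ => (hasDerivAt_ratio hm hn y).hasDerivWithinAt) (fun y hy => ?_) hb ha
  have h1 := one_add_ratio_pos hm hn y
  have h2 := one_sub_ratio_pos hm hn y
  have h3 := (abs_le.1 (abs_ratio_le hm hn y)).2
  rw [Real.norm_eq_abs, abs_of_pos (by positivity)]
  have h4 : 1 - m * ratio m n y ≤ (m + n) * (σ / (2 * (1 + n))) := by
    rw [one_sub_ratio hm hn, div_eq_mul_inv]
    refine mul_le_mul_of_nonneg_left ?_ (by positivity)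
    rw [inv_le_comm₀ (by positivity) (by positivity), inv_div]
    have h5 := Real.add_one_le_exp (2 * y)
    have h6 : (1 + n) / σ ≤ y := hy
    have h7 := Real.exp_pos (2 * y)
    rw [mul_div_assoc]
    nlinarith
  have h8 : 1 + n * ratio m n y ≤ 1 + n := by nlinarith
  calc 2 / (m + n) * ((1 + n * ratio m n y) * (1 - m * ratio m n y))
      ≤ 2 / (m + n) * ((1 + n) * ((m + n) * (σ / (2 * (1 + n))))) := by gcongr
    _ = σ := by field_simp

/-- The derivative of the cone form `w² - ε² y²` for two nearby orbits. The diagonal term is at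
least `2κη w²`; this `ε` makes both cross terms at most `(κη ε/2) |y| |w|`, and `2ε |y| |w| ≤ w² +
ε² y²` finishes. -/
theorem quadratic_growth {r κ η ε y w T G : ℝ} (hr : 0 < r) (hκ0 : 0 < κ) (hη0 : 0 < η)
    (hε : ε = κ * η / (4 * r)) (e1 : η * w ^ 2 ≤ T * w) (e2 : |T| ≤ |w|)
    (e3 : |G| ≤ η * ε * r / 4 * |y|) :
    κ * η / 2 * (w ^ 2 - ε ^ 2 * y ^ 2)
      ≤ 2 * κ * (T * w) - 2 * κ / r * (G * w) - 2 * ε ^ 2 * r * (T * y) := by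
  have hε0 : 0 < ε := by rw [hε]; positivity
  have e4 : G * w ≤ η * ε * r / 4 * (|y| * |w|) := by
    calc G * w ≤ |G * w| := le_abs_self _
      _ = |G| * |w| := abs_mul _ _
      _ ≤ η * ε * r / 4 * |y| * |w| := by gcongr
      _ = _ := by ring
  have e5 : T * y ≤ |y| * |w| := by
    calc T * y ≤ |T * y| := le_abs_self _
      _ = |T| * |y| := abs_mul _ _
      _ ≤ |w| * |y| := by gcongr
      _ = _ := by ring
  have e6 : 2 * ε * (|y| * |w|) ≤ w ^ 2 + ε ^ 2 * y ^ 2 := by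
    rw [← sq_abs w, ← sq_abs y]
    nlinarith [sq_nonneg (|w| - ε * |y|)]
  have e7 : 2 * κ / r * (G * w) ≤ 2 * κ / r * (η * ε * r / 4 * (|y| * |w|)) := by gcongr
  have e8 : 2 * ε ^ 2 * r * (T * y) ≤ 2 * ε ^ 2 * r * (|y| * |w|) := by gcongr
  have e9 : 2 * κ / r * (η * ε * r / 4 * (|y| * |w|)) + 2 * ε ^ 2 * r * (|y| * |w|)
      = κ * η / 2 * (2 * ε * (|y| * |w|)) := by
    rw [hε]; field_simp; ring
  have e10 : κ * η / 2 * (2 * ε * (|y| * |w|)) ≤ κ * η / 2 * (w ^ 2 + ε ^ 2 * y ^ 2) := by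
    gcongr
  have e11 : 2 * κ * (η * w ^ 2) ≤ 2 * κ * (T * w) := by gcongr
  have e12 : 0 ≤ κ * η * w ^ 2 := by positivity
  have e13 : 0 ≤ κ * η * (ε ^ 2 * y ^ 2) := by positivity
  linarith

/-- Two solutions that stay in the strip near an edge and start on the same vertical line
coincide. -/
theorem snd_eq_of_stay (hm : 2 ≤ m) (hn : 2 ≤ n) {q : ℝ} (hq : q < 1) (hq0 : 0 ≤ q) :
    ∃ Y > 0, ∀ z₁ z₂ : ℝ → ℝ × ℝ, IsSol m n z₁ → IsSol m n z₂ → (z₁ 0).1 = (z₂ 0).1 →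
      (∀ t ≥ 0, |Real.tanh (z₁ t).2| ≤ q) → (∀ t ≥ 0, |Real.tanh (z₂ t).2| ≤ q) →
      (∀ t ≥ 0, Y ≤ (z₁ t).1) → (∀ t ≥ 0, Y ≤ (z₂ t).1) → (z₁ 0).2 = (z₂ 0).2 := by
  have hr := radius_pos hm hn
  set r := radius m n with hrdef
  set κ := (m + n - 1) / (m + n) with hκ
  have hκ0 : 0 < κ := div_pos (by linarith) (by linarith)
  set η := 1 - q ^ 2 with hη
  have hη0 : 0 < η := by nlinarith
  set ε := κ * η / (4 * r) with hε
  have hε0 : 0 < ε := by positivity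
  obtain ⟨Y, hY, hlip⟩ := exists_abs_ratio_sub_le hm hn (σ := η * ε * r / 4) (by positivity)
  refine ⟨Y, hY, fun z₁ z₂ h₁ h₂ h0 hq₁ hq₂ hY₁ hY₂ => ?_⟩
  by_contra hne
  -- Starting on one vertical line makes this form positive unless the points agree. It then grows
  -- exponentially, yet `|tanh| ≤ q` bounds the difference of the `w`'s.
  set Q : ℝ → ℝ := fun t => ((z₁ t).2 - (z₂ t).2) ^ 2 - ε ^ 2 * ((z₁ t).1 - (z₂ t).1) ^ 2 with hQ
  have hQ0 : 0 < Q 0 := by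
    have : (z₁ 0).2 - (z₂ 0).2 ≠ 0 := sub_ne_zero.2 hne
    have h := sq_pos_iff.2 this
    simp only [hQ, h0, sub_self]
    linarith
  set lam := κ * η / 2 with hlam
  have hlam0 : 0 < lam := by positivity
  have hQd : ∀ t ≥ 0, ∃ d, HasDerivAt Q d t ∧ lam * Q t ≤ d := fun t ht => by
    have s₁ : HasDerivAt (fun t => (z₁ t).1) (planeField m n (z₁ t)).1 t := (h₁ t).fst
    have s₂ : HasDerivAt (fun t => (z₂ t).1) (planeField m n (z₂ t)).1 t := (h₂ t).fst
    have v₁ : HasDerivAt (fun t => (z₁ t).2) (planeField m n (z₁ t)).2 t := (h₁ t).snd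
    have v₂ : HasDerivAt (fun t => (z₂ t).2) (planeField m n (z₂ t)).2 t := (h₂ t).snd
    have d1 := (v₁.fun_sub v₂).fun_pow 2
    have d2 := ((s₁.fun_sub s₂).fun_pow 2).const_mul (ε ^ 2)
    refine ⟨_, d1.fun_sub d2, ?_⟩
    simp only [planeField, hQ]
    have e1 := tanh_sub_mul_ge (hq₁ t ht) (hq₂ t ht)
    have e2 := abs_tanh_sub_le (z₁ t).2 (z₂ t).2
    have e3 := hlip _ _ (hY₁ t ht) (hY₂ t ht)
    set y := (z₁ t).1 - (z₂ t).1
    set w := (z₁ t).2 - (z₂ t).2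
    set T := Real.tanh (z₁ t).2 - Real.tanh (z₂ t).2 with hT
    set G := ratio m n (z₁ t).1 - ratio m n (z₂ t).1 with hG
    have goal : (2 : ℝ) * w ^ (2 - 1) * (κ * (Real.tanh (z₁ t).2 - ratio m n (z₁ t).1 / r)
        - κ * (Real.tanh (z₂ t).2 - ratio m n (z₂ t).1 / r))
        - ε ^ 2 * (2 * y ^ (2 - 1) * (r * Real.tanh (z₁ t).2 - r * Real.tanh (z₂ t).2))
        = 2 * κ * (T * w) - 2 * κ / r * (G * w) - 2 * ε ^ 2 * r * (T * y) := by
      rw [hT, hG]; norm_num; ring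
    push_cast
    rw [goal, hlam]
    exact quadratic_growth hr hκ0 hη0 hε e1 e2 e3
  choose! d hd hdl using hQd
  have hmono : MonotoneOn (fun t => Q t * Real.exp (-(lam * t))) (Ici 0) := by
    have hE : ∀ t, HasDerivAt (fun t => Real.exp (-(lam * t))) (Real.exp (-(lam * t)) * -(lam * 1)) t :=
      fun t => ((hasDerivAt_id t).const_mul lam).fun_neg.exp
    refine monotoneOn_of_deriv_nonneg (convex_Ici 0)
      (HasDerivAt.continuousOn fun t ht => (hd t ht).mul (hE t))
      (fun t ht => ?_) fun t ht => ?_ <;> rw [interior_Ici] at ht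
    · exact ((hd t (le_of_lt ht)).mul (hE t)).differentiableAt.differentiableWithinAt
    · have := ((hd t (le_of_lt ht)).mul (hE t)).deriv
      simp only [Pi.mul_def] at this
      rw [this]
      have h1 := mul_le_mul_of_nonneg_right (hdl t (le_of_lt ht)) (Real.exp_pos (-(lam * t))).le
      linarith
  have hbound : ∀ t ≥ 0, Q t * η ^ 2 ≤ 4 := fun t ht => by
    have e1 := tanh_sub_mul_ge (hq₁ t ht) (hq₂ t ht)
    have a1 := abs_le.1 (hq₁ t ht)
    have a2 := abs_le.1 (hq₂ t ht)
    have e0 : 0 ≤ ε ^ 2 * ((z₁ t).1 - (z₂ t).1) ^ 2 := by positivity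
    simp only [hQ]
    set w := (z₁ t).2 - (z₂ t).2
    set T := Real.tanh (z₁ t).2 - Real.tanh (z₂ t).2 with hT
    have e2 : T ^ 2 ≤ 4 := by
      have : |T| ≤ 2 := by rw [abs_le]; constructor <;> linarith
      rw [← sq_abs]; nlinarith [abs_nonneg T]
    have e3 := mul_le_mul_of_nonneg_left e1 hη0.le
    have e4 : 0 ≤ η ^ 2 * (ε ^ 2 * ((z₁ t).1 - (z₂ t).1) ^ 2) := by positivity
    nlinarith [sq_nonneg (T - η * w)]
  -- At this time already the linear lower bound of the exponential exceeds the bound `4`.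
  set t := 4 / (Q 0 * η ^ 2 * lam) with ht
  have ht0 : 0 ≤ t := by positivity
  have h1 := hmono (mem_Ici.2 le_rfl) (mem_Ici.2 ht0) ht0
  simp only [mul_zero, neg_zero, Real.exp_zero, mul_one, Real.exp_neg] at h1
  rw [← div_eq_mul_inv, le_div_iff₀ (Real.exp_pos _)] at h1
  have h2 := hbound t ht0
  have h3 := Real.add_one_le_exp (lam * t)
  have h4 : Q 0 * η ^ 2 * (lam * t) = 4 := by rw [ht]; field_simp
  have h5 : 0 < Q 0 * η ^ 2 := by positivity
  nlinarith [mul_le_mul_of_nonneg_left h3 h5.le]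

end

/-! ### Openness and density of the orbits that leave the strip -/

section

variable {m n : ℝ}

theorem continuous_shear (m n : ℝ) : Continuous (shear m n) := continuous_const.mul continuous_tanh

theorem shear_neg (w : ℝ) : shear n m (-w) = -shear m n w := by
  rw [shear, shear, radius_swap, Real.tanh_neg, mul_neg]

theorem disc_shear (hm : 2 ≤ m) (hn : 2 ≤ n) (w : ℝ) :
    m + n - 1 - m * n * shear m n w ^ 2 = (m + n - 1) * (1 - Real.tanh w ^ 2) := by
  rw [shear, mul_pow]
  linear_combination (-Real.tanh w ^ 2) * radius_sq hm hn

theorem continuous_ratio (hm : 2 ≤ m) (hn : 2 ≤ n) : Continuous (ratio m n) :=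
  continuous_iff_continuousAt.2 fun y => (hasDerivAt_ratio hm hn y).continuousAt

theorem continuous_lyap_plane (hm : 2 ≤ m) (hn : 2 ≤ n) :
    Continuous fun z : ℝ × ℝ => lyap m n (ratio m n z.1) (shear m n z.2) := by
  have h1 := continuous_ratio hm hn
  have h2 := continuous_shear m n
  unfold lyap
  refine ((continuous_const.mul (Continuous.log (by fun_prop) fun z => ?_)).add
    (continuous_const.mul (Continuous.log (by fun_prop) fun z => ?_))).add
    (continuous_const.mul (Continuous.log (by fun_prop) fun z => ?_))
  · rw [disc_shear hm hn]
    exact (mul_pos (by linarith) (one_sub_tanh_sq_pos _)).ne'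
  · exact (one_add_ratio_pos hm hn _).ne'
  · exact (one_sub_ratio_pos hm hn _).ne'

/-- `lyap` is bounded below on the compact box `|y| ≤ Y`, `|tanh w| ≤ q`. In the strip, a very
negative value thus means closeness to an edge. -/
theorem exists_lt_abs_of_lyap_le (hm : 2 ≤ m) (hn : 2 ≤ n) {q : ℝ} (hq : q < 1) (Y : ℝ) :
    ∃ L, ∀ z : ℝ × ℝ, |Real.tanh z.2| ≤ q → lyap m n (ratio m n z.1) (shear m n z.2) < L →
      Y < |z.1| := by
  rcases le_or_gt 0 q with hq0 | hq0
  swap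
  · exact ⟨0, fun z hz => absurd ((abs_nonneg _).trans hz) (not_le.2 hq0)⟩
  have hqm : q ∈ Ioo (-1) 1 := ⟨by linarith, hq⟩
  have hqm' : -q ∈ Ioo (-1) 1 := ⟨by linarith, by linarith⟩
  obtain ⟨L, hL⟩ := ((isCompact_Icc (a := -Y) (b := Y)).prod (isCompact_Icc (a := Real.artanh (-q))
    (b := Real.artanh q))).bddBelow_image (continuous_lyap_plane hm hn).continuousOn
  refine ⟨L, fun z hz hl => ?_⟩
  by_contra hc
  push Not at hc
  refine absurd hl (not_lt.2 (hL ⟨z, ⟨abs_le.1 hc, ?_, ?_⟩, rfl⟩))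
  · rw [← strictMono_tanh.le_iff_le, Real.tanh_artanh hqm']
    exact (abs_le.1 hz).1
  · rw [← strictMono_tanh.le_iff_le, Real.tanh_artanh hqm]
    exact (abs_le.1 hz).2

theorem radius_gt_inv' (hm : 2 ≤ m) (hn : 2 ≤ n) : 1 / m < radius m n :=
  PlanarOrbit.radius_gt_inv hm hn

/-- Orbits to the right end point are those that leave the strip to the right. -/
theorem IsSol.tendsto_radius_iff {z : ℝ → ℝ × ℝ} (hz : IsSol m n z) (hm : 2 ≤ m) (hn : 2 ≤ n) :
    Tendsto (fun t => shear m n (z t).2) atTop (𝓝 (radius m n)) ↔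
      ∃ t, 1 / m < shear m n (z t).2 := by
  constructor
  · intro h
    exact (h.eventually (lt_mem_nhds (radius_gt_inv' hm hn))).exists
  · rintro ⟨t, ht⟩
    exact (hz.planarOrbit hm hn).tendsto_of_inv_le hm hn ht.le

theorem IsSol.tendsto_neg_radius_iff {z : ℝ → ℝ × ℝ} (hz : IsSol m n z) (hm : 2 ≤ m)
    (hn : 2 ≤ n) : Tendsto (fun t => shear m n (z t).2) atTop (𝓝 (-radius m n)) ↔
      ∃ t, shear m n (z t).2 < -(1 / n) := by
  have h := (hz.neg hm hn).tendsto_radius_iff hn hm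
  simp only [Prod.snd_neg, shear_neg, radius_swap m n] at h
  refine Iff.trans ⟨fun h1 => by simpa using h1.neg, fun h1 => by simpa using h1.neg⟩
    (h.trans ⟨?_, ?_⟩) <;>
  · rintro ⟨t, ht⟩
    exact ⟨t, by linarith⟩

/-- The points of the phase plane whose orbits leave the strip between the two exceptional
values of the shear. -/
def escapeSet (m n : ℝ) (φ : ℝ → ℝ × ℝ → ℝ × ℝ) : Set (ℝ × ℝ) :=
  {z | (∃ t, 1 / m < shear m n (φ t z).2) ∨ ∃ t, shear m n (φ t z).2 < -(1 / n)}

variable {φ : ℝ → ℝ × ℝ → ℝ × ℝ}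

theorem IsFlow.continuous (hφ : IsFlow m n φ) (t : ℝ) : Continuous (φ t) :=
  hφ.cont.comp (Continuous.prodMk_right t)

theorem IsFlow.neg (hφ : IsFlow m n φ) (hm : 2 ≤ m) (hn : 2 ≤ n) :
    IsFlow n m fun t z => -φ t (-z) where
  zero z := by rw [hφ.zero, neg_neg]
  sol z := (hφ.sol (-z)).neg hm hn
  cont := (hφ.cont.comp (continuous_fst.prodMk continuous_snd.neg)).neg

theorem isOpen_escapeSet (hφ : IsFlow m n φ) : IsOpen (escapeSet m n φ) := by
  have h : ∀ t, Continuous fun z => shear m n (φ t z).2 := fun t =>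
    (continuous_shear m n).comp (continuous_snd.comp (hφ.continuous t))
  have e : escapeSet m n φ = (⋃ t, {z | 1 / m < shear m n (φ t z).2}) ∪
      ⋃ t, {z | shear m n (φ t z).2 < -(1 / n)} := by
    ext z; simp [escapeSet]
  rw [e]
  exact (isOpen_iUnion fun t => isOpen_lt continuous_const (h t)).union
    (isOpen_iUnion fun t => isOpen_lt (h t) continuous_const)

theorem exists_abs_tanh_le (hm : 2 ≤ m) (hn : 2 ≤ n) : ∃ q, 0 ≤ q ∧ q < 1 ∧
    ∀ w, shear m n w ≤ 1 / m → -(1 / n) ≤ shear m n w → |Real.tanh w| ≤ q := by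
  have hr := radius_pos hm hn
  have h1 := radius_gt_inv' hm hn
  have h2 := radius_gt_inv' hn hm
  rw [radius_swap m n] at h2
  refine ⟨max (1 / m) (1 / n) / radius m n, by positivity, (div_lt_one hr).2 (max_lt h1 h2),
    fun w hw hw' => ?_⟩
  have h : |Real.tanh w| * radius m n = |shear m n w| := by
    rw [shear, abs_mul, abs_of_pos hr, mul_comm]
  rw [le_div_iff₀ hr, h, abs_le]
  exact ⟨(neg_le_neg (le_max_right _ _)).trans hw', hw.trans (le_max_left _ _)⟩

/-- No open set of orbits stays in the strip while it drifts to the edge `B = 0`. -/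
theorem IsFlow.exists_lyap_ge_of_stay (hφ : IsFlow m n φ) (hm : 2 ≤ m) (hn : 2 ≤ n) {q : ℝ}
    (hq0 : 0 ≤ q) (hq : q < 1) : ∃ L, ∀ W : Set (ℝ × ℝ), IsOpen W →
      (∀ z ∈ W, ∀ t, |Real.tanh (φ t z).2| ≤ q) → ∀ z ∈ W, ∀ t,
      lyap m n (ratio m n (φ t z).1) (shear m n (φ t z).2) < L → (φ t z).1 ≤ 0 := by
  obtain ⟨Y, hY, huniq⟩ := snd_eq_of_stay hm hn hq hq0
  obtain ⟨L, hL⟩ := exists_lt_abs_of_lyap_le hm hn hq Y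
  refine ⟨L, fun W hW hstay z₀ hz₀ T hT => ?_⟩
  by_contra hc
  push Not at hc
  -- The trapped open set is transported to time `T` and cut down to points already close to the
  -- edge `B = 0`. Below such points `lyap` only decreases, so `|y| > Y` persists and `y` cannot
  -- change sign.
  set V : Set (ℝ × ℝ) := φ (-T) ⁻¹' W ∩ {z | lyap m n (ratio m n z.1) (shear m n z.2) < L} ∩
    {z | 0 < z.1} with hV
  have hVo : IsOpen V := ((hW.preimage (hφ.continuous _)).inter
    (isOpen_lt (continuous_lyap_plane hm hn) continuous_const)).inter
    (isOpen_lt continuous_const continuous_fst)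
  have hz : φ T z₀ ∈ V := by
    refine ⟨⟨?_, hT⟩, hc⟩
    rw [mem_preimage, ← hφ.add hm hn, neg_add_cancel, hφ.zero]
    exact hz₀
  have hstayV : ∀ z ∈ V, ∀ t, |Real.tanh (φ t z).2| ≤ q := fun z hzV t => by
    have := hstay _ hzV.1.1 (t + T)
    rwa [hφ.add hm hn, ← hφ.add hm hn (-T) T, add_neg_cancel, hφ.zero] at this
  have hYV : ∀ z ∈ V, ∀ t ≥ 0, Y ≤ (φ t z).1 := fun z hzV t ht => by
    have hlt : ∀ s ≥ 0, Y < |(φ s z).1| := fun s hs => by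
      refine hL _ (hstayV z hzV s) (lt_of_le_of_lt
        (((hφ.sol z).planarOrbit hm hn).antitone_lyap hm hn hs) ?_)
      simp only [hφ.zero]
      exact hzV.1.2
    have hcont : Continuous fun s => (φ s z).1 := continuous_iff_continuousAt.2 fun s =>
      ((hφ.sol z s).continuousAt).fst
    by_contra hlt'
    push Not at hlt'
    have hneg : (φ t z).1 ≤ 0 := by
      by_contra h0
      push Not at h0
      have := hlt t ht
      rw [abs_of_pos h0] at this
      linarith
    obtain ⟨s, hs, hs0⟩ := intermediate_value_Icc' ht hcont.continuousOn
      (show (0 : ℝ) ∈ Icc _ _ from ⟨hneg, by rw [hφ.zero]; exact (le_of_lt hzV.2)⟩)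
    have := hlt s hs.1
    simp only at hs0
    rw [hs0, abs_zero] at this
    linarith
  obtain ⟨δ, hδ, hball⟩ := Metric.isOpen_iff.1 hVo _ hz
  -- A second point of `V` on the same vertical line, contradicting `snd_eq_of_stay`.
  set z₁ : ℝ × ℝ := ((φ T z₀).1, (φ T z₀).2 + δ / 2) with hz₁
  have hz₁V : z₁ ∈ V := hball (by
    rw [Metric.mem_ball, Prod.dist_eq, hz₁]
    simp only [dist_self, Real.dist_eq, add_sub_cancel_left]
    rw [abs_of_pos (by positivity)]
    exact max_lt hδ (by linarith))
  have h := huniq (φ · z₁) (φ · (φ T z₀)) (hφ.sol _) (hφ.sol _) (by simp only [hφ.zero, hz₁])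
    (fun t _ => hstayV _ hz₁V t) (fun t _ => hstayV _ hz t) (hYV _ hz₁V) (hYV _ hz)
  simp only [hφ.zero, hz₁] at h
  linarith

theorem PlanarOrbit.ne_zero_of_ne_zero {f x : ℝ → ℝ} (h : PlanarOrbit m n f x) (hm : 2 ≤ m)
    (hn : 2 ≤ n) {s : ℝ} (hs : f s ≠ 0 ∨ x s ≠ 0) (t : ℝ) : f t ≠ 0 ∨ x t ≠ 0 := by
  by_contra hc
  push Not at hc
  obtain ⟨h1, h2⟩ := h.eq_zero_of_eq_zero hm hn hc.1 hc.2 s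
  exact hs.elim (absurd h1) (absurd h2)

theorem ratio_eq_zero (hm : 2 ≤ m) (hn : 2 ≤ n) {y : ℝ} : ratio m n y = 0 ↔ y = 0 := by
  simpa only [ratio_zero] using (strictMono_ratio hm hn).injective.eq_iff (a := y) (b := 0)

theorem shear_eq_zero (hm : 2 ≤ m) (hn : 2 ≤ n) {w : ℝ} : shear m n w = 0 ↔ w = 0 := by
  rw [shear, mul_eq_zero, or_iff_right (radius_pos hm hn).ne']
  simpa only [Real.tanh_zero] using strictMono_tanh.injective.eq_iff (a := w) (b := 0)

/-- On an open set of trapped orbits some orbit is nonconstant, so `lyap → -∞` drives it near an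
edge. `exists_lyap_ge_of_stay` and its mirror image rule out `y > 0` and `y < 0`. -/
theorem dense_escapeSet (hφ : IsFlow m n φ) (hm : 2 ≤ m) (hn : 2 ≤ n) :
    Dense (escapeSet m n φ) := by
  rw [dense_iff_inter_open]
  by_contra hc
  push Not at hc
  obtain ⟨W, hW, ⟨z₁, hz₁⟩, hWe⟩ := hc
  obtain ⟨q, hq0, hq, hstrip⟩ := exists_abs_tanh_le hm hn
  have hstay : ∀ z ∈ W, ∀ t, |Real.tanh (φ t z).2| ≤ q := fun z hz t => by
    have : z ∉ escapeSet m n φ := fun h => by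
      have : z ∈ W ∩ escapeSet m n φ := ⟨hz, h⟩
      simp [hWe] at this
    rw [escapeSet, mem_ofPred_eq, not_or] at this
    push Not at this
    exact hstrip _ (this.1 t) (this.2 t)
  obtain ⟨L, hL⟩ := hφ.exists_lyap_ge_of_stay hm hn hq0 hq
  obtain ⟨L', hL'⟩ := (hφ.neg hm hn).exists_lyap_ge_of_stay hn hm hq0 hq
  obtain ⟨z₀, hz₀, hne⟩ : ∃ z ∈ W, z ≠ 0 := by
    by_contra h
    push Not at h
    have h1 : W = {0} := eq_singleton_iff_unique_mem.2 ⟨h z₁ hz₁ ▸ hz₁, h⟩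
    exact not_isOpen_singleton (0 : ℝ × ℝ) (h1 ▸ hW)
  have ho := (hφ.sol z₀).planarOrbit hm hn
  have hne' : ratio m n (φ 0 z₀).1 ≠ 0 ∨ shear m n (φ 0 z₀).2 ≠ 0 := by
    rw [hφ.zero, Ne, Ne, ratio_eq_zero hm hn, shear_eq_zero hm hn, ← not_and_or]
    exact fun h => hne (Prod.ext h.1 h.2)
  have hnet := fun t => ho.ne_zero_of_ne_zero hm hn hne' t
  have hev := (ho.tendsto_lyap_atTop hm hn hnet).eventually (eventually_lt_atBot (min L L'))
  obtain ⟨Lz, hLz⟩ := exists_lt_abs_of_lyap_le hm hn hq 0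
  obtain ⟨t, ht, ht'⟩ := (hev.and ((ho.tendsto_lyap_atTop hm hn hnet).eventually
    (eventually_lt_atBot Lz))).exists
  have hy := hLz _ (hstay z₀ hz₀ t) ht'
  have h1 := hL W hW hstay z₀ hz₀ t (ht.trans_le (min_le_left _ _))
  have h2 := hL' (-W) hW.neg (fun z hz s => by
    rw [Prod.snd_neg, Real.tanh_neg, abs_neg]; exact hstay _ hz s) (-z₀) (by simpa using hz₀) t (by
    rw [neg_neg, Prod.fst_neg, Prod.snd_neg, ratio_neg hn hm, shear_neg]
    refine lt_of_eq_of_lt ?_ (ht.trans_le (min_le_right _ _))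
    simp only [lyap, neg_sq]
    ring_nf)
  rw [neg_neg, Prod.fst_neg] at h2
  rw [abs_pos] at hy
  exact hy (le_antisymm h1 (by linarith))

end

/-! ### The state space as an image of the phase plane -/

section

variable {m n : ℕ} {φ : ℝ → ℝ × ℝ → ℝ × ℝ}

theorem continuousOn_artanh : ContinuousOn Real.artanh (Ioo (-1) 1) := by
  have h : ∀ x ∈ Ioo (-1 : ℝ) 1, 0 < 1 + x ∧ 0 < 1 - x := fun x hx =>
    ⟨by linarith [hx.1], by linarith [hx.2]⟩
  refine ContinuousOn.log (Real.continuous_sqrt.comp_continuousOn (ContinuousOn.div (by fun_prop)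
    (by fun_prop) fun x hx => (h x hx).2.ne')) fun x hx => ?_
  exact (Real.sqrt_pos.2 (div_pos (h x hx).1 (h x hx).2)).ne'

theorem range_ofPlane (hm : 2 ≤ m) (hn : 2 ≤ n) : range (ofPlane m n) = stateSpace m n := by
  refine Subset.antisymm ?_ fun X hX => ⟨_, ofPlane_toPlane hm hn hX⟩
  rintro _ ⟨z, rfl⟩
  exact ofPlane_mem hm hn z

theorem orbitFamily_eq_image (hφ : IsFlow (m : ℝ) n φ) (hm : 2 ≤ m) (hn : 2 ≤ n) (F : State)
    (R : (ℝ → State) → Prop) : orbitFamily m n F R = ofPlane m n ''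
      {z | ConvergesTo (fun t => ofPlane m n (φ t z)) F ∧ R fun t => ofPlane m n (φ t z)} := by
  have hm' : (2 : ℝ) ≤ m := by exact_mod_cast hm
  have hn' : (2 : ℝ) ≤ n := by exact_mod_cast hn
  ext x
  constructor
  · rintro ⟨X, hX, rfl, hF, hR⟩
    obtain ⟨z, hz, rfl⟩ := hX.exists_isSol hm hn
    have h : z = fun t => φ t (z 0) := funext fun t => by
      rw [← hφ.eq hm' hn' hz, add_zero]
    refine ⟨z 0, ?_, rfl⟩
    rw [h] at hF hR
    exact ⟨hF, hR⟩
  · rintro ⟨z, ⟨hF, hR⟩, rfl⟩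
    exact ⟨_, (hφ.sol z).isOrbit hm hn, by simp only [hφ.zero], hF, hR⟩

theorem genericSet_eq_image (hφ : IsFlow (m : ℝ) n φ) (hm : 2 ≤ m) (hn : 2 ≤ n) :
    genericSet m n = ofPlane m n '' escapeSet m n φ := by
  have hm' : (2 : ℝ) ≤ m := by exact_mod_cast hm
  have hn' : (2 : ℝ) ≤ n := by exact_mod_cast hn
  rw [genericSet, orbitFamily_eq_image hφ hm hn, orbitFamily_eq_image hφ hm hn, ← image_union]
  congr 1
  ext z
  simp only [convergesTo_F₁_iff hm hn, convergesTo_F₂_iff hm hn, and_true, mem_union, mem_ofPred_eq,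
    escapeSet, ← (hφ.sol z).tendsto_radius_iff hm' hn', ← (hφ.sol z).tendsto_neg_radius_iff hm' hn']

theorem stateSpace_subset_closure_genericSet (hm : 2 ≤ m) (hn : 2 ≤ n) :
    stateSpace m n ⊆ closure (genericSet m n) := by
  have hm' : (2 : ℝ) ≤ m := by exact_mod_cast hm
  have hn' : (2 : ℝ) ≤ n := by exact_mod_cast hn
  obtain ⟨φ, hφ⟩ := exists_isFlow hm' hn'
  rw [genericSet_eq_image hφ hm hn, ← range_ofPlane hm hn, ← image_univ,
    ← (dense_escapeSet hφ hm' hn').closure_eq]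
  exact image_closure_subset_closure_image (continuous_ofPlane hm hn)

/-- The inverse chart `toPlane` is continuous on an open subset of the ambient space that contains
the state space. -/
theorem exists_isOpen_image_ofPlane (hm : 2 ≤ m) (hn : 2 ≤ n) {E : Set (ℝ × ℝ)} (hE : IsOpen E) :
    ∃ O, IsOpen O ∧ ofPlane m n '' E = stateSpace m n ∩ O := by
  have hr := (radius_pos (m := m) (n := n) (by exact_mod_cast hm) (by exact_mod_cast hn)).ne'
  set D : Set State := {X | 0 < X.1 ∧ 0 < X.2.1 ∧
    0 < (m : ℝ) + n - 1 - m * n * (X.2.2.1 - X.2.2.2) ^ 2} with hD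
  have hDo : IsOpen D := (isOpen_lt continuous_const continuous_fst).inter
    ((isOpen_lt continuous_const (continuous_fst.comp continuous_snd)).inter
      (isOpen_lt continuous_const (f := fun _ => (0 : ℝ)) (g := fun X : State =>
        (m : ℝ) + n - 1 - m * n * (X.2.2.1 - X.2.2.2) ^ 2) (by fun_prop)))
  have hc : ContinuousOn (toPlane m n) D := by
    refine ContinuousOn.prodMk (ContinuousOn.log (ContinuousOn.div (by fun_prop) (by fun_prop)
      fun X hX => hX.2.1.ne') fun X hX => (div_pos hX.1 hX.2.1).ne') ?_
    exact continuousOn_artanh.comp (by fun_prop) fun X hX => div_radius_mem hm hn hX.2.2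
  refine ⟨D ∩ toPlane m n ⁻¹' E, hc.isOpen_inter_preimage hDo hE, Subset.antisymm ?_ ?_⟩
  · rintro _ ⟨z, hz, rfl⟩
    have h := ofPlane_mem hm hn z
    refine ⟨h, ⟨h.2.1, h.2.2, disc_pos_of_mem hm hn h⟩, ?_⟩
    rwa [mem_preimage, toPlane_ofPlane hm hn]
  · rintro X ⟨hX, -, hXE⟩
    exact ⟨_, hXE, ofPlane_toPlane hm hn hX⟩

theorem exists_isOpen_genericSet (hm : 2 ≤ m) (hn : 2 ≤ n) :
    ∃ O : Set State, IsOpen O ∧ genericSet m n = stateSpace m n ∩ O := by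
  have hm' : (2 : ℝ) ≤ m := by exact_mod_cast hm
  have hn' : (2 : ℝ) ≤ n := by exact_mod_cast hn
  obtain ⟨φ, hφ⟩ := exists_isFlow hm' hn'
  rw [genericSet_eq_image hφ hm hn]
  exact exists_isOpen_image_ofPlane hm hn (isOpen_escapeSet hφ)

end

/-! ### Classification of the orbits by their phases of acceleration -/

namespace PlanarOrbit

variable {m n : ℝ} {f x : ℝ → ℝ}

theorem ne_zero_of_tendsto (h : PlanarOrbit m n f x) (hm : 2 ≤ m) (hn : 2 ≤ n) {e : ℝ}
    (he : e ≠ 0) (hx : Tendsto x atTop (𝓝 e)) (t : ℝ) : f t ≠ 0 ∨ x t ≠ 0 := by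
  obtain ⟨s, hs⟩ := (hx.eventually_ne he).exists
  exact h.ne_zero_of_ne_zero hm hn (Or.inr hs) t

theorem Crossing.tendsto_ge (hc : Crossing f x) {e : ℝ} (hx : Tendsto x atTop (𝓝 e)) : 0 ≤ e := by
  obtain ⟨s, -, -, -, hpos⟩ := hc
  refine ge_of_tendsto hx ?_
  filter_upwards [eventually_gt_atTop s] with t ht using (hpos t ht).le

/-- The two kinds of orbits with a positive limit of the shear. -/
theorem cases_of_tendsto_pos (h : PlanarOrbit m n f x) (hm : 2 ≤ m) (hn : 2 ≤ n) {μ β μ' β' : ℝ}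
    (hB : IsBarrier m n μ β) (hB' : IsBarrier n m μ' β') {e : ℝ} (he : 0 < e)
    (hx : Tendsto x atTop (𝓝 e)) : (∀ t, 0 < x t) ∨ Crossing f x := by
  rcases h.cases hm hn hB hB' (h.ne_zero_of_tendsto hm hn he.ne' hx) with h1 | h1 | h1 | h1
  · exact Or.inl h1
  · exact absurd (le_of_tendsto hx (Eventually.of_forall fun t => (h1 t).le)) (not_le.2 he)
  · exact Or.inr h1
  · have := h1.tendsto_ge hx.neg
    linarith

end PlanarOrbit

section

variable {m n : ℕ} {z : ℝ → ℝ × ℝ}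

theorem accelState_ofPlane_pos (hm : 2 ≤ m) (hn : 2 ≤ n) (w : ℝ × ℝ) :
    0 < accelState m n (ofPlane m n w) ↔ 0 < accel m n (ratio m n w.1) (shear m n w.2) := by
  have hn' : (2 : ℝ) ≤ n := by exact_mod_cast hn
  rw [accelState_ofPlane hm hn, mul_pos_iff_of_pos_left (by positivity)]

theorem IsSol.latePhase_of_pos (hz : IsSol (m : ℝ) n z) (hm : 2 ≤ m) (hn : 2 ≤ n)
    (hx : ∀ t, 0 < shear m n (z t).2) (hF : ConvergesTo (fun t => ofPlane m n (z t)) (F₁ m n)) :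
    LatePhase m n fun t => ofPlane m n (z t) := by
  have hm' : (2 : ℝ) ≤ m := by exact_mod_cast hm
  have hn' : (2 : ℝ) ≤ n := by exact_mod_cast hn
  refine latePhase_of_eq_Iio hm hn ?_
  simp only [accelState_ofPlane_pos hm hn]
  exact (hz.planarOrbit hm' hn').accel_eq_Iio_of_pos hm' hn' hx
    (eventually_accel_neg hm hn (accelState_F₁ hm hn) hF)

theorem IsSol.finitePhase_of_crossing (hz : IsSol (m : ℝ) n z) (hm : 2 ≤ m) (hn : 2 ≤ n)
    (hc : PlanarOrbit.Crossing (fun t => ratio m n (z t).1) fun t => shear m n (z t).2)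
    (hF : ConvergesTo (fun t => ofPlane m n (z t)) (F₁ m n)) :
    FinitePhase m n fun t => ofPlane m n (z t) := by
  have hm' : (2 : ℝ) ≤ m := by exact_mod_cast hm
  have hn' : (2 : ℝ) ≤ n := by exact_mod_cast hn
  refine finitePhase_of_eq_Ioo hm hn ?_
  simp only [accelState_ofPlane_pos hm hn]
  exact hc.accel_eq_Ioo (hz.planarOrbit hm' hn') hm' hn'
    (eventually_accel_neg hm hn (accelState_F₁ hm hn) hF)

theorem IsSol.latePhase_of_crossing (hz : IsSol (m : ℝ) n z) (hm : 2 ≤ m) (hn : 2 ≤ n)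
    (hc : PlanarOrbit.Crossing (fun t => -ratio m n (z t).1) fun t => -shear m n (z t).2)
    (hF : ConvergesTo (fun t => ofPlane m n (z t)) (F₂ m n)) :
    LatePhase m n fun t => ofPlane m n (z t) := by
  have hm' : (2 : ℝ) ≤ m := by exact_mod_cast hm
  have hn' : (2 : ℝ) ≤ n := by exact_mod_cast hn
  refine latePhase_of_eq_Iio hm hn ?_
  simp only [accelState_ofPlane_pos hm hn]
  exact PlanarOrbit.Crossing.accel_eq_Iio hc (hz.planarOrbit hm' hn') hm' hn'
    (eventually_accel_neg hm hn (accelState_F₂ hm hn) hF)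

theorem IsSol.decelerating_of_neg (hz : IsSol (m : ℝ) n z) (hm : 2 ≤ m) (hn : 2 ≤ n)
    (hx : ∀ t, shear m n (z t).2 < 0) {F : State} (hF0 : accelState m n F < 0)
    (hF : ConvergesTo (fun t => ofPlane m n (z t)) F) :
    Decelerating m n fun t => ofPlane m n (z t) := by
  have hm' : (2 : ℝ) ≤ m := by exact_mod_cast hm
  have hn' : (2 : ℝ) ≤ n := by exact_mod_cast hn
  refine DoublyWarped.decelerating_of_neg hm hn fun t => ?_
  rw [accelState_ofPlane hm hn]
  exact mul_neg_of_pos_of_neg (by positivity) ((hz.planarOrbit hm' hn').accel_neg_of_neg hm' hn'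
    hx (eventually_accel_neg hm hn hF0 hF) t)

variable {μ β μ' β' : ℝ}

theorem IsSol.cases_F₁ (hz : IsSol (m : ℝ) n z) (hm : 2 ≤ m) (hn : 2 ≤ n)
    (hB : IsBarrier m n μ β) (hB' : IsBarrier n m μ' β')
    (hF : ConvergesTo (fun t => ofPlane m n (z t)) (F₁ m n)) :
    ((∀ t, 0 < shear m n (z t).2) ∧ LatePhase m n fun t => ofPlane m n (z t)) ∨
    (PlanarOrbit.Crossing (fun t => ratio m n (z t).1) (fun t => shear m n (z t).2) ∧
      FinitePhase m n fun t => ofPlane m n (z t)) := by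
  have hm' : (2 : ℝ) ≤ m := by exact_mod_cast hm
  have hn' : (2 : ℝ) ≤ n := by exact_mod_cast hn
  exact ((hz.planarOrbit hm' hn').cases_of_tendsto_pos hm' hn' hB hB' (radius_pos hm' hn')
    ((convergesTo_F₁_iff hm hn).1 hF)).imp (fun h => ⟨h, hz.latePhase_of_pos hm hn h hF⟩)
    fun h => ⟨h, hz.finitePhase_of_crossing hm hn h hF⟩

theorem IsSol.cases_F₂ (hz : IsSol (m : ℝ) n z) (hm : 2 ≤ m) (hn : 2 ≤ n)
    (hB : IsBarrier m n μ β) (hB' : IsBarrier n m μ' β')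
    (hF : ConvergesTo (fun t => ofPlane m n (z t)) (F₂ m n)) :
    ((∀ t, shear m n (z t).2 < 0) ∧ Decelerating m n fun t => ofPlane m n (z t)) ∨
    (PlanarOrbit.Crossing (fun t => -ratio m n (z t).1) (fun t => -shear m n (z t).2) ∧
      LatePhase m n fun t => ofPlane m n (z t)) := by
  have hm' : (2 : ℝ) ≤ m := by exact_mod_cast hm
  have hn' : (2 : ℝ) ≤ n := by exact_mod_cast hn
  have hx := ((convergesTo_F₂_iff hm hn).1 hF).neg
  rw [neg_neg] at hx
  refine ((hz.planarOrbit hm' hn').swap.cases_of_tendsto_pos hn' hm' hB' hB (radius_pos hm' hn')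
    hx).imp (fun h => ?_) fun h => ⟨h, hz.latePhase_of_crossing hm hn h hF⟩
  have h' : ∀ t, shear m n (z t).2 < 0 := fun t => neg_pos.1 (h t)
  exact ⟨h', hz.decelerating_of_neg hm hn h' (accelState_F₂ hm hn) hF⟩

/-- The barrier ending at the saddle is needed from right to left, to send crossing orbits to `F₁`.
The other direction uses that finite and late phases exclude each other. -/
theorem IsSol.finitePhase_iff (hz : IsSol (m : ℝ) n z) (hm : 2 ≤ m) (hn : 2 ≤ n)
    (hB : IsBarrier m n μ (m * (μ - 1))) (hB' : IsBarrier n m μ' β') :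
    (ConvergesTo (fun t => ofPlane m n (z t)) (F₁ m n) ∧
      FinitePhase m n fun t => ofPlane m n (z t)) ↔
    PlanarOrbit.Crossing (fun t => ratio m n (z t).1) fun t => shear m n (z t).2 := by
  have hm' : (2 : ℝ) ≤ m := by exact_mod_cast hm
  have hn' : (2 : ℝ) ≤ n := by exact_mod_cast hn
  constructor
  · rintro ⟨hF, hfin⟩
    refine (hz.cases_F₁ hm hn hB hB' hF).elim (fun h => ?_) And.left
    exact absurd h.2 (not_finite_and_late (exists_corresponds (hz.isOrbit hm hn) hm hn) hfin)
  · intro h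
    have ho := hz.planarOrbit hm' hn'
    obtain ⟨t, ht⟩ := h.exists_inv_le ho hm' hn' hB
    have hF := (convergesTo_F₁_iff hm hn).2 (ho.tendsto_of_inv_le hm' hn' ht)
    exact ⟨hF, hz.finitePhase_of_crossing hm hn h hF⟩

theorem IsSol.latePhase_F₁_iff (hz : IsSol (m : ℝ) n z) (hm : 2 ≤ m) (hn : 2 ≤ n)
    (hB : IsBarrier m n μ β) (hB' : IsBarrier n m μ' β') :
    (ConvergesTo (fun t => ofPlane m n (z t)) (F₁ m n) ∧
      LatePhase m n fun t => ofPlane m n (z t)) ↔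
    (∀ t, 0 < shear m n (z t).2) ∧ ∃ t, 1 / (m : ℝ) ≤ shear m n (z t).2 := by
  have hm' : (2 : ℝ) ≤ m := by exact_mod_cast hm
  have hn' : (2 : ℝ) ≤ n := by exact_mod_cast hn
  constructor
  · rintro ⟨hF, hl⟩
    refine (hz.cases_F₁ hm hn hB hB' hF).elim (fun h => ⟨h.1, ?_⟩) fun h => ?_
    · exact ((hz.tendsto_radius_iff hm' hn').1 ((convergesTo_F₁_iff hm hn).1 hF)).imp
        fun t => le_of_lt
    · exact absurd hl (not_finite_and_late (exists_corresponds (hz.isOrbit hm hn) hm hn) h.2)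
  · rintro ⟨h, t, ht⟩
    have hF := (convergesTo_F₁_iff hm hn).2
      ((hz.planarOrbit hm' hn').tendsto_of_inv_le hm' hn' ht)
    exact ⟨hF, hz.latePhase_of_pos hm hn h hF⟩

theorem IsSol.convergesTo_F₂_of_le (hz : IsSol (m : ℝ) n z) (hm : 2 ≤ m) (hn : 2 ≤ n) {t : ℝ}
    (ht : 1 / (n : ℝ) ≤ -shear m n (z t).2) :
    ConvergesTo (fun t => ofPlane m n (z t)) (F₂ m n) := by
  have hm' : (2 : ℝ) ≤ m := by exact_mod_cast hm
  have hn' : (2 : ℝ) ≤ n := by exact_mod_cast hn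
  have h := ((hz.planarOrbit hm' hn').swap.tendsto_of_inv_le hn' hm' ht).neg
  simp only [neg_neg] at h
  rw [convergesTo_F₂_iff hm hn, ← radius_swap]
  exact h

theorem IsSol.latePhase_F₂_iff (hz : IsSol (m : ℝ) n z) (hm : 2 ≤ m) (hn : 2 ≤ n)
    (hB : IsBarrier m n μ β) (hB' : IsBarrier n m μ' (n * (μ' - 1))) :
    (ConvergesTo (fun t => ofPlane m n (z t)) (F₂ m n) ∧
      LatePhase m n fun t => ofPlane m n (z t)) ↔
    PlanarOrbit.Crossing (fun t => -ratio m n (z t).1) fun t => -shear m n (z t).2 := by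
  have hm' : (2 : ℝ) ≤ m := by exact_mod_cast hm
  have hn' : (2 : ℝ) ≤ n := by exact_mod_cast hn
  constructor
  · rintro ⟨hF, hl⟩
    refine (hz.cases_F₂ hm hn hB hB' hF).elim (fun h => ?_) And.left
    exact absurd hl (not_decelerating_and_late (exists_corresponds (hz.isOrbit hm hn) hm hn) h.2)
  · intro h
    obtain ⟨t, ht⟩ := h.exists_inv_le (hz.planarOrbit hm' hn').swap hn' hm' hB'
    have hF := hz.convergesTo_F₂_of_le hm hn ht
    exact ⟨hF, hz.latePhase_of_crossing hm hn h hF⟩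

theorem IsSol.decelerating_iff (hz : IsSol (m : ℝ) n z) (hm : 2 ≤ m) (hn : 2 ≤ n)
    (hB : IsBarrier m n μ β) (hB' : IsBarrier n m μ' β') :
    (ConvergesTo (fun t => ofPlane m n (z t)) (F₂ m n) ∧
      Decelerating m n fun t => ofPlane m n (z t)) ↔
    (∀ t, 0 < -shear m n (z t).2) ∧ ∃ t, 1 / (n : ℝ) ≤ -shear m n (z t).2 := by
  have hm' : (2 : ℝ) ≤ m := by exact_mod_cast hm
  have hn' : (2 : ℝ) ≤ n := by exact_mod_cast hn
  constructor
  · rintro ⟨hF, hd⟩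
    refine (hz.cases_F₂ hm hn hB hB' hF).elim (fun h => ⟨fun t => neg_pos.2 (h.1 t), ?_⟩)
      fun h => ?_
    · refine ((hz.tendsto_neg_radius_iff hm' hn').1 ((convergesTo_F₂_iff hm hn).1 hF)).imp
        fun t ht => ?_
      linarith
    · exact absurd h.2 (not_decelerating_and_late (exists_corresponds (hz.isOrbit hm hn) hm hn) hd)
  · rintro ⟨h, t, ht⟩
    have hF := hz.convergesTo_F₂_of_le hm hn ht
    exact ⟨hF, hz.decelerating_of_neg hm hn (fun t => neg_pos.1 (h t)) (accelState_F₂ hm hn) hF⟩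

/-- The limiting shear is `-1/n`, so `x < 0` throughout or the orbit crosses downwards. In the
latter case the barrier to the saddle would send it to `F₂`. -/
theorem IsSol.decelerating_of_convergesTo_F_A (hz : IsSol (m : ℝ) n z) (hm : 2 ≤ m) (hn : 2 ≤ n)
    (hB : IsBarrier m n μ (m * (μ - 1))) (hB' : IsBarrier n m μ' (n * (μ' - 1)))
    (hF : ConvergesTo (fun t => ofPlane m n (z t)) (F_A m n)) :
    Decelerating m n fun t => ofPlane m n (z t) := by
  have hm' : (2 : ℝ) ≤ m := by exact_mod_cast hm
  have hn' : (2 : ℝ) ≤ n := by exact_mod_cast hn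
  have hn0 : 0 < 1 / (n : ℝ) := by positivity
  have ho := hz.planarOrbit hm' hn'
  have hx := (tendsto_shear hm hF).neg
  simp only [F_A, zero_sub, neg_neg] at hx
  refine (ho.swap.cases_of_tendsto_pos hn' hm' hB' hB hn0 hx).elim
    (fun h => hz.decelerating_of_neg hm hn (fun t => neg_pos.1 (h t)) (accelState_F_A hn) hF)
    fun h => ?_
  obtain ⟨t, ht⟩ := h.exists_inv_le ho.swap hn' hm' hB'
  exact absurd (tendsto_nhds_unique hx (ho.swap.tendsto_of_inv_le hn' hm' ht))
    (PlanarOrbit.radius_gt_inv hn' hm').ne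

end

/-! ### Orbits near the edges -/

section

variable {m n : ℕ}

theorem ratio_pos_of_lt (hm : 2 ≤ m) (hn : 2 ≤ n) {z : ℝ × ℝ}
    (h : (ofPlane m n z).2.1 < (ofPlane m n z).1) : 0 < ratio m n z.1 := by
  have hm' : (2 : ℝ) ≤ m := by exact_mod_cast hm
  have hn' : (2 : ℝ) ≤ n := by exact_mod_cast hn
  rw [ofPlane_A, lt_mul_iff_one_lt_left (ofPlane_B_pos hm hn z), Real.one_lt_exp_iff] at h
  rw [← ratio_zero m n]
  exact strictMono_ratio hm' hn' h

theorem ratio_neg_of_lt (hm : 2 ≤ m) (hn : 2 ≤ n) {z : ℝ × ℝ}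
    (h : (ofPlane m n z).1 < (ofPlane m n z).2.1) : ratio m n z.1 < 0 := by
  have hm' : (2 : ℝ) ≤ m := by exact_mod_cast hm
  have hn' : (2 : ℝ) ≤ n := by exact_mod_cast hn
  rw [ofPlane_A, mul_lt_iff_lt_one_left (ofPlane_B_pos hm hn z), Real.exp_lt_one_iff] at h
  rw [← ratio_zero m n]
  exact strictMono_ratio hm' hn' h

theorem one_sub_ratio_mul_disc (hm : 2 ≤ m) (hn : 2 ≤ n) (z : ℝ × ℝ) :
    (1 - m * ratio m n z.1) * ((m : ℝ) + n - 1 - m * n * shear m n z.2 ^ 2)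
      = (m + n - 1) * (m + n) ^ 2 * (ofPlane m n z).2.1 ^ 2 := by
  have hm' : (2 : ℝ) ≤ m := by exact_mod_cast hm
  have hn' : (2 : ℝ) ≤ n := by exact_mod_cast hn
  have h : 0 < (m : ℝ) * Real.exp (2 * z.1) + n := by positivity
  have h2 : (m : ℝ) + n ≠ 0 := by positivity
  rw [one_sub_ratio hm' hn', disc_shear hm' hn', ofPlane_B_sq hm hn]
  field_simp

theorem one_add_ratio_mul_disc (hm : 2 ≤ m) (hn : 2 ≤ n) (z : ℝ × ℝ) :
    (1 + n * ratio m n z.1) * ((m : ℝ) + n - 1 - m * n * shear m n z.2 ^ 2)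
      = (m + n - 1) * (m + n) ^ 2 * (ofPlane m n z).1 ^ 2 := by
  have hm' : (2 : ℝ) ≤ m := by exact_mod_cast hm
  have hn' : (2 : ℝ) ≤ n := by exact_mod_cast hn
  have h : 0 < (m : ℝ) * Real.exp (2 * z.1) + n := by positivity
  have h2 : (m : ℝ) + n ≠ 0 := by positivity
  rw [one_add_ratio hm' hn', disc_shear hm' hn', ofPlane_A_sq hm hn]
  field_simp

variable {μ β μ' β' : ℝ}

/-- The region `A < B`, i.e. `f < 0`, serves as neighbourhood: orbits with `x > 0` throughout leave
the origin with `f` increasing and never enter it. -/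
theorem holdsNear_F₁_edgeA (hm : 2 ≤ m) (hn : 2 ≤ n) (hB : IsBarrier m n μ β)
    (hB' : IsBarrier n m μ' β') : HoldsNear m n (F₁ m n) (edgeA m n) (FinitePhase m n) := by
  have hm' : (2 : ℝ) ≤ m := by exact_mod_cast hm
  have hn' : (2 : ℝ) ≤ n := by exact_mod_cast hn
  refine ⟨{X | X.1 < X.2.1}, isOpen_lt continuous_fst (continuous_fst.comp continuous_snd),
    fun X hX => ?_, ?_⟩
  · rw [mem_ofPred_eq, hX.2.1]; exact hX.2.2
  · rintro X hX hF ⟨τ, hτ⟩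
    obtain ⟨z, hz, rfl⟩ := hX.exists_isSol hm hn
    refine (hz.cases_F₁ hm hn hB hB' hF).elim (fun h => ?_) And.right
    exact absurd ((hz.planarOrbit hm' hn').f_pos_of_forall_lt hm' hn' (s := τ) fun t _ => h.1 t)
      (not_lt.2 (ratio_neg_of_lt hm hn hτ).le)

theorem holdsNear_F₂_edgeB (hm : 2 ≤ m) (hn : 2 ≤ n) (hB : IsBarrier m n μ β)
    (hB' : IsBarrier n m μ' β') : HoldsNear m n (F₂ m n) (edgeB m n) (LatePhase m n) := by
  have hm' : (2 : ℝ) ≤ m := by exact_mod_cast hm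
  have hn' : (2 : ℝ) ≤ n := by exact_mod_cast hn
  refine ⟨{X | X.2.1 < X.1}, isOpen_lt (continuous_fst.comp continuous_snd) continuous_fst,
    fun X hX => ?_, ?_⟩
  · rw [mem_ofPred_eq, hX.2.2]; exact hX.2.1
  · rintro X hX hF ⟨τ, hτ⟩
    obtain ⟨z, hz, rfl⟩ := hX.exists_isSol hm hn
    refine (hz.cases_F₂ hm hn hB hB' hF).elim (fun h => ?_) And.right
    exact absurd ((hz.planarOrbit hm' hn').f_neg_of_forall_lt hm' hn' (s := τ) fun t _ => h.1 t)
      (not_lt.2 (ratio_pos_of_lt hm hn hτ).le)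

/-- On the edges the discriminant of the shear is positive. -/
theorem disc_of_constraints {X : State} (hX : Constraints m n X) :
    (m : ℝ) + n - 1 - m * n * (X.2.2.1 - X.2.2.2) ^ 2
      = (m + n) * (m + n - 1) * (m * X.1 ^ 2 + n * X.2.1 ^ 2) := by
  obtain ⟨A, B, P, Q⟩ := X
  obtain ⟨h1, h2⟩ := hX
  simp only [sumSq] at h2 ⊢
  have h3 : (m * P + n * Q : ℝ) = 1 := by linarith
  have h4 : (m * P + n * Q : ℝ) ^ 2 = 1 := by rw [h3]; norm_num
  linear_combination (-((m : ℝ) + n)) * h2 + h4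

/-- The estimate `c D^N ≤ 1 - m f` for crossing orbits, multiplied by `D`, is a polynomial
inequality between `B²` and `D`. Its strict failure is an open condition, and it holds on the edge,
where `B = 0` and `D > 0`. -/
theorem holdsNear_F₁_edgeB (hm : 2 ≤ m) (hn : 2 ≤ n) (hB : IsBarrier m n μ β)
    (hlt : β < m * (μ - 1)) (hB' : IsBarrier n m μ' β') :
    HoldsNear m n (F₁ m n) (edgeB m n) (LatePhase m n) := by
  have hm' : (2 : ℝ) ≤ m := by exact_mod_cast hm
  have hn' : (2 : ℝ) ≤ n := by exact_mod_cast hn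
  obtain ⟨c, hc, N, hN⟩ := PlanarOrbit.exists_le_of_crossing hm' hn' hB hlt
  refine ⟨{X | ((m : ℝ) + n - 1) * (m + n) ^ 2 * X.2.1 ^ 2
    < c * ((m : ℝ) + n - 1 - m * n * (X.2.2.1 - X.2.2.2) ^ 2) ^ (N + 1)},
    isOpen_lt (by fun_prop) (by fun_prop), fun X hX => ?_, ?_⟩
  · have hd : (0 : ℝ) < m + n - 1 := by linarith
    have := hX.2.1
    have h0 : 0 < (m : ℝ) * X.1 ^ 2 := by positivity
    rw [mem_ofPred_eq, disc_of_constraints hX.1, hX.2.2]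
    norm_num
    positivity
  · rintro X hX hF ⟨τ, hτ⟩
    obtain ⟨z, hz, rfl⟩ := hX.exists_isSol hm hn
    refine (hz.cases_F₁ hm hn hB hB' hF).elim And.right fun h => ?_
    have ho := hz.planarOrbit hm' hn'
    have h1 := mul_le_mul_of_nonneg_right (hN _ _ ho h.1 τ) (ho.disc τ).le
    rw [mem_ofPred_eq, ofPlane_sub hm, ← one_sub_ratio_mul_disc hm hn, pow_succ _ N, ← mul_assoc] at hτ
    exact absurd hτ (not_lt.2 h1)

theorem holdsNear_F₂_edgeA (hm : 2 ≤ m) (hn : 2 ≤ n) (hB : IsBarrier m n μ β)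
    (hB' : IsBarrier n m μ' β') (hlt : β' < n * (μ' - 1)) :
    HoldsNear m n (F₂ m n) (edgeA m n) (Decelerating m n) := by
  have hm' : (2 : ℝ) ≤ m := by exact_mod_cast hm
  have hn' : (2 : ℝ) ≤ n := by exact_mod_cast hn
  obtain ⟨c, hc, N, hN⟩ := PlanarOrbit.exists_le_of_crossing hn' hm' hB' hlt
  refine ⟨{X | ((m : ℝ) + n - 1) * (m + n) ^ 2 * X.1 ^ 2
    < c * ((m : ℝ) + n - 1 - m * n * (X.2.2.1 - X.2.2.2) ^ 2) ^ (N + 1)},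
    isOpen_lt (by fun_prop) (by fun_prop), fun X hX => ?_, ?_⟩
  · have hd : (0 : ℝ) < m + n - 1 := by linarith
    have := hX.2.2
    have h0 : 0 < (n : ℝ) * X.2.1 ^ 2 := by positivity
    rw [mem_ofPred_eq, disc_of_constraints hX.1, hX.2.1]
    norm_num
    positivity
  · rintro X hX hF ⟨τ, hτ⟩
    obtain ⟨z, hz, rfl⟩ := hX.exists_isSol hm hn
    refine (hz.cases_F₂ hm hn hB hB' hF).elim And.right fun h => ?_
    have ho := hz.planarOrbit hm' hn'
    have h1 := hN _ _ ho.swap h.1 τ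
    have h2 := mul_le_mul_of_nonneg_right h1 (ho.disc τ).le
    rw [mem_ofPred_eq, ofPlane_sub hm, ← one_add_ratio_mul_disc hm hn, pow_succ _ N, ← mul_assoc] at hτ
    rw [neg_sq, add_comm (n : ℝ) m, mul_comm (n : ℝ) m, mul_neg, sub_neg_eq_add] at h2
    exact absurd hτ (not_lt.2 h2)

end

/-! ### Connectedness of the families of orbits -/

theorem PlanarOrbit.Crossing.shift {f x : ℝ → ℝ} (h : PlanarOrbit.Crossing f x) (s : ℝ) :
    PlanarOrbit.Crossing (fun t => f (t + s)) fun t => x (t + s) := by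
  obtain ⟨r, h1, h2, h3, h4⟩ := h
  exact ⟨r - s, by simpa using h1, by simpa using h2, fun t ht => h3 _ (by linarith),
    fun t ht => h4 _ (by linarith)⟩

section

variable {m n : ℝ} {φ : ℝ → ℝ × ℝ → ℝ × ℝ}

/-- The points on orbits that cross the line `P = Q` upwards. -/
def crossingSet (m n : ℝ) (φ : ℝ → ℝ × ℝ → ℝ × ℝ) : Set (ℝ × ℝ) :=
  {z | PlanarOrbit.Crossing (fun t => ratio m n (φ t z).1) fun t => shear m n (φ t z).2}

/-- The points on orbits with `P > Q` that leave the strip. -/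
def directSet (m n : ℝ) (φ : ℝ → ℝ × ℝ → ℝ × ℝ) : Set (ℝ × ℝ) :=
  {z | (∀ t, 0 < shear m n (φ t z).2) ∧ ∃ t, 1 / m ≤ shear m n (φ t z).2}

theorem IsFlow.mem_crossingSet (hφ : IsFlow m n φ) (hm : 2 ≤ m) (hn : 2 ≤ n) {z : ℝ × ℝ}
    (hz : z ∈ crossingSet m n φ) (s : ℝ) : φ s z ∈ crossingSet m n φ := by
  have h := PlanarOrbit.Crossing.shift hz s
  simpa only [crossingSet, mem_ofPred_eq, hφ.add hm hn] using h

theorem IsFlow.mem_directSet (hφ : IsFlow m n φ) (hm : 2 ≤ m) (hn : 2 ≤ n) {z : ℝ × ℝ}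
    (hz : z ∈ directSet m n φ) (s : ℝ) : φ s z ∈ directSet m n φ := by
  obtain ⟨h1, t, ht⟩ := hz
  refine ⟨fun t => ?_, t - s, ?_⟩ <;> rw [← hφ.add hm hn]
  · exact h1 _
  · rwa [sub_add_cancel]

theorem IsFlow.neg_apply (hφ : IsFlow m n φ) (hm : 2 ≤ m) (hn : 2 ≤ n) (s : ℝ) (z : ℝ × ℝ) :
    φ (-s) (φ s z) = z := by
  rw [← hφ.add hm hn, neg_add_cancel, hφ.zero]

variable {μ β μ' β' : ℝ}

/-- The crossing orbits are parametrized by their point of crossing. -/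
theorem crossingSet_eq_image (hφ : IsFlow m n φ) (hm : 2 ≤ m) (hn : 2 ≤ n)
    (hB : IsBarrier m n μ β) (hB' : IsBarrier n m μ' β') :
    crossingSet m n φ = (fun p : ℝ × ℝ => φ p.1 (p.2, 0)) '' (univ ×ˢ Iio 0) := by
  have hmono := strictMono_ratio hm hn
  ext z
  constructor
  · rintro ⟨s, hxs, hfs, -, -⟩
    refine ⟨(-s, (φ s z).1), ⟨mem_univ _, ?_⟩, ?_⟩
    · rw [← ratio_zero m n] at hfs
      exact hmono.lt_iff_lt.1 hfs
    · have : ((φ s z).1, 0) = φ s z := Prod.ext rfl ((shear_eq_zero hm hn).1 hxs).symm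
      simp only [this]
      exact hφ.neg_apply hm hn s z
  · rintro ⟨⟨s, y⟩, ⟨-, hy⟩, rfl⟩
    refine hφ.mem_crossingSet hm hn (z := (y, 0)) ?_ s
    refine ((hφ.sol (y, 0)).planarOrbit hm hn).crossing_of_zero hm hn hB hB' (s := 0) ?_ ?_
    · simp only [hφ.zero]
      rw [← ratio_zero m n]
      exact hmono hy
    · simp only [hφ.zero]
      exact (shear_eq_zero hm hn).2 rfl

theorem isConnected_crossingSet (hφ : IsFlow m n φ) (hm : 2 ≤ m) (hn : 2 ≤ n)
    (hB : IsBarrier m n μ β) (hB' : IsBarrier n m μ' β') : IsConnected (crossingSet m n φ) := by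
  rw [crossingSet_eq_image hφ hm hn hB hB']
  refine (isConnected_univ.prod isConnected_Iio).image _ (Continuous.continuousOn ?_)
  exact hφ.cont.comp (continuous_fst.prodMk (continuous_snd.prodMk continuous_const))

/-- Before and after the hitting time `g - c` has strict opposite signs. These signs persist for
nearby parameters and confine their hitting times. -/
theorem tendsto_order_of_hitting {X : Type*} [TopologicalSpace X] {g : X → ℝ → ℝ} {c : ℝ}
    (hg : Continuous fun p : X × ℝ => g p.1 p.2) {S : Set X} {T : X → ℝ}
    (hlt : ∀ y ∈ S, ∀ t < T y, g y t < c) (hgt : ∀ y ∈ S, ∀ t, T y < t → c < g y t)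
    (heq : ∀ y ∈ S, g y (T y) = c) : ContinuousOn T S := by
  intro y hy
  refine tendsto_order.2 ⟨fun t ht => ?_, fun t ht => ?_⟩
  · have h1 : ∀ᶠ y' in 𝓝[S] y, g y' t < c := ((hg.comp (Continuous.prodMk_left t)).continuousAt.eventually
      (gt_mem_nhds (hlt y hy t ht))).filter_mono nhdsWithin_le_nhds
    filter_upwards [h1, self_mem_nhdsWithin] with y' h1 hy'
    by_contra hc
    rcases (not_lt.1 hc).eq_or_lt with h | h
    · rw [← h, heq y' hy'] at h1; exact lt_irrefl _ h1
    · exact lt_asymm h1 (hgt y' hy' t h)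
  · have h1 : ∀ᶠ y' in 𝓝[S] y, c < g y' t := ((hg.comp (Continuous.prodMk_left t)).continuousAt.eventually
      (lt_mem_nhds (hgt y hy t ht))).filter_mono nhdsWithin_le_nhds
    filter_upwards [h1, self_mem_nhdsWithin] with y' h1 hy'
    by_contra hc
    rcases (not_lt.1 hc).eq_or_lt with h | h
    · rw [h, heq y' hy'] at h1; exact lt_irrefl _ h1
    · exact lt_asymm h1 (hlt y' hy' t h)

/-- An orbit that starts to the left of the line where the shear is `1 / m` and ends to its right
hits it once. -/
theorem PlanarOrbit.exists_hitting {f x : ℝ → ℝ} (h : PlanarOrbit m n f x) (hm : 2 ≤ m)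
    (hn : 2 ≤ n) (ht : ∃ t, 1 / m ≤ x t) :
    ∃ T, x T = 1 / m ∧ (∀ t < T, x t < 1 / m) ∧ ∀ t, T < t → 1 / m < x t := by
  have hm0 : 0 < 1 / m := by positivity
  obtain ⟨t, ht⟩ := ht
  obtain ⟨s, hs, hst⟩ := (((h.tendsto_atBot hm hn).2.eventually (gt_mem_nhds hm0)).and
    (eventually_le_atBot t)).exists
  obtain ⟨T, -, hT⟩ := intermediate_value_Icc hst h.continuous_x.continuousOn ⟨hs.le, ht⟩
  refine ⟨T, hT, fun r hr => ?_, fun r hr => ?_⟩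
  · by_contra hc
    have := h.strictMonoOn_x hm hn (not_lt.1 hc) (mem_Ici.2 le_rfl) (mem_Ici.2 hr.le) hr
    exact absurd (not_lt.1 hc) (not_le.2 (hT ▸ this))
  · rw [← hT]
    exact h.strictMonoOn_x hm hn hT.ge (mem_Ici.2 le_rfl) (mem_Ici.2 hr.le) hr

theorem not_direct_of_crossing {f x : ℝ → ℝ} (h : PlanarOrbit.Crossing f x)
    (hx : ∀ t, 0 < x t) : False := by
  obtain ⟨s, hs, -⟩ := h
  exact (hx s).ne' hs

theorem mem_directSet_or_crossingSet (hφ : IsFlow m n φ) (hm : 2 ≤ m) (hn : 2 ≤ n)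
    (hB : IsBarrier m n μ β) (hB' : IsBarrier n m μ' β') {z : ℝ × ℝ}
    (hz : 1 / m ≤ shear m n z.2) : z ∈ directSet m n φ ∨ z ∈ crossingSet m n φ := by
  have ho := (hφ.sol z).planarOrbit hm hn
  have h0 : 1 / m ≤ shear m n (φ 0 z).2 := by rwa [hφ.zero]
  exact (ho.cases_of_tendsto_pos hm hn hB hB' (radius_pos hm hn)
    (ho.tendsto_of_inv_le hm hn h0)).imp (fun h => ⟨h, 0, h0⟩) id

theorem shear_artanh_inv (hm : 2 ≤ m) (hn : 2 ≤ n) :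
    shear m n (Real.artanh (1 / m / radius m n)) = 1 / m := by
  have hr := radius_pos hm hn
  have h1 : 0 < 1 / m / radius m n := by positivity
  rw [shear, Real.tanh_artanh ⟨by linarith, (div_lt_one hr).2 (radius_gt_inv' hm hn)⟩]
  field_simp

/-- Along the line where the shear is `1 / m` the crossing orbits lie below the direct ones. -/
theorem ordConnected_crossing_line (hφ : IsFlow m n φ) (hm : 2 ≤ m) (hn : 2 ≤ n)
    (hB : IsBarrier m n μ (m * (μ - 1))) (hB' : IsBarrier n m μ' β') {w : ℝ}
    (hw : shear m n w = 1 / m) : OrdConnected {y | (y, w) ∈ crossingSet m n φ} := by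
  have hinj : ∀ {v}, shear m n v = 1 / m → v = w := fun {v} hv => by
    rw [← hw, shear, shear] at hv
    exact strictMono_tanh.injective (mul_left_cancel₀ (radius_pos hm hn).ne' hv)
  have hhit : ∀ y ∈ Iio (0 : ℝ), ∃ T, shear m n (φ T (y, 0)).2 = 1 / m ∧
      (∀ t < T, shear m n (φ t (y, 0)).2 < 1 / m) ∧
      ∀ t, T < t → 1 / m < shear m n (φ t (y, 0)).2 := fun y hy => by
    have hc : (y, (0 : ℝ)) ∈ crossingSet m n φ := by
      rw [crossingSet_eq_image hφ hm hn hB hB']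
      exact ⟨(0, y), ⟨mem_univ _, hy⟩, hφ.zero _⟩
    have ho := (hφ.sol (y, 0)).planarOrbit hm hn
    exact ho.exists_hitting hm hn (PlanarOrbit.Crossing.exists_inv_le hc ho hm hn hB)
  choose! T hT hlt hgt using hhit
  have hcont : ContinuousOn T (Iio 0) := by
    refine tendsto_order_of_hitting (g := fun y t => shear m n (φ t (y, 0)).2) (c := 1 / m) ?_ hlt
      hgt hT
    exact (continuous_shear m n).comp (continuous_snd.comp (hφ.cont.comp
      (continuous_snd.prodMk (continuous_fst.prodMk continuous_const))))
  have hc' : ContinuousOn (fun y => (φ (T y) (y, 0)).1) (Iio 0) :=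
    continuous_fst.comp_continuousOn (hφ.cont.comp_continuousOn
      (hcont.prodMk (continuousOn_id.prodMk continuousOn_const)))
  -- Each crossing orbit meets the line where the shear is `1/m` exactly once, at a point depending
  -- continuously on its crossing point. So this set is a continuous image of a half-line.
  have heq : {y | (y, w) ∈ crossingSet m n φ} = (fun y => (φ (T y) (y, 0)).1) '' Iio 0 := by
    ext y
    constructor
    · intro hy
      have hy' := hy
      rw [mem_ofPred_eq, crossingSet_eq_image hφ hm hn hB hB'] at hy'
      obtain ⟨⟨s, y₀⟩, ⟨-, hy₀⟩, he⟩ := hy'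
      simp only at he hy₀
      refine ⟨y₀, hy₀, ?_⟩
      have hs : T y₀ = s := by
        have h1 : shear m n (φ s (y₀, 0)).2 = 1 / m := by rw [he, hw]
        rcases lt_trichotomy (T y₀) s with h | h | h
        · exact absurd h1 (hgt y₀ hy₀ s h).ne'
        · exact h
        · exact absurd h1 (hlt y₀ hy₀ s h).ne
      simp only [hs, he]
    · rintro ⟨y₀, hy₀, rfl⟩
      have h1 : ((φ (T y₀) (y₀, 0)).1, w) = φ (T y₀) (y₀, 0) :=
        Prod.ext rfl (hinj (hT y₀ hy₀)).symm
      rw [mem_ofPred_eq, h1, crossingSet_eq_image hφ hm hn hB hB']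
      exact ⟨(T y₀, y₀), ⟨mem_univ _, hy₀⟩, rfl⟩
  rw [heq]
  exact (isPreconnected_Iio.image _ hc').ordConnected

theorem directSet_eq_image (hφ : IsFlow m n φ) (hm : 2 ≤ m) (hn : 2 ≤ n) {w : ℝ}
    (hw : shear m n w = 1 / m) : directSet m n φ =
      (fun p : ℝ × ℝ => φ p.1 (p.2, w)) '' (univ ×ˢ {y | (y, w) ∈ directSet m n φ}) := by
  ext z
  constructor
  · intro hz
    obtain ⟨T, hT, -, -⟩ := ((hφ.sol z).planarOrbit hm hn).exists_hitting hm hn hz.2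
    have h1 : ((φ T z).1, w) = φ T z := by
      refine Prod.ext rfl ?_
      rw [← hw, shear, shear] at hT
      exact (strictMono_tanh.injective (mul_left_cancel₀ (radius_pos hm hn).ne' hT)).symm
    refine ⟨(-T, (φ T z).1), ⟨mem_univ _, ?_⟩, ?_⟩
    · rw [mem_ofPred_eq, h1]
      exact hφ.mem_directSet hm hn hz T
    · simp only [h1]
      exact hφ.neg_apply hm hn T z
  · rintro ⟨⟨s, y⟩, ⟨-, hy⟩, rfl⟩
    exact hφ.mem_directSet hm hn hy s

/-- A point on the strict barrier close to the origin, where the curve is still below `radius`, lies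
on a direct orbit. -/
theorem directSet_nonempty (hφ : IsFlow m n φ) (hm : 2 ≤ m) (hn : 2 ≤ n)
    (hB : IsBarrier m n μ β) (hlt : β < m * (μ - 1)) (hB' : IsBarrier n m μ' β') :
    (directSet m n φ).Nonempty := by
  have hr := radius_pos hm hn
  have hcurve : ∀ᶠ y in 𝓝[>] (0 : ℝ), curve μ β (ratio m n y) < radius m n := by
    have h0 : ContinuousAt (curve μ β) (ratio m n 0) := by
      rw [ratio_zero]; exact continuousAt_curve hB.nonneg le_rfl
    have h1 : ContinuousAt (fun y => curve μ β (ratio m n y)) 0 :=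
      h0.comp (f := ratio m n) (continuous_ratio hm hn).continuousAt
    refine (h1.eventually (gt_mem_nhds ?_)).filter_mono nhdsWithin_le_nhds
    simpa [curve, ratio_zero] using hr
  obtain ⟨y, hy, hy0⟩ := (hcurve.and self_mem_nhdsWithin).exists
  have hf : 0 < ratio m n y := by rw [← ratio_zero m n]; exact strictMono_ratio hm hn hy0
  have hc := curve_pos hB.one_lt hB.nonneg hf
  have hc0 := div_pos hc hr
  set w := Real.artanh (curve μ β (ratio m n y) / radius m n) with hw
  have hsh : shear m n w = curve μ β (ratio m n y) := by
    rw [shear, hw, Real.tanh_artanh ⟨by linarith, (div_lt_one hr).2 hy⟩]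
    field_simp
  exact ⟨(y, w), ((hφ.sol (y, w)).planarOrbit hm hn).direct_of_barrier hm hn hB hlt hB' (s := 0)
    (by simpa only [hφ.zero] using hf) (by simpa only [hφ.zero] using hsh)⟩

theorem isConnected_directSet (hφ : IsFlow m n φ) (hm : 2 ≤ m) (hn : 2 ≤ n) {ν : ℝ}
    (hB : IsBarrier m n μ (m * (μ - 1))) (hs : IsBarrier m n ν β) (hlt : β < m * (ν - 1))
    (hB' : IsBarrier n m μ' β') : IsConnected (directSet m n φ) := by
  set w := Real.artanh (1 / m / radius m n) with hw
  have hsh : shear m n w = 1 / m := shear_artanh_inv hm hn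
  set K := {y | (y, w) ∈ crossingSet m n φ} with hK
  set J := {y | (y, w) ∈ directSet m n φ} with hJ
  have hKo : OrdConnected K := ordConnected_crossing_line hφ hm hn hB hB' hsh
  have hor : ∀ y, y ∈ J ∨ y ∈ K := fun y =>
    mem_directSet_or_crossingSet hφ hm hn hB hB' (z := (y, w)) hsh.ge
  have hnot : ∀ y, y ∈ J → y ∉ K := fun y h1 h2 => not_direct_of_crossing h2 h1.1
  have hneg : ∀ y ∈ J, 0 < y := fun y hy => by
    have := ((hφ.sol (y, w)).planarOrbit hm hn).f_pos_of_forall_lt hm hn (s := 0) fun t _ => hy.1 t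
    simp only [hφ.zero] at this
    rw [← ratio_zero m n] at this
    exact (strictMono_ratio hm hn).lt_iff_lt.1 this
  -- The line splits into `J` and the interval `K`. As `J` lies in `y > 0`, `K` contains `0`, hence
  -- every `y` between `0` and any of its points; so `J` is closed upwards.
  have hJo : OrdConnected J := by
    refine ⟨fun a ha b _ y hy => (hor y).resolve_right fun hyK => hnot a ha ?_⟩
    have h0 : (0 : ℝ) ∈ K := (hor 0).resolve_left fun h => lt_irrefl _ (hneg 0 h)
    exact hKo.out h0 hyK ⟨(hneg a ha).le, hy.1⟩
  refine ⟨directSet_nonempty hφ hm hn hs hlt hB', ?_⟩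
  rw [directSet_eq_image hφ hm hn hsh]
  refine (isPreconnected_univ.prod hJo.isPreconnected).image _ (Continuous.continuousOn ?_)
  exact hφ.cont.comp (continuous_fst.prodMk (continuous_snd.prodMk continuous_const))

end

section

variable {m n : ℕ} {μ β μ' β' : ℝ}

theorem isConnected_finitePhase (hm : 2 ≤ m) (hn : 2 ≤ n)
    (hB : IsBarrier m n μ (m * (μ - 1))) (hB' : IsBarrier n m μ' β') :
    IsConnected (orbitFamily m n (F₁ m n) (FinitePhase m n)) := by
  have hm' : (2 : ℝ) ≤ m := by exact_mod_cast hm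
  have hn' : (2 : ℝ) ≤ n := by exact_mod_cast hn
  obtain ⟨φ, hφ⟩ := exists_isFlow hm' hn'
  rw [orbitFamily_eq_image hφ hm hn]
  simp only [fun z => (hφ.sol z).finitePhase_iff hm hn hB hB']
  exact (isConnected_crossingSet hφ hm' hn' hB hB').image _
    (continuous_ofPlane hm hn).continuousOn

theorem isConnected_latePhase_F₁ (hm : 2 ≤ m) (hn : 2 ≤ n) {ν : ℝ}
    (hB : IsBarrier m n μ (m * (μ - 1))) (hs : IsBarrier m n ν β) (hlt : β < m * (ν - 1))
    (hB' : IsBarrier n m μ' β') :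
    IsConnected (orbitFamily m n (F₁ m n) (LatePhase m n)) := by
  have hm' : (2 : ℝ) ≤ m := by exact_mod_cast hm
  have hn' : (2 : ℝ) ≤ n := by exact_mod_cast hn
  obtain ⟨φ, hφ⟩ := exists_isFlow hm' hn'
  rw [orbitFamily_eq_image hφ hm hn]
  simp only [fun z => (hφ.sol z).latePhase_F₁_iff hm hn hB hB']
  exact (isConnected_directSet hφ hm' hn' hB hs hlt hB').image _
    (continuous_ofPlane hm hn).continuousOn

theorem isConnected_latePhase_F₂ (hm : 2 ≤ m) (hn : 2 ≤ n)
    (hB : IsBarrier m n μ β) (hB' : IsBarrier n m μ' (n * (μ' - 1))) :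
    IsConnected (orbitFamily m n (F₂ m n) (LatePhase m n)) := by
  have hm' : (2 : ℝ) ≤ m := by exact_mod_cast hm
  have hn' : (2 : ℝ) ≤ n := by exact_mod_cast hn
  obtain ⟨φ, hφ⟩ := exists_isFlow hm' hn'
  rw [orbitFamily_eq_image hφ hm hn]
  simp only [fun z => (hφ.sol z).latePhase_F₂_iff hm hn hB hB']
  -- For the flow `-φ t (-z)` of the system with the factors exchanged, downward crossings become
  -- upward ones.
  have h := (isConnected_crossingSet (hφ.neg hm' hn') hn' hm' hB' hB).image Neg.neg
    continuous_neg.continuousOn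
  rw [image_neg_eq_neg] at h
  convert! h.image _ (continuous_ofPlane hm hn).continuousOn using 2
  ext z
  simp only [crossingSet, Set.mem_neg, mem_ofPred_eq, neg_neg, Prod.fst_neg, Prod.snd_neg,
    ratio_neg hn' hm', shear_neg]

theorem isConnected_decelerating (hm : 2 ≤ m) (hn : 2 ≤ n) {ν : ℝ}
    (hB : IsBarrier m n μ β) (hB' : IsBarrier n m μ' (n * (μ' - 1)))
    (hs : IsBarrier n m ν β') (hlt : β' < n * (ν - 1)) :
    IsConnected (orbitFamily m n (F₂ m n) (Decelerating m n)) := by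
  have hm' : (2 : ℝ) ≤ m := by exact_mod_cast hm
  have hn' : (2 : ℝ) ≤ n := by exact_mod_cast hn
  obtain ⟨φ, hφ⟩ := exists_isFlow hm' hn'
  rw [orbitFamily_eq_image hφ hm hn]
  simp only [fun z => (hφ.sol z).decelerating_iff hm hn hB hB']
  have h := (isConnected_directSet (hφ.neg hm' hn') hn' hm' hB' hs hlt hB).image Neg.neg
    continuous_neg.continuousOn
  rw [image_neg_eq_neg] at h
  convert! h.image _ (continuous_ofPlane hm hn).continuousOn using 2
  ext z
  simp only [directSet, Set.mem_neg, mem_ofPred_eq, neg_neg, Prod.snd_neg, shear_neg]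

end

end DoublyWarped

/-! ### The main theorem -/

theorem mainTheorem5 (m n : ℕ) (hm : 2 ≤ m) (hn : 2 ≤ n) :
    -- every orbit corresponds to a vacuum solution, hence to a reduced model
    (∀ X, IsOrbit m n X → ∃ a b, Corresponds m n X a b) ∧
    -- generic orbits fill a relatively open and dense set, and none is eternally accelerating
    ((∃ O : Set State, IsOpen O ∧ genericSet m n = stateSpace m n ∩ O) ∧
      stateSpace m n ⊆ closure (genericSet m n) ∧
      ∀ X, IsOrbit m n X → (ConvergesTo X (F₁ m n) ∨ ConvergesTo X (F₂ m n)) →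
        ∀ a b, Corresponds m n X a b → ¬ ∀ t, 0 < t → AccelAt m n a b t) ∧
    (9 ≤ m + n → (m, n) ≠ (2, 7) → (m, n) ≠ (7, 2) →
      -- orbits ending at `F₁`
      ((∀ X, IsOrbit m n X → ConvergesTo X (F₁ m n) → FinitePhase m n X ∨ LatePhase m n X) ∧
        HoldsNear m n (F₁ m n) (edgeA m n) (FinitePhase m n) ∧
        IsConnected (orbitFamily m n (F₁ m n) (FinitePhase m n)) ∧
        ((m, n) ≠ (2, 8) → (m, n) ≠ (3, 6) →
          HoldsNear m n (F₁ m n) (edgeB m n) (LatePhase m n) ∧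
          IsConnected (orbitFamily m n (F₁ m n) (LatePhase m n)))) ∧
      -- orbits ending at `F₂`
      ((∀ X, IsOrbit m n X → ConvergesTo X (F₂ m n) → Decelerating m n X ∨ LatePhase m n X) ∧
        HoldsNear m n (F₂ m n) (edgeB m n) (LatePhase m n) ∧
        IsConnected (orbitFamily m n (F₂ m n) (LatePhase m n)) ∧
        ((m, n) ≠ (8, 2) → (m, n) ≠ (6, 3) →
          HoldsNear m n (F₂ m n) (edgeA m n) (Decelerating m n) ∧
          IsConnected (orbitFamily m n (F₂ m n) (Decelerating m n)))) ∧
      -- the exceptional orbit ending at `F_A`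
      ∀ X, IsOrbit m n X → ConvergesTo X (F_A m n) → Decelerating m n X) := by
  have generic_not : ∀ X, IsOrbit m n X → (ConvergesTo X (F₁ m n) ∨ ConvergesTo X (F₂ m n)) →
      ∀ a b, Corresponds m n X a b → ¬ ∀ t, 0 < t → AccelAt m n a b t := by
    intro X _ hF a b hab
    have key : ∀ F, accelState m n F < 0 → ConvergesTo X F → ∃ σ, accelState m n (X σ) < 0 :=
      fun F hF h => ((((continuous_accelState m n).tendsto F).comp h).eventually
        (gt_mem_nhds hF)).exists
    exact not_forall_accelAt hm hn (hF.elim (key _ (accelState_F₁ hm hn))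
      (key _ (accelState_F₂ hm hn))) hab
  refine ⟨fun X hX => exists_corresponds hX hm hn, ⟨exists_isOpen_genericSet hm hn,
    stateSpace_subset_closure_genericSet hm hn, generic_not⟩, fun hd h27 h72 => ?_⟩
  have swap : ∀ {a b : ℕ}, (m, n) ≠ (b, a) → (n, m) ≠ (a, b) := fun h h' => by
    simp only [Prod.mk.injEq] at h'
    exact h (Prod.ext h'.2 h'.1)
  have hd' : 9 ≤ n + m := by omega
  -- One barrier for each order of the factors: the first guards the quadrant `f, x > 0`, the second
  -- its mirror image.
  obtain ⟨μ, hB⟩ := exists_isBarrier hm hn hd h27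
  obtain ⟨μ', hB'⟩ := exists_isBarrier hn hm hd' (swap h72)
  refine ⟨⟨fun X hX hF => ?_, holdsNear_F₁_edgeA hm hn hB hB', isConnected_finitePhase hm hn hB hB',
    fun h28 h36 => ?_⟩, ⟨fun X hX hF => ?_, holdsNear_F₂_edgeB hm hn hB hB',
    isConnected_latePhase_F₂ hm hn hB hB', fun h82 h63 => ?_⟩, fun X hX hF => ?_⟩
  · obtain ⟨z, hz, rfl⟩ := hX.exists_isSol hm hn
    exact (hz.cases_F₁ hm hn hB hB' hF).symm.imp And.right And.right
  · obtain ⟨ν, β, hs, hlt⟩ := exists_isBarrier_strict hm hn hd h27 h28 h36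
    exact ⟨holdsNear_F₁_edgeB hm hn hs hlt hB', isConnected_latePhase_F₁ hm hn hB hs hlt hB'⟩
  · obtain ⟨z, hz, rfl⟩ := hX.exists_isSol hm hn
    exact (hz.cases_F₂ hm hn hB hB' hF).imp And.right And.right
  · obtain ⟨ν, β, hs, hlt⟩ := exists_isBarrier_strict hn hm hd' (swap h72) (swap h82) (swap h63)
    exact ⟨holdsNear_F₂_edgeA hm hn hB hs hlt, isConnected_decelerating hm hn hB hB' hs hlt⟩
  · obtain ⟨z, hz, rfl⟩ := hX.exists_isSol hm hn
    exact hz.decelerating_of_convergesTo_F_A hm hn hB hB' hF
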